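/- All logarithms are to base 2, written $\lg$. A $d$-uniform hypergraph is a finite vertex set $V$ with a set of $d$-element subsets of $V$, its edges. A $d$-clique is a complete $d$-partite $d$-uniform hypergraph: it is given by disjoint nonempty parts $V_1,\dots,V_d$, its vertex set is $V_1\cup\dots\cup V_d$, and its edges are all sets $\{v_1,\dots,v_d\}$ with $v_i\in V_i$ for each $i$. A $d$-clique cover of $H$ is a set $\mathcal C$ of $d$-cliques with vertices in $V(H)$ and $E(H)=\bigcup_{K\in\mathcal C}E(K)$; it is a $d$-clique partition if this union is disjoint. The weight of $\mathcal C$ is $\sum_{K\in\mathcal C}|V(K)|$, and the load of a vertex is the number of members of $\mathcal C$ that contain it. Let $\mathsf{MC}_d(H)$ and $\mathsf{MP}_d(H)$ be the minimum weight of a $d$-clique cover and of a $d$-clique partition of $H$, let $\mathsf{LMP}_d(H)$ be the least $m$ such that some $d$-clique partition of $H$ has all loads at most $m$, and let $\mathsf{MC}_d(n)$, $\mathsf{MP}_d(n)$, $\mathsf{LMP}_d(n)$ be the maxima of these quantities over all $n$-vertex $d$-uniform hypergraphs. **Theorem.** For every fixed $d\ge 2$, as $n\to\infty$, $$\Bigl(\frac1{d!}-o_d(1)\Bigr)\frac{n^{d-1}}{\lg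 n}\le\frac{\mathsf{MC}_d(n)}n\le\frac{\mathsf{MP}_d(n)}n\le\mathsf{LMP}_d(n)\le\Bigl(\frac1{d!}+o_d(1)\Bigr)\frac{n^{d-1}}{\lg n},$$ so that $\mathsf{MC}_d(n)/n$, $\mathsf{MP}_d(n)/n$ and $\mathsf{LMP}_d(n)$ are all asymptotic to $\frac1{d!}\frac{n^{d-1}}{\lg n}$. Moreover, every $n$-vertex $d$-uniform hypergraph has a $d$-clique partition that has at most $O_d(n^d/\lg^3 n)$ members and in which every vertex has load at most $\bigl(\frac1{d!}+o_d(1)\bigr)\frac{n^{d-1}}{\lg n}$. Such a partition can be constructed deterministically in time $O(n^d/d!)$. That is, there is an absolute constant $A$ such that for every $d\ge2$ there is a program for a word RAM with words of $O_d(\lg n)$ bits which, given $n$ and random access to the $d$-dimensional $0/1$ adjacency array of any hypergraph $H$ on $\{0,\dots,n-1\}$, halts and writes out such a partition (each $d$-clique part by part, each part as its size followed by its vertices), and which takes at most $A\,n^d/d!$ steps whenever $n\ge N(d)$, for some $N(d)$ depending only on $d$. -/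

import Mathlib

/-- A `d`-uniform hypergraph on the vertex set `V`. -/
structure UniformHypergraph (d : ℕ) (V : Type*) where
  edges : Finset (Finset V)
  uniform : ∀ e ∈ edges, e.card = d

/-- A complete `d`-partite `d`-uniform hypergraph (a `d`-clique) on vertices of `V`, given by its
parts. (A tuple with an empty part has no edges, so it is useless in covers and partitions.) -/
structure DClique (d : ℕ) (V : Type*) where
  parts : Fin d → Finset V
  nonempty : ∀ i, (parts i).Nonempty
  disjoint : ∀ i j, i ≠ j → Disjoint (parts i) (parts j)
  deriving DecidableEq

namespace DClique

variable {d : ℕ} {V : Type*} [DecidableEq V]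

/-- The edges `{v₁, …, v_d}` with `vᵢ` in the `i`-th part for every `i`. -/
def edges (K : DClique d V) : Finset (Finset V) :=
  (Fintype.piFinset K.parts).image fun v => Finset.univ.image v

/-- The vertex set: the union of the parts. -/
def vertices (K : DClique d V) : Finset V := Finset.univ.biUnion K.parts

/-- The total number of vertices of the members of a set of `d`-cliques. -/
def weight (C : Finset (DClique d V)) : ℕ := ∑ K ∈ C, K.vertices.card

/-- The number of members of `C` that contain the vertex `v`. -/
def load (C : Finset (DClique d V)) (v : V) : ℕ := (C.filter fun K => v ∈ K.vertices).card

end DClique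

namespace UniformHypergraph

variable {d : ℕ} {V : Type*} [DecidableEq V]

/-- `C` is a cover of `H` by `d`-cliques: the union of their edge sets is the edge set of `H`. -/
def IsCover (H : UniformHypergraph d V) (C : Finset (DClique d V)) : Prop :=
  (∀ K ∈ C, K.edges ⊆ H.edges) ∧ ∀ e ∈ H.edges, ∃ K ∈ C, e ∈ K.edges

/-- `C` is a partition of `H` into `d`-cliques: the edge set of `H` is the disjoint union of the
edge sets of the members of `C`. -/
def IsPartition (H : UniformHypergraph d V) (C : Finset (DClique d V)) : Prop :=
  (∀ K ∈ C, K.edges ⊆ H.edges) ∧ ∀ e ∈ H.edges, ∃! K, K ∈ C ∧ e ∈ K.edges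

/-- The minimum weight of a `d`-clique cover of `H`. -/
noncomputable def mc (H : UniformHypergraph d V) : ℕ :=
  sInf {w | ∃ C, H.IsCover C ∧ DClique.weight C = w}

/-- The minimum weight of a `d`-clique partition of `H`. -/
noncomputable def mp (H : UniformHypergraph d V) : ℕ :=
  sInf {w | ∃ C, H.IsPartition C ∧ DClique.weight C = w}

/-- The least `m` such that some `d`-clique partition of `H` has every vertex in at most `m` of
its members. -/
noncomputable def lmp (H : UniformHypergraph d V) : ℕ :=
  sInf {m | ∃ C, H.IsPartition C ∧ ∀ v, DClique.load C v ≤ m}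

theorem IsPartition.isCover {H : UniformHypergraph d V} {C : Finset (DClique d V)}
    (h : H.IsPartition C) : H.IsCover C :=
  ⟨h.1, fun e he => (h.2 e he).exists⟩

/-- The sets over which the minima above are taken are not empty. -/
theorem exists_isPartition (H : UniformHypergraph d V) : ∃ C, H.IsPartition C := by
  classical
  have key : ∀ e : {e // e ∈ H.edges}, ∃ K : DClique d V, K.edges = {e.1} := by
    rintro ⟨e, he⟩
    have f := (e.equivFinOfCardEq (H.uniform e he)).symm
    refine ⟨⟨fun i => {(f i).1}, fun i => Finset.singleton_nonempty _, fun i j hij => ?_⟩, ?_⟩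
    · exact Finset.disjoint_singleton.2 fun h => hij (f.injective (Subtype.ext h))
    · ext s
      simp only [DClique.edges, Finset.mem_image, Fintype.mem_piFinset, Finset.mem_singleton]
      have hu : Finset.univ.image (fun i => (f i).1) = e := by
        ext x
        simp only [Finset.mem_image, Finset.mem_univ, true_and]
        exact ⟨fun ⟨i, hi⟩ => hi ▸ (f i).2, fun hx => ⟨f.symm ⟨x, hx⟩, by simp⟩⟩
      constructor
      · rintro ⟨v, hv, rfl⟩
        rw [← hu, funext hv]
      · rintro rfl
        exact ⟨fun i => (f i).1, fun _ => rfl, hu⟩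
  choose K hK using key
  refine ⟨Finset.univ.image K, ?_, fun e he => ⟨K ⟨e, he⟩, ?_, ?_⟩⟩
  · intro L hL
    obtain ⟨e, -, rfl⟩ := Finset.mem_image.1 hL
    simp [hK]
  · simp [hK]
  · rintro L ⟨hL, heL⟩
    obtain ⟨e', -, rfl⟩ := Finset.mem_image.1 hL
    have : e = e'.1 := by simpa [hK] using heL
    subst this
    rfl

/-- There are finitely many hypergraphs on a finite vertex set, so the suprema of `ℕ`-valued
functions below are maxima. -/
instance instFinite [Finite V] : Finite (UniformHypergraph d V) :=
  Finite.of_injective UniformHypergraph.edges fun H H' h => by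
    cases H; cases H'; cases h; rfl

/-- The maximum of `mc H` over the `d`-uniform hypergraphs on `n` vertices. -/
noncomputable def maxMC (d n : ℕ) : ℕ := ⨆ H : UniformHypergraph d (Fin n), H.mc

/-- The maximum of `mp H` over the `d`-uniform hypergraphs on `n` vertices. -/
noncomputable def maxMP (d n : ℕ) : ℕ := ⨆ H : UniformHypergraph d (Fin n), H.mp

/-- The maximum of `lmp H` over the `d`-uniform hypergraphs on `n` vertices. -/
noncomputable def maxLMP (d n : ℕ) : ℕ := ⨆ H : UniformHypergraph d (Fin n), H.lmp

end UniformHypergraph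

/-! ### A word RAM

Programs work on registers, a random-access memory, a read-only random-access input, and a
write-only output. Every elementary instruction and every test costs one step. -/

namespace WordRAM

/-- Arithmetic on words: subtraction is truncated at `0`, division rounds down. -/
inductive Arith
  | add | sub | mul | div

def Arith.eval : Arith → ℕ → ℕ → ℕ
  | .add, x, y => x + y
  | .sub, x, y => x - y
  | .mul, x, y => x * y
  | .div, x, y => x / y

inductive Program
  /-- do nothing -/
  | skip
  /-- put the constant `c` into register `r` -/
  | const (r c : ℕ)
  /-- put the result of an operation on registers `a` and `b` into register `r` -/
  | arith (o : Arith) (r a b : ℕ)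
  /-- put the memory cell addressed by register `a` into register `r` -/
  | load (r a : ℕ)
  /-- put register `b` into the memory cell addressed by register `a` -/
  | store (a b : ℕ)
  /-- put the input cell addressed by register `a` into register `r` -/
  | read (r a : ℕ)
  /-- append register `a` to the output -/
  | emit (a : ℕ)
  /-- run `p`, then `q` -/
  | seq (p q : Program)
  /-- run `p` if register `a` is not `0`, and `q` otherwise -/
  | ite (a : ℕ) (p q : Program)
  /-- as long as register `a` is not `0`, run `p` -/
  | loop (a : ℕ) (p : Program)

structure State where
  reg : ℕ → ℕ
  mem : ℕ → ℕ
  out : List ℕ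

def State.setReg (s : State) (r x : ℕ) : State := { s with reg := Function.update s.reg r x }

/-- `Exec inp W p s s' t`: on the input `inp`, the program `p` started in `s` halts in `s'` after
exactly `t` steps, and every value that it computes on the way is less than `W`. A run that
exceeds `W` is not a run on words of `log₂ W` bits, and is not allowed. -/
inductive Exec (inp : ℕ → ℕ) (W : ℕ) : Program → State → State → ℕ → Prop
  | skip (s : State) : Exec inp W .skip s s 1
  | const (s : State) (r c : ℕ) (h : c < W) : Exec inp W (.const r c) s (s.setReg r c) 1
  | arith (s : State) (o : Arith) (r a b : ℕ) (h : o.eval (s.reg a) (s.reg b) < W) :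
      Exec inp W (.arith o r a b) s (s.setReg r (o.eval (s.reg a) (s.reg b))) 1
  | load (s : State) (r a : ℕ) :
      Exec inp W (.load r a) s (s.setReg r (s.mem (s.reg a))) 1
  | store (s : State) (a b : ℕ) :
      Exec inp W (.store a b) s { s with mem := Function.update s.mem (s.reg a) (s.reg b) } 1
  | read (s : State) (r a : ℕ) (h : inp (s.reg a) < W) :
      Exec inp W (.read r a) s (s.setReg r (inp (s.reg a))) 1
  | emit (s : State) (a : ℕ) :
      Exec inp W (.emit a) s { s with out := s.out ++ [s.reg a] } 1
  | seq {p q : Program} {s s' s'' : State} {t t' : ℕ}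
      (h : Exec inp W p s s' t) (h' : Exec inp W q s' s'' t') :
      Exec inp W (.seq p q) s s'' (t + t')
  | ite_pos {p q : Program} {s s' : State} {t a : ℕ} (h : s.reg a ≠ 0)
      (h' : Exec inp W p s s' t) : Exec inp W (.ite a p q) s s' (1 + t)
  | ite_zero {p q : Program} {s s' : State} {t a : ℕ} (h : s.reg a = 0)
      (h' : Exec inp W q s s' t) : Exec inp W (.ite a p q) s s' (1 + t)
  | loop_pos {p : Program} {s s' s'' : State} {t t' a : ℕ} (h : s.reg a ≠ 0)
      (h' : Exec inp W p s s' t) (h'' : Exec inp W (.loop a p) s' s'' t') :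
      Exec inp W (.loop a p) s s'' (1 + t + t')
  | loop_zero {p : Program} {s : State} {a : ℕ} (h : s.reg a = 0) :
      Exec inp W (.loop a p) s s 1

/-- The model is deterministic: the final state and the number of steps are functions of the
program, the input and the initial state, and do not depend on the word size. -/
theorem Exec.deterministic {inp : ℕ → ℕ} {W W' : ℕ} {p : Program} {s s₁ s₂ : State} {t₁ t₂ : ℕ}
    (h₁ : Exec inp W p s s₁ t₁) (h₂ : Exec inp W' p s s₂ t₂) : s₁ = s₂ ∧ t₁ = t₂ := by
  induction h₁ generalizing s₂ t₂ with
  | seq _ _ ih ih' =>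
    cases h₂ with
    | seq k k' =>
      obtain ⟨rfl, rfl⟩ := ih k
      obtain ⟨rfl, rfl⟩ := ih' k'
      exact ⟨rfl, rfl⟩
  | ite_pos h _ ih =>
    cases h₂ with
    | ite_pos _ k => obtain ⟨rfl, rfl⟩ := ih k; exact ⟨rfl, rfl⟩
    | ite_zero k _ => exact absurd k h
  | ite_zero h _ ih =>
    cases h₂ with
    | ite_pos k _ => exact absurd h k
    | ite_zero _ k => obtain ⟨rfl, rfl⟩ := ih k; exact ⟨rfl, rfl⟩
  | loop_pos h _ _ ih ih' =>
    cases h₂ with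
    | loop_pos _ k k' =>
      obtain ⟨rfl, rfl⟩ := ih k
      obtain ⟨rfl, rfl⟩ := ih' k'
      exact ⟨rfl, rfl⟩
    | loop_zero k => exact absurd k h
  | loop_zero h =>
    cases h₂ with
    | loop_pos k _ _ => exact absurd h k
    | loop_zero _ => exact ⟨rfl, rfl⟩
  | _ => cases h₂; exact ⟨rfl, rfl⟩

/-- The initial state: `n` in register `0`, and everything else zero or empty. -/
def start (n : ℕ) : State where
  reg := Function.update (fun _ => 0) 0 n
  mem := fun _ => 0
  out := []

open Classical in
/-- The input is the `d`-dimensional adjacency array of `H`, of `n ^ d` cells with entries `0` and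
`1`: the cell of `(v₀, …, v_{d-1})` has the address `∑ vᵢ nⁱ`, and it holds `1` if and only if
`{v₀, …, v_{d-1}}` is an edge. -/
noncomputable def adjacencyArray {d n : ℕ} (H : UniformHypergraph d (Fin n)) (a : ℕ) : ℕ :=
  if ∃ v : Fin d → Fin n, a = ∑ i, (v i : ℕ) * n ^ (i : ℕ) ∧ Finset.univ.image v ∈ H.edges
  then 1 else 0

/-- The words `w` describe the `d`-clique `K`: for each part in turn its size, followed by a list
of its vertices, in any order and without repetition. -/
def Describes {d n : ℕ} (w : List ℕ) (K : DClique d (Fin n)) : Prop :=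
  ∃ P : Fin d → List (Fin n),
    (∀ i, (P i).Nodup ∧ (P i).toFinset = K.parts i) ∧
    w = (List.ofFn P).flatMap fun l => l.length :: l.map Fin.val

/-- The words `w` are a concatenation of descriptions of the members of `L`, in order. -/
def DescribesList {d n : ℕ} (w : List ℕ) (L : List (DClique d (Fin n))) : Prop :=
  ∃ ws : List (List ℕ), List.Forall₂ Describes ws L ∧ w = ws.flatten

/-- On the adjacency array of `H`, with words of `κ log₂ (n + 2)` bits, the program `p` halts
after `t` steps, and its output is the list `L` of `d`-cliques. -/
def Outputs {d n : ℕ} (p : Program) (κ : ℕ) (H : UniformHypergraph d (Fin n))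
    (L : List (DClique d (Fin n))) (t : ℕ) : Prop :=
  ∃ s : State, Exec (adjacencyArray H) ((n + 2) ^ κ) p (start n) s t ∧ DescribesList s.out L

end WordRAM

/-! Lower bound. A cover determines its hypergraph, so the `2 ^ n.choose d` hypergraphs have
distinct minimum covers, all of weight at most `maxMC d n`. A clique is a partial colouring of the
vertices with `d` colours, so the sum of `z ^ weight` over all sets of cliques is at most `exp ((1 +
d z) ^ n)`. With `z = 1 / (d n)` this is bounded, and `n.choose d ≤ maxMC d n * (lg d + lg n) +
O(1)` follows (`choose_le_maxMC_mul_logb`). The middle inequalities hold because a partition is a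
cover and the weight is the sum of the loads.

Upper bound. Let `d = D + 2`. Cut the vertices into `m` blocks of `k` consecutive ones, with `k`
about `lg n` and `k ^ 2 * 2 ^ k ≤ n`. Suppose that every edge has been given a canonical order of
its vertices. Fix the first `D` vertices `t`, the block `i` of the last vertex and a nonempty set
`S` in this block. The vertices `b` for which the canonical extensions of `(t, b)` in block `i` are
exactly `S` form a clique with `S` and the singletons of `t`. These cliques partition the edges, and
there are at most `n ^ D * m * 2 ^ k = O(n ^ d / lg ^ 3 n)` of them. A vertex has small load from
the singleton parts and from the parts `S`. As a `b` it lies in at most one clique for each pair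
`(t, i)`, and only pairs compatible with the canonical order count.

Everything thus depends on an order in which each vertex comes next to last equally often. Sort the
vertices of an edge by the rank `d β - σ` modulo `m` of their block `β`, where `σ` is the sum of all
`d` blocks, and break ties by the vertex. The rank does not change when all blocks are shifted by
the same residue, so every block is equally frequent in every position. As `m` is prime to `d`,
different blocks have different ranks, and a set of `d` distinct blocks has just one strictly sorted
order. So about `m ^ (D + 1) / d!` block patterns have a given block next to last
(`factorial_mul_card_sorted_le`), which gives the load `n ^ (D + 1) / (d! k)`
(`factorial_mul_vertexAccepted_le`, `load_le`).

Algorithm. For all `t`, `i`, `b` a test of `O(D)` steps decides whether `(t, b)` can be followed by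
block `i`; this costs `O_d(n ^ d / k)` in all. Only for the accepted triples, about `n ^ d / (d! k)`
in number, are the `k` adjacencies read, and `b` is put into the bucket numbered by the resulting
bit string. This is the main cost, `13 n ^ d / d!`. The run is verified by weakest preconditions
(`wp_partitionProgram`), its output is shown to describe a partition (`exists_cliqueList`), and
`exists_outputs` collects all bounds. -/

namespace DClique

/-! ### Cliques as partial colourings, and their generating function. -/

variable {d : ℕ} {V : Type*}

theorem parts_injective : Function.Injective (DClique.parts : DClique d V → Fin d → Finset V) := by
  intro K L h
  cases K; cases L; cases h; rfl

instance instFinite [Finite V] : Finite (DClique d V) :=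
  Finite.of_injective _ parts_injective

variable [DecidableEq V]

theorem mem_vertices {K : DClique d V} {v : V} : v ∈ K.vertices ↔ ∃ i, v ∈ K.parts i := by
  simp [vertices]

/-- The index of the part that contains a vertex, if there is one. -/
noncomputable def partIndex (K : DClique d V) (v : V) : Option (Fin d) := by
  classical exact if h : ∃ i, v ∈ K.parts i then some h.choose else none

theorem partIndex_eq_some {K : DClique d V} {v : V} {i : Fin d} :
    K.partIndex v = some i ↔ v ∈ K.parts i := by
  unfold partIndex
  constructor
  · intro h
    split_ifs at h with h'
    cases h
    exact h'.choose_spec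
  · intro h
    have h' : ∃ i, v ∈ K.parts i := ⟨i, h⟩
    rw [dif_pos h']
    by_contra hne
    have hne' : h'.choose ≠ i := fun h => hne (by rw [h])
    exact Finset.disjoint_left.1 (K.disjoint _ _ hne') h'.choose_spec h

theorem partIndex_eq_none {K : DClique d V} {v : V} :
    K.partIndex v = none ↔ v ∉ K.vertices := by
  rw [mem_vertices, Option.eq_none_iff_forall_not_mem]
  simp [partIndex_eq_some]

/-- Since the parts are disjoint, a clique is a partial colouring of the vertices with `d` colours.
Counting colourings instead of cliques only increases the count. -/
theorem partIndex_injective :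
    Function.Injective (partIndex : DClique d V → V → Option (Fin d)) := by
  intro K L h
  apply parts_injective
  ext i v
  rw [← partIndex_eq_some, ← partIndex_eq_some, h]

theorem weight_eq_sum_load [Fintype V] (C : Finset (DClique d V)) :
    weight C = ∑ v, load C v := by
  unfold weight load
  simp only [Finset.card_filter]
  rw [Finset.sum_comm]
  refine Finset.sum_congr rfl fun K _ => ?_
  rw [← Finset.card_filter]
  congr 1
  ext v
  simp

open Classical in
/-- A generating function bound for the number of cliques by their number of vertices. -/
theorem sum_pow_card_vertices_le [Fintype V] [Fintype (DClique d V)] {z : ℝ} (hz : 0 ≤ z) :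
    ∑ K : DClique d V, z ^ K.vertices.card ≤ (1 + d * z) ^ Fintype.card V := by
  -- An uncovered vertex has weight `1` and a covered one `z`, whichever of the `d` parts contains
  -- it. The sum over all colourings then factors over the vertices.
  let w : Option (Fin d) → ℝ := fun o => o.elim 1 fun _ => z
  have hw : ∀ o, 0 ≤ w o := by rintro (_ | _) <;> simp [w, hz]
  have h1 : ∀ K : DClique d V, z ^ K.vertices.card = ∏ v, w (K.partIndex v) := by
    intro K
    rw [← Finset.prod_const, ← Finset.prod_subset (Finset.subset_univ K.vertices)]
    · refine Finset.prod_congr rfl fun v hv => ?_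
      cases h : K.partIndex v with
      | none => exact absurd hv (partIndex_eq_none.1 h)
      | some i => rfl
    · intro v _ hv
      rw [partIndex_eq_none.2 hv]
      rfl
  have h2 : (1 + d * z) ^ Fintype.card V = ∑ f : V → Option (Fin d), ∏ v, w (f v) := by
    rw [← Fintype.piFinset_univ, Finset.sum_prod_piFinset]
    simp [w, Fintype.sum_option]
  rw [h2]
  simp only [h1]
  rw [← Finset.sum_image (f := fun f => ∏ v, w (f v)) (g := partIndex)
    fun _ _ _ _ h => partIndex_injective h]
  exact Finset.sum_le_sum_of_subset_of_nonneg (Finset.subset_univ _)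
    fun f _ _ => Finset.prod_nonneg fun v _ => hw _

open Classical in
/-- The number of sets of cliques of bounded weight. -/
theorem card_weight_le_mul_pow_le [Fintype V] [Fintype (DClique d V)] {z : ℝ} (hz : 0 < z)
    (hz1 : z ≤ 1) (W : ℕ) :
    ((Finset.univ.filter fun C : Finset (DClique d V) => weight C ≤ W).card : ℝ) * z ^ W ≤
      Real.exp ((1 + d * z) ^ Fintype.card V) := by
  calc ((Finset.univ.filter fun C : Finset (DClique d V) => weight C ≤ W).card : ℝ) * z ^ W
      = ∑ C ∈ Finset.univ.filter fun C : Finset (DClique d V) => weight C ≤ W, z ^ W := by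
        rw [Finset.sum_const, nsmul_eq_mul]
    _ ≤ ∑ C ∈ Finset.univ.filter fun C : Finset (DClique d V) => weight C ≤ W,
          z ^ weight C :=
        Finset.sum_le_sum fun C hC =>
          pow_le_pow_of_le_one hz.le hz1 (Finset.mem_filter.1 hC).2
    _ ≤ ∑ C : Finset (DClique d V), z ^ weight C :=
        Finset.sum_le_sum_of_subset_of_nonneg (Finset.filter_subset _ _)
          fun C _ _ => by positivity
    _ = ∑ C : Finset (DClique d V), ∏ K ∈ C, z ^ K.vertices.card :=
        Finset.sum_congr rfl fun C _ => (Finset.prod_pow_eq_pow_sum _ _ _).symm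
    -- The weight is additive over the members of a set of cliques, so the sum over all sets is a
    -- product over all cliques.
    _ = ∏ K : DClique d V, (1 + z ^ K.vertices.card) := by
        rw [Finset.prod_one_add, Finset.powerset_univ]
    _ ≤ ∏ K : DClique d V, Real.exp (z ^ K.vertices.card) :=
        Finset.prod_le_prod (fun K _ => by positivity)
          fun K _ => by rw [add_comm]; exact Real.add_one_le_exp _
    _ = Real.exp (∑ K : DClique d V, z ^ K.vertices.card) := (Real.exp_sum _ _).symm
    _ ≤ _ := Real.exp_le_exp.2 (sum_pow_card_vertices_le hz.le)

end DClique

/-! ### The counting lower bound, and the trivial inequalities. -/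

namespace UniformHypergraph

variable {d : ℕ} {V : Type*} [DecidableEq V]

theorem exists_isCover_weight_eq_mc (H : UniformHypergraph d V) :
    ∃ C, H.IsCover C ∧ DClique.weight C = H.mc := by
  obtain ⟨C, hC⟩ := H.exists_isPartition
  exact Nat.sInf_mem (s := {w | ∃ C, H.IsCover C ∧ DClique.weight C = w})
    ⟨_, C, hC.isCover, rfl⟩

theorem exists_isPartition_weight_eq_mp (H : UniformHypergraph d V) :
    ∃ C, H.IsPartition C ∧ DClique.weight C = H.mp := by
  obtain ⟨C, hC⟩ := H.exists_isPartition
  exact Nat.sInf_mem (s := {w | ∃ C, H.IsPartition C ∧ DClique.weight C = w})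
    ⟨_, C, hC, rfl⟩

theorem exists_isPartition_load_le_lmp [Fintype V] (H : UniformHypergraph d V) :
    ∃ C, H.IsPartition C ∧ ∀ v, DClique.load C v ≤ H.lmp := by
  obtain ⟨C, hC⟩ := H.exists_isPartition
  exact Nat.sInf_mem (s := {m | ∃ C, H.IsPartition C ∧ ∀ v, DClique.load C v ≤ m})
    ⟨_, C, hC, fun v => Finset.card_le_card (Finset.filter_subset _ _)⟩

theorem lmp_le {H : UniformHypergraph d V} {C : Finset (DClique d V)} (hC : H.IsPartition C)
    {m : ℕ} (h : ∀ v, DClique.load C v ≤ m) : H.lmp ≤ m :=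
  Nat.sInf_le ⟨C, hC, h⟩

theorem mc_le_mp (H : UniformHypergraph d V) : H.mc ≤ H.mp := by
  obtain ⟨C, hC, h⟩ := H.exists_isPartition_weight_eq_mp
  exact Nat.sInf_le ⟨C, hC.isCover, h⟩

theorem mp_le_card_mul_lmp [Fintype V] (H : UniformHypergraph d V) :
    H.mp ≤ Fintype.card V * H.lmp := by
  obtain ⟨C, hC, h⟩ := H.exists_isPartition_load_le_lmp
  calc H.mp ≤ DClique.weight C := Nat.sInf_le ⟨C, hC, rfl⟩
    _ = ∑ v, DClique.load C v := DClique.weight_eq_sum_load C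
    _ ≤ ∑ _v : V, H.lmp := Finset.sum_le_sum fun v _ => h v
    _ = _ := by simp

instance instNonempty : Nonempty (UniformHypergraph d V) := ⟨⟨∅, by simp⟩⟩

theorem maxMC_le_maxMP (d n : ℕ) : maxMC d n ≤ maxMP d n :=
  ciSup_mono (Set.finite_range _).bddAbove fun H => H.mc_le_mp

theorem maxMP_le_mul_maxLMP (d n : ℕ) : maxMP d n ≤ n * maxLMP d n :=
  ciSup_le fun H => H.mp_le_card_mul_lmp.trans <| by
    rw [Fintype.card_fin]
    exact Nat.mul_le_mul_left _ (le_ciSup (f := fun H : UniformHypergraph d (Fin n) => H.lmp)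
      (Set.finite_range _).bddAbove H)

theorem maxLMP_le {d n m : ℕ} (h : ∀ H : UniformHypergraph d (Fin n), H.lmp ≤ m) :
    maxLMP d n ≤ m := ciSup_le h

/-- The injectivity on which the counting argument rests. -/
theorem IsCover.edges_eq {H H' : UniformHypergraph d V} {C : Finset (DClique d V)}
    (h : H.IsCover C) (h' : H'.IsCover C) : H = H' := by
  have : H.edges = H'.edges := by
    apply Finset.Subset.antisymm
    · intro e he
      obtain ⟨K, hK, heK⟩ := h.2 e he
      exact h'.1 K hK heK
    · intro e he
      obtain ⟨K, hK, heK⟩ := h'.2 e he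
      exact h.1 K hK heK
  cases H; cases H'; cases this; rfl

theorem two_pow_choose_le_card (d n : ℕ) [Fintype (UniformHypergraph d (Fin n))] :
    2 ^ n.choose d ≤ Fintype.card (UniformHypergraph d (Fin n)) := by
  classical
  let s := (Finset.univ : Finset (Fin n)).powersetCard d
  have hs : s.powerset.card = 2 ^ n.choose d := by simp [s]
  rw [← hs, ← Fintype.card_coe]
  refine Fintype.card_le_of_injective
    (fun E => ⟨E.1, fun e he => (Finset.mem_powersetCard.1 (Finset.mem_powerset.1 E.2 he)).2⟩) ?_
  intro E E' h
  exact Subtype.ext (congrArg UniformHypergraph.edges h)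

theorem two_pow_choose_le (d n : ℕ) (hd : 1 ≤ d) (hn : 1 ≤ n) :
    (2 : ℝ) ^ n.choose d ≤ ((d * n : ℕ) : ℝ) ^ maxMC d n * Real.exp (Real.exp 1) := by
  classical
  let _ : Fintype (UniformHypergraph d (Fin n)) := Fintype.ofFinite _
  let _ : Fintype (DClique d (Fin n)) := Fintype.ofFinite _
  choose c hc hw using fun H : UniformHypergraph d (Fin n) => H.exists_isCover_weight_eq_mc
  have hinj : Function.Injective c := fun H H' h => (hc H).edges_eq (h ▸ hc H')
  have hcard : Fintype.card (UniformHypergraph d (Fin n)) ≤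
      (Finset.univ.filter fun C : Finset (DClique d (Fin n)) =>
        DClique.weight C ≤ maxMC d n).card := by
    rw [← Finset.card_univ, ← Finset.card_image_of_injective _ hinj]
    refine Finset.card_le_card fun C hC => ?_
    obtain ⟨H, -, rfl⟩ := Finset.mem_image.1 hC
    refine Finset.mem_filter.2 ⟨Finset.mem_univ _, ?_⟩
    rw [hw]
    exact le_ciSup (f := fun H : UniformHypergraph d (Fin n) => H.mc)
      (Set.finite_range _).bddAbove H
  have hdn : (1 : ℝ) ≤ ((d * n : ℕ) : ℝ) := by exact_mod_cast Nat.mul_pos hd hn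
  have hpos : (0 : ℝ) < ((d * n : ℕ) : ℝ) := by linarith
  -- For `z = 1 / (d n)` the base `1 + d z` is `1 + 1 / n`, so the exponential factor is at most
  -- `exp e`, while each unit of weight costs only `lg d + lg n` bits.
  have key := DClique.card_weight_le_mul_pow_le (d := d) (V := Fin n)
    (z := ((d * n : ℕ) : ℝ)⁻¹) (by positivity) (inv_le_one_of_one_le₀ hdn) (maxMC d n)
  have he : (1 + (d : ℝ) * ((d * n : ℕ) : ℝ)⁻¹) ^ Fintype.card (Fin n) ≤ Real.exp 1 := by
    have h1 : (d : ℝ) * ((d * n : ℕ) : ℝ)⁻¹ = (n : ℝ)⁻¹ := by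
      have : (d : ℝ) ≠ 0 := by positivity
      push_cast
      field_simp
    rw [h1, Fintype.card_fin, add_comm]
    calc ((n : ℝ)⁻¹ + 1) ^ n ≤ (Real.exp (n : ℝ)⁻¹) ^ n :=
          pow_le_pow_left₀ (by positivity) (Real.add_one_le_exp _) _
      _ = Real.exp 1 := by
          rw [← Real.exp_nat_mul, mul_inv_cancel₀ (by positivity)]
  have h3 := key.trans (Real.exp_le_exp.2 he)
  rw [inv_pow, ← div_eq_mul_inv, div_le_iff₀ (by positivity)] at h3
  calc (2 : ℝ) ^ n.choose d ≤ Fintype.card (UniformHypergraph d (Fin n)) := by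
        exact_mod_cast two_pow_choose_le_card d n
    _ ≤ _ := by exact_mod_cast hcard
    _ ≤ _ := h3
    _ = _ := mul_comm _ _

/-- The counting lower bound for the maximum of `mc`. -/
theorem choose_le_maxMC_mul_logb (d n : ℕ) (hd : 1 ≤ d) (hn : 1 ≤ n) :
    (n.choose d : ℝ) ≤
      maxMC d n * (Real.logb 2 d + Real.logb 2 n) + Real.exp 1 / Real.log 2 := by
  have h := Real.logb_le_logb_of_le (b := 2) (by norm_num) (by positivity)
    (two_pow_choose_le d n hd hn)
  have hd' : (0 : ℝ) < d := by exact_mod_cast hd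
  have hn' : (0 : ℝ) < n := by exact_mod_cast hn
  rw [Real.logb_pow, Real.logb_self_eq_one (by norm_num), mul_one,
    Real.logb_mul (by positivity) (by positivity), Real.logb_pow, Nat.cast_mul,
    Real.logb_mul hd'.ne' hn'.ne'] at h
  have he : Real.logb 2 (Real.exp (Real.exp 1)) = Real.exp 1 / Real.log 2 := by
    rw [Real.logb, Real.log_exp]
  rwa [he] at h

end UniformHypergraph

namespace WordRAM

/-! ### A calculus of weakest preconditions -/

/-- The program `p`, started in `s` at time `c`, halts, and `Q` holds for the final state and the
final time. -/
def WP (inp : ℕ → ℕ) (W : ℕ) (p : Program) (s : State) (c : ℕ) (Q : State → ℕ → Prop) : Prop :=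
  ∃ s' t, Exec inp W p s s' t ∧ Q s' (c + t)

section WP

variable {inp : ℕ → ℕ} {W : ℕ} {s : State} {c : ℕ} {Q Q' : State → ℕ → Prop}

theorem WP.mono {p : Program} (h : WP inp W p s c Q) (hQ : ∀ s' c', Q s' c' → Q' s' c') :
    WP inp W p s c Q' := by
  obtain ⟨s', t, he, hq⟩ := h
  exact ⟨s', t, he, hQ _ _ hq⟩

theorem wp_skip : WP inp W .skip s c Q ↔ Q s (c + 1) := by
  constructor
  · rintro ⟨s', t, he, hq⟩
    cases he
    exact hq
  · exact fun h => ⟨_, _, .skip s, h⟩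

theorem wp_const {r x : ℕ} :
    WP inp W (.const r x) s c Q ↔ x < W ∧ Q (s.setReg r x) (c + 1) := by
  constructor
  · rintro ⟨s', t, he, hq⟩
    cases he with
    | const _ _ _ h => exact ⟨h, hq⟩
  · exact fun h => ⟨_, _, .const s r x h.1, h.2⟩

theorem wp_arith {o : Arith} {r a b : ℕ} :
    WP inp W (.arith o r a b) s c Q ↔
      o.eval (s.reg a) (s.reg b) < W ∧ Q (s.setReg r (o.eval (s.reg a) (s.reg b))) (c + 1) := by
  constructor
  · rintro ⟨s', t, he, hq⟩
    cases he with
    | arith _ _ _ _ _ h => exact ⟨h, hq⟩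
  · exact fun h => ⟨_, _, .arith s o r a b h.1, h.2⟩

theorem wp_load {r a : ℕ} :
    WP inp W (.load r a) s c Q ↔ Q (s.setReg r (s.mem (s.reg a))) (c + 1) := by
  constructor
  · rintro ⟨s', t, he, hq⟩
    cases he
    exact hq
  · exact fun h => ⟨_, _, .load s r a, h⟩

theorem wp_store {a b : ℕ} :
    WP inp W (.store a b) s c Q ↔
      Q { s with mem := Function.update s.mem (s.reg a) (s.reg b) } (c + 1) := by
  constructor
  · rintro ⟨s', t, he, hq⟩
    cases he
    exact hq
  · exact fun h => ⟨_, _, .store s a b, h⟩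

theorem wp_read {r a : ℕ} :
    WP inp W (.read r a) s c Q ↔
      inp (s.reg a) < W ∧ Q (s.setReg r (inp (s.reg a))) (c + 1) := by
  constructor
  · rintro ⟨s', t, he, hq⟩
    cases he with
    | read _ _ _ h => exact ⟨h, hq⟩
  · exact fun h => ⟨_, _, .read s r a h.1, h.2⟩

theorem wp_emit {a : ℕ} :
    WP inp W (.emit a) s c Q ↔ Q { s with out := s.out ++ [s.reg a] } (c + 1) := by
  constructor
  · rintro ⟨s', t, he, hq⟩
    cases he
    exact hq
  · exact fun h => ⟨_, _, .emit s a, h⟩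

theorem wp_seq {p q : Program} :
    WP inp W (.seq p q) s c Q ↔ WP inp W p s c fun s' c' => WP inp W q s' c' Q := by
  constructor
  · rintro ⟨s', t, he, hq⟩
    cases he with
    | seq h h' => exact ⟨_, _, h, _, _, h', by rwa [add_assoc]⟩
  · rintro ⟨s', t, h, s'', t', h', hq⟩
    exact ⟨_, _, .seq h h', by rwa [← add_assoc]⟩

theorem wp_ite {p q : Program} {a : ℕ} :
    WP inp W (.ite a p q) s c Q ↔
      if s.reg a = 0 then WP inp W q s (c + 1) Q else WP inp W p s (c + 1) Q := by
  split_ifs with h0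
  · constructor
    · rintro ⟨s', t, he, hq⟩
      cases he with
      | ite_pos h _ => exact absurd h0 h
      | ite_zero _ h' => exact ⟨_, _, h', by rwa [add_assoc]⟩
    · rintro ⟨s', t, h, hq⟩
      exact ⟨_, _, .ite_zero h0 h, by rwa [← add_assoc]⟩
  · constructor
    · rintro ⟨s', t, he, hq⟩
      cases he with
      | ite_pos _ h' => exact ⟨_, _, h', by rwa [add_assoc]⟩
      | ite_zero h _ => exact absurd h h0
    · rintro ⟨s', t, h, hq⟩
      exact ⟨_, _, .ite_pos h0 h, by rwa [← add_assoc]⟩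

theorem wp_loop_zero {p : Program} {a : ℕ} (h : s.reg a = 0) (hQ : Q s (c + 1)) :
    WP inp W (.loop a p) s c Q :=
  ⟨s, 1, .loop_zero h, hQ⟩

theorem wp_loop_pos {p : Program} {a : ℕ} (h : s.reg a ≠ 0)
    (hp : WP inp W p s (c + 1) fun s' c' => WP inp W (.loop a p) s' c' Q) :
    WP inp W (.loop a p) s c Q := by
  obtain ⟨s', t, he, s'', t', he', hq⟩ := hp
  exact ⟨s'', 1 + t + t', .loop_pos h he he', by
    have : c + (1 + t + t') = c + 1 + t + t' := by omega
    rwa [this]⟩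

/-- A loop of `N` rounds: `I j` holds when `j` rounds are left, and the round that starts with
`I (j + 1)` takes time at most `T j`. -/
theorem wp_loop {p : Program} {a : ℕ} (I : ℕ → State → Prop) (T : ℕ → ℕ)
    (N : ℕ) (hreg : ∀ j ≤ N, ∀ s, I j s → (s.reg a = 0 ↔ j = 0))
    (hp : ∀ j, j < N → ∀ s c, I (j + 1) s →
      WP inp W p s c fun s' c' => I j s' ∧ c' ≤ c + T j)
    (h : I N s)
    (hQ : ∀ s' c', I 0 s' → c' ≤ c + ∑ j ∈ Finset.range N, (T j + 1) + 1 → Q s' c') :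
    WP inp W (.loop a p) s c Q := by
  induction N generalizing s c with
  | zero => exact wp_loop_zero ((hreg 0 le_rfl _ h).2 rfl) (hQ _ _ h (by simp))
  | succ N ih =>
    refine wp_loop_pos (fun h0 => absurd ((hreg (N + 1) le_rfl _ h).1 h0) (by omega)) ?_
    refine (hp N (by omega) s (c + 1) h).mono ?_
    rintro s' c' ⟨hI, hc⟩
    refine ih (fun j hj => hreg j (by omega)) (fun j hj => hp j (by omega)) hI
      fun s'' c'' h' hc' => hQ _ _ h' ?_
    rw [Finset.sum_range_succ]
    omega

/-- A loop that is controlled by a register that counts down from `N`. -/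
theorem wp_loop_down {p : Program} {a : ℕ} (I : ℕ → State → Prop) (T : ℕ → ℕ)
    (N : ℕ) (hreg : ∀ j s, I j s → s.reg a = j)
    (hp : ∀ j, j < N → ∀ s c, I (j + 1) s →
      WP inp W p s c fun s' c' => I j s' ∧ c' ≤ c + T j)
    (h : I N s)
    (hQ : ∀ s' c', I 0 s' → c' ≤ c + ∑ j ∈ Finset.range N, (T j + 1) + 1 → Q s' c') :
    WP inp W (.loop a p) s c Q :=
  wp_loop I T N (fun j _ s h => by rw [hreg j s h]) hp h hQ

/-- The same with a constant bound for the time of a round, and `I j` for `j` completed rounds. -/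
theorem wp_loop_up {p : Program} {a : ℕ} (I : ℕ → State → Prop) (T N : ℕ)
    (hreg : ∀ j s, I j s → s.reg a = N - j)
    (hp : ∀ j, j < N → ∀ s c, I j s → WP inp W p s c fun s' c' => I (j + 1) s' ∧ c' ≤ c + T)
    (h : I 0 s)
    (hQ : ∀ s' c', I N s' → c' ≤ c + N * (T + 1) + 1 → Q s' c') :
    WP inp W (.loop a p) s c Q := by
  refine wp_loop_down (fun j s => j ≤ N ∧ I (N - j) s) (fun _ => T) N ?_ ?_ ⟨le_rfl, by simpa⟩ ?_
  · rintro j s ⟨hj, hI⟩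
    rw [hreg _ _ hI]
    omega
  · rintro j hj s c ⟨-, hI⟩
    refine (hp (N - (j + 1)) (by omega) s c hI).mono ?_
    rintro s' c' ⟨h1, h2⟩
    refine ⟨⟨by omega, ?_⟩, h2⟩
    rwa [show N - (j + 1) + 1 = N - j by omega] at h1
  · rintro s' c' ⟨-, hI⟩ hc
    refine hQ s' c' (by simpa using hI) (by simpa using hc)

end WP

@[simp] theorem State.setReg_reg (s : State) (r x q : ℕ) :
    (s.setReg r x).reg q = if q = r then x else s.reg q := by
  simp [State.setReg, Function.update_apply]

@[simp] theorem State.setReg_mem (s : State) (r x : ℕ) : (s.setReg r x).mem = s.mem := rfl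

@[simp] theorem State.setReg_out (s : State) (r x : ℕ) : (s.setReg r x).out = s.out := rfl

/-- Run a list of programs one after the other. -/
def block : List Program → Program
  | [] => .skip
  | [p] => p
  | p :: l => .seq p (block l)

end WordRAM

/-! ### The parameters, the sorting test, and the reading of one block. -/

namespace WordRAM

/-- `x + y` -/
def Program.add (r a b : ℕ) : Program := .arith .add r a b
/-- `x - y` -/
def Program.sub (r a b : ℕ) : Program := .arith .sub r a b
/-- `x * y` -/
def Program.mul (r a b : ℕ) : Program := .arith .mul r a b
/-- `x / y` -/
def Program.div (r a b : ℕ) : Program := .arith .div r a b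

section

variable {inp : ℕ → ℕ} {W : ℕ} {s : State} {c : ℕ} {Q : State → ℕ → Prop} {r a b : ℕ}

theorem wp_add : WP inp W (.add r a b) s c Q ↔
    s.reg a + s.reg b < W ∧ Q (s.setReg r (s.reg a + s.reg b)) (c + 1) := wp_arith

theorem wp_sub : WP inp W (.sub r a b) s c Q ↔
    s.reg a - s.reg b < W ∧ Q (s.setReg r (s.reg a - s.reg b)) (c + 1) := wp_arith

theorem wp_mul : WP inp W (.mul r a b) s c Q ↔
    s.reg a * s.reg b < W ∧ Q (s.setReg r (s.reg a * s.reg b)) (c + 1) := wp_arith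

theorem wp_div : WP inp W (.div r a b) s c Q ↔
    s.reg a / s.reg b < W ∧ Q (s.setReg r (s.reg a / s.reg b)) (c + 1) := wp_arith

end

/-- The number `f c + 2 f (c + 1) + ⋯ + 2 ^ (l - 1) f (c + l - 1)`. -/
def horner (f : ℕ → ℕ) (c : ℕ) : ℕ → ℕ
  | 0 => 0
  | l + 1 => 2 * horner f (c + 1) l + f c

/-- The parameters of the construction: hypergraphs of uniformity `D + 2` on `n` vertices with
adjacency array `inp`, and `m` blocks of `k` consecutive vertices. -/
structure Params where
  D : ℕ
  n : ℕ
  k : ℕ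
  m : ℕ
  inp : ℕ → ℕ

namespace Params

variable (P : Params)

/-- The digits of a number in base `n`. -/
def digit (u j : ℕ) : ℕ := u / P.n ^ j % P.n

/-- The sum of the blocks of the first `D + 1` vertices and of the block `i`. -/
def blockSum (u i : ℕ) : ℕ := ∑ j ∈ Finset.range (P.D + 1), P.digit u j / P.k + i

/-- The position of the block `β` relative to a sum `σ` of blocks. -/
def rank (σ β : ℕ) : ℕ := ((P.D + 2) * β + ((P.D + 2) * P.m - σ)) % P.m

/-- The key by which the vertices of an edge are sorted. -/
def key (u i j : ℕ) : ℕ := P.rank (P.blockSum u i) (P.digit u j / P.k) * P.n + P.digit u j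

/-- The offset of the keys of the vertices in block `i`. -/
def top (u i : ℕ) : ℕ := P.rank (P.blockSum u i) i * P.n

/-- The vertices coded by `u` can be followed by a vertex in block `i`. -/
def Accepts (u i : ℕ) : Prop :=
  (∀ j < P.D, P.key u i j < P.key u i (j + 1)) ∧ P.key u i P.D < P.top u i + P.n

instance (u i : ℕ) : Decidable (P.Accepts u i) := by unfold Accepts; infer_instance

/-- Whether the vertex `i k + c` extends `u` to an edge with sorted keys. -/
def bit (u i c : ℕ) : ℕ :=
  if P.key u i P.D < P.top u i + (i * P.k + c) then
    P.inp (u + (i * P.k + c) * P.n ^ (P.D + 1)) else 0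

/-- The set of all extensions of `u` in block `i`, as a number. -/
def code (u i : ℕ) : ℕ := horner (P.bit u i) 0 P.k

/-- The vertices which have the extensions `S` in the block `i`. -/
def bucket (t i S : ℕ) : List ℕ :=
  if S = 0 then [] else (List.range P.n).filter fun b =>
    P.Accepts (t + b * P.n ^ P.D) i ∧ P.code (t + b * P.n ^ P.D) i = S

/-- The vertices of the block `i` in the set coded by `S`. -/
def members (i S : ℕ) : List ℕ :=
  ((List.range P.k).filter fun c => S / 2 ^ c % 2 = 1).map fun c => i * P.k + c

/-- The description of a clique. -/
def word (t i S : ℕ) : List ℕ :=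
  ((List.range P.D).flatMap fun j => [1, P.digit t j]) ++
    ((P.bucket t i S).length :: P.bucket t i S) ++ ((P.members i S).length :: P.members i S)

end Params

/-- The registers that hold the parameters. -/
structure Env (P : Params) (s : State) : Prop where
  h0 : s.reg 0 = P.n
  h1 : s.reg 1 = 1
  h2 : s.reg 2 = P.k
  h3 : s.reg 3 = 2 ^ P.k
  h4 : s.reg 4 = P.m
  h5 : s.reg 5 = P.n ^ P.D
  h6 : s.reg 6 = P.n ^ (P.D + 1)
  h7 : s.reg 7 = P.D + 2
  h8 : s.reg 8 = 2

/-- The words are large enough. -/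
structure Fits (P : Params) (W : ℕ) : Prop where
  m_pos : 0 < P.m
  k_pos : 0 < P.k
  n_lt : P.n < W
  inp_le : ∀ a, P.inp a ≤ 1
  le_mul : P.n ≤ P.m * P.k
  lt₁ : 2 * ((P.D + 2) * P.m) < W
  lt₂ : (P.D + 2) * (P.m * P.n + P.n + 1) < W
  lt₃ : P.m * P.k * P.n ^ (P.D + 1) + P.n ^ (P.D + 1) < W
  lt₄ : P.m * P.n + P.m * P.k < W
  lt₅ : 2 * 2 ^ P.k < W
  lt₆ : 2 ^ P.k * P.n + 2 ^ P.k + P.n < W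

/-- The parameters occupy the registers below `9`. The passes of the main loop write only to higher
ones, so they preserve `Env`. -/
theorem Env.of_agree {P : Params} {s s' : State} (h : Env P s) {c : ℕ} (hc : 9 ≤ c)
    (hs : ∀ r < c, s'.reg r = s.reg r) : Env P s' := by
  constructor <;> rw [hs _ (by omega)]
  exacts [h.h0, h.h1, h.h2, h.h3, h.h4, h.h5, h.h6, h.h7, h.h8]

open Program

/-- Computes the sum of the blocks. -/
def sumPass (D : ℕ) : Program :=
  block [.mul 20 13 1, .const 21 (D + 1), .mul 14 7 4, .sub 14 14 11, .loop 21 (block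
    [.div 24 20 0, .mul 25 24 0, .sub 22 20 25, .mul 20 24 1, .div 23 22 2, .sub 14 14 23,
      .sub 21 21 1])]

/-- Computes the keys and checks that they increase. -/
def keyPass (D : ℕ) : Program :=
  block [.mul 20 13 1, .const 21 (D + 1), .const 15 0, .const 16 0, .loop 21 (block
    [.div 24 20 0, .mul 25 24 0, .sub 22 20 25, .mul 20 24 1, .div 23 22 2, .mul 23 7 23,
      .add 23 23 14, .div 24 23 4, .mul 24 24 4, .sub 23 23 24, .mul 23 23 0, .add 23 23 22,
      .sub 24 16 23, .add 15 15 24, .add 16 23 1, .sub 21 21 1]),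
    .mul 17 7 11, .add 17 17 14, .div 24 17 4, .mul 24 24 4, .sub 17 17 24, .mul 17 17 0,
    .add 24 17 0, .sub 24 16 24, .add 15 15 24]

/-- Reads the adjacencies of the vertices of a block. -/
def readPass : Program :=
  block [.const 18 0, .mul 21 2 1, .loop 21 (block
    [.sub 21 21 1, .mul 22 11 2, .add 22 22 21, .mul 23 22 6, .add 23 23 13, .add 24 17 22,
      .sub 24 16 24, .mul 18 8 18, .ite 24 .skip (block [.read 25 23, .add 18 18 25])])]

/-- The machine has no remainder, so a digit is computed from two consecutive quotients. -/
theorem Params.digit_succ (P : Params) (u j : ℕ) :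
    u / P.n ^ j - u / P.n ^ (j + 1) * P.n = P.digit u j := by
  rw [Params.digit, Nat.mod_eq_sub_div_mul, pow_succ, Nat.div_div_eq_div_mul]

theorem Params.div_pow_succ (P : Params) (u j : ℕ) :
    u / P.n ^ j / P.n = u / P.n ^ (j + 1) := by
  rw [Nat.div_div_eq_div_mul, pow_succ]

theorem Params.n_pos_of_lt {P : Params} {u : ℕ} (hu : u < P.n ^ (P.D + 1)) : 0 < P.n := by
  rcases Nat.eq_zero_or_pos P.n with h | h
  · simp [h] at hu
  · exact h

section

variable {P : Params} {W : ℕ} {s : State} {c : ℕ} {Q : State → ℕ → Prop} {u i : ℕ}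

/-- Repeated truncated subtractions amount to one truncated subtraction of the sum, so no bound on
the sum of the blocks is needed at this point. Multiplication by register `1` serves as a copy
instruction. -/
theorem wp_sumPass (hE : Env P s) (hF : Fits P W) (hu : s.reg 13 = u) (hi : s.reg 11 = i)
    (huY : u < P.n ^ (P.D + 1))
    (hQ : ∀ s' c', (∀ r < 14, s'.reg r = s.reg r) →
      s'.reg 14 = (P.D + 2) * P.m - P.blockSum u i →
      s'.mem = s.mem → s'.out = s.out → c' ≤ c + 8 * (P.D + 1) + 5 → Q s' c') :
    WP P.inp W (sumPass P.D) s c Q := by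
  have hY : P.n ^ (P.D + 1) < W := by have := hF.lt₃; omega
  have hm := hF.m_pos
  have h1 := hF.lt₁
  have hDm : P.D + 2 ≤ (P.D + 2) * P.m := Nat.le_mul_of_pos_right _ hm
  have hmD : P.m ≤ (P.D + 2) * P.m := Nat.le_mul_of_pos_left _ (by omega)
  simp only [sumPass, block, wp_seq, wp_mul, wp_const, wp_sub, State.setReg_reg]
  simp [hu, hi, hE.h1, hE.h7, hE.h4]
  refine ⟨by omega, by omega, by omega, by omega, ?_⟩
  refine wp_loop_up (fun j s' => (∀ r < 14, s'.reg r = s.reg r) ∧ s'.mem = s.mem ∧ s'.out = s.out ∧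
    s'.reg 20 = u / P.n ^ j ∧ s'.reg 21 = P.D + 1 - j ∧
    s'.reg 14 = (P.D + 2) * P.m - (∑ l ∈ Finset.range j, P.digit u l / P.k + i))
    7 (P.D + 1) (fun j s h => h.2.2.2.2.1) ?_ ?_ ?_
  · rintro j hj s' c' ⟨ha, hmem, hout, hq, hcnt, hsum⟩
    have e0 : s'.reg 0 = P.n := by rw [ha _ (by omega), hE.h0]
    have e1 : s'.reg 1 = 1 := by rw [ha _ (by omega), hE.h1]
    have e2 : s'.reg 2 = P.k := by rw [ha _ (by omega), hE.h2]
    have q1 : u / P.n ^ j ≤ u := Nat.div_le_self _ _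
    have q2 : u / P.n ^ (j + 1) ≤ u := Nat.div_le_self _ _
    have q3 : u / P.n ^ j / P.n * P.n ≤ u := (Nat.div_mul_le_self _ _).trans q1
    have q4 : P.digit u j / P.k ≤ P.digit u j := Nat.div_le_self _ _
    have q0 : 0 ≤ P.digit u j / P.k := Nat.zero_le _
    have q5 : P.digit u j ≤ u := (Nat.mod_le _ _).trans q1
    simp [wp_seq, wp_mul, wp_div, wp_sub, e0, e1, e2, hq, hcnt, hsum, P.digit_succ, P.div_pow_succ]
    refine ⟨by omega, by rw [pow_succ, ← Nat.div_div_eq_div_mul]; omega, by omega, by omega,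
      by omega, by omega, by omega, fun r hr => ?_, hmem, hout, by omega, ?_⟩
    · iterate 7 rw [if_neg (by omega)]
      exact ha r hr
    · rw [Finset.sum_range_succ]
      omega
  · simp only [State.setReg_reg, State.setReg_mem, State.setReg_out]
    refine ⟨fun r hr => ?_, trivial, trivial, by simp, by simp, by simp⟩
    iterate 4 rw [if_neg (by omega)]
  · rintro s' c' ⟨ha, hmem, hout, -, -, hsum⟩ hc
    exact hQ s' c' ha hsum hmem hout (by omega)

theorem Params.rank_lt (hF : Fits P W) (σ β : ℕ) : P.rank σ β < P.m := Nat.mod_lt _ hF.m_pos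

theorem Params.rank_eq (σ β : ℕ) :
    (P.D + 2) * β + ((P.D + 2) * P.m - σ) -
      ((P.D + 2) * β + ((P.D + 2) * P.m - σ)) / P.m * P.m = P.rank σ β := by
  rw [Params.rank, Nat.mod_eq_sub_div_mul]

/-- One more than the key of the previous vertex. -/
def Params.prevKey (P : Params) (u i : ℕ) : ℕ → ℕ
  | 0 => 0
  | j + 1 => P.key u i j + 1

/-- This number is zero if and only if `u` and `i` pass the test. -/
def Params.defect (P : Params) (u i : ℕ) : ℕ :=
  ∑ l ∈ Finset.range (P.D + 1), (P.prevKey u i l - P.key u i l) +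
    (P.key u i P.D + 1 - (P.top u i + P.n))

/-- A truncated difference vanishes exactly when an inequality holds, so one sum tests all
inequalities without branching. The first summand is zero because `prevKey` starts at `0`. -/
theorem Params.defect_eq_zero : P.defect u i = 0 ↔ P.Accepts u i := by
  rw [Params.defect, Finset.sum_range_succ', Nat.add_eq_zero_iff, Params.Accepts]
  simp [Params.prevKey, Nat.sub_eq_zero_iff_le, Finset.sum_eq_zero_iff]

theorem Params.key_le (hF : Fits P W) (hn : 0 < P.n) (j : ℕ) :
    P.key u i j < P.m * P.n := by
  have h1 : P.rank (P.blockSum u i) (P.digit u j / P.k) + 1 ≤ P.m := Params.rank_lt hF _ _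
  have h2 : P.digit u j < P.n := Nat.mod_lt _ hn
  have h3 := Nat.mul_le_mul_right P.n h1
  rw [add_mul, one_mul] at h3
  rw [Params.key]
  omega

/-- Register `16` holds one more than the latest key, which turns the strict comparison of
consecutive keys into a truncated subtraction. A round takes 16 steps and one more for the loop
test. -/
theorem wp_keyPass (hE : Env P s) (hF : Fits P W) (hu : s.reg 13 = u) (hi : s.reg 11 = i)
    (hσ : s.reg 14 = (P.D + 2) * P.m - P.blockSum u i)
    (huY : u < P.n ^ (P.D + 1)) (him : i < P.m)
    (hQ : ∀ s' c', (∀ r < 15, s'.reg r = s.reg r) → s'.reg 15 = P.defect u i →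
      s'.reg 16 = P.key u i P.D + 1 → s'.reg 17 = P.top u i →
      s'.mem = s.mem → s'.out = s.out → c' ≤ c + 17 * (P.D + 1) + 14 → Q s' c') :
    WP P.inp W (keyPass P.D) s c Q := by
  have hY : P.n ^ (P.D + 1) < W := by have := hF.lt₃; omega
  have hm := hF.m_pos
  have hn := Params.n_pos_of_lt huY
  have h1 := hF.lt₁
  have h2 := hF.lt₂
  have hDm : P.D + 2 ≤ (P.D + 2) * P.m := Nat.le_mul_of_pos_right _ hm
  have hmD : P.m ≤ (P.D + 2) * P.m := Nat.le_mul_of_pos_left _ (by omega)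
  have hmn : P.m * P.n + P.n + 1 ≤ (P.D + 2) * (P.m * P.n + P.n + 1) :=
    Nat.le_mul_of_pos_left _ (by omega)
  have hle : ∀ l, P.prevKey u i l ≤ P.m * P.n := by
    rintro (_ | l)
    · exact Nat.zero_le _
    · exact Params.key_le hF hn l
  have hsumle : ∀ j ≤ P.D + 1,
      ∑ l ∈ Finset.range j, (P.prevKey u i l - P.key u i l) ≤ (P.D + 1) * (P.m * P.n) := by
    intro j hj
    calc _ ≤ ∑ l ∈ Finset.range j, P.m * P.n :=
          Finset.sum_le_sum fun l _ => (Nat.sub_le _ _).trans (hle l)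
      _ = j * (P.m * P.n) := by simp
      _ ≤ _ := Nat.mul_le_mul_right _ hj
  have hbig : (P.D + 1) * (P.m * P.n) + P.m * P.n + P.n < W := by nlinarith
  have hrank : ∀ β, P.rank (P.blockSum u i) β * P.n ≤ P.m * P.n :=
    fun β => Nat.mul_le_mul_right _ (Params.rank_lt hF _ _).le
  simp only [keyPass, block, wp_seq, wp_mul, wp_const]
  simp [hu, hE.h1]
  refine ⟨by omega, by omega, by omega, ?_⟩
  refine wp_loop_up (fun j s' => (∀ r < 15, s'.reg r = s.reg r) ∧ s'.mem = s.mem ∧ s'.out = s.out ∧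
    s'.reg 20 = u / P.n ^ j ∧ s'.reg 21 = P.D + 1 - j ∧ s'.reg 16 = P.prevKey u i j ∧
    s'.reg 15 = ∑ l ∈ Finset.range j, (P.prevKey u i l - P.key u i l))
    16 (P.D + 1) (fun j s h => h.2.2.2.2.1) ?_ ?_ ?_
  · rintro j hj s' c' ⟨ha, hmem, hout, hq, hcnt, hpk, hsum⟩
    have e0 : s'.reg 0 = P.n := by rw [ha _ (by omega), hE.h0]
    have e1 : s'.reg 1 = 1 := by rw [ha _ (by omega), hE.h1]
    have e2 : s'.reg 2 = P.k := by rw [ha _ (by omega), hE.h2]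
    have e4 : s'.reg 4 = P.m := by rw [ha _ (by omega), hE.h4]
    have e7 : s'.reg 7 = P.D + 2 := by rw [ha _ (by omega), hE.h7]
    have e14 : s'.reg 14 = (P.D + 2) * P.m - P.blockSum u i := by rw [ha _ (by omega), hσ]
    have q1 : u / P.n ^ j ≤ u := Nat.div_le_self _ _
    have q2 : u / P.n ^ (j + 1) ≤ u := Nat.div_le_self _ _
    have q3 : u / P.n ^ j / P.n * P.n ≤ u := (Nat.div_mul_le_self _ _).trans q1
    have q4 : P.digit u j / P.k ≤ P.digit u j := Nat.div_le_self _ _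
    have q0 : 0 ≤ P.digit u j / P.k := Nat.zero_le _
    have q5 : P.digit u j ≤ u := (Nat.mod_le _ _).trans q1
    have q6 : P.digit u j / P.k < P.m := Nat.div_lt_of_lt_mul (by
      have : P.digit u j < P.n := Nat.mod_lt _ hn
      have := hF.le_mul
      rw [mul_comm]
      omega)
    have q7 : (P.D + 2) * (P.digit u j / P.k) ≤ (P.D + 2) * P.m := Nat.mul_le_mul_left _ q6.le
    have q8 := hrank (P.digit u j / P.k)
    have q9 := Params.key_le (u := u) (i := i) hF hn j
    have q9' : P.key u i j =
      P.rank (P.blockSum u i) (P.digit u j / P.k) * P.n + P.digit u j := rfl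
    have q10 := hle j
    have q11 := hsumle (j + 1) hj
    rw [Finset.sum_range_succ] at q11
    have q12 := Params.rank_lt hF (P.blockSum u i) (P.digit u j / P.k)
    have q13 := Nat.div_mul_le_self
      ((P.D + 2) * (P.digit u j / P.k) + ((P.D + 2) * P.m - P.blockSum u i)) P.m
    have q14 := Nat.div_le_self
      ((P.D + 2) * (P.digit u j / P.k) + ((P.D + 2) * P.m - P.blockSum u i)) P.m
    simp [wp_seq, wp_mul, wp_div, wp_sub, wp_add, e0, e1, e2, e4, e7, e14, hq, hcnt, hsum, hpk,
      P.digit_succ, P.div_pow_succ, Params.rank_eq]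
    rw [← q9']
    refine ⟨by omega, by rw [pow_succ, ← Nat.div_div_eq_div_mul]; omega, by omega, by omega,
      by omega, by omega, by omega, by omega, by omega, by omega, by omega, by omega, by omega,
      by omega, by omega, by omega, fun r hr => ?_, hmem, hout, by omega, rfl,
      (Finset.sum_range_succ _ _).symm⟩
    iterate 16 rw [if_neg (by omega)]
    exact ha r hr
  · simp only [State.setReg_reg, State.setReg_mem, State.setReg_out]
    refine ⟨fun r hr => ?_, trivial, trivial, by simp, by simp, by simp [Params.prevKey], by simp⟩
    iterate 4 rw [if_neg (by omega)]
  · rintro s' c' ⟨ha, hmem, hout, -, -, hpk, hsum⟩ hc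
    have e0 : s'.reg 0 = P.n := by rw [ha _ (by omega), hE.h0]
    have e4 : s'.reg 4 = P.m := by rw [ha _ (by omega), hE.h4]
    have e7 : s'.reg 7 = P.D + 2 := by rw [ha _ (by omega), hE.h7]
    have e11 : s'.reg 11 = i := by rw [ha _ (by omega), hi]
    have e14 : s'.reg 14 = (P.D + 2) * P.m - P.blockSum u i := by rw [ha _ (by omega), hσ]
    have q7 : (P.D + 2) * i ≤ (P.D + 2) * P.m := Nat.mul_le_mul_left _ him.le
    have q8 := hrank i
    have q8' : P.top u i = P.rank (P.blockSum u i) i * P.n := rfl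
    have q10 := hle (P.D + 1)
    have q11 := hsumle (P.D + 1) le_rfl
    have q12 := Params.rank_lt hF (P.blockSum u i) i
    have q13 := Nat.div_mul_le_self
      ((P.D + 2) * i + ((P.D + 2) * P.m - P.blockSum u i)) P.m
    have q14 := Nat.div_le_self
      ((P.D + 2) * i + ((P.D + 2) * P.m - P.blockSum u i)) P.m
    have q15 : P.prevKey u i (P.D + 1) = P.key u i P.D + 1 := rfl
    simp [wp_div, wp_sub, wp_add, e0, e4, e7, e11, e14, hsum, hpk,
      Params.rank_eq]
    rw [← q8']
    refine ⟨by omega, by omega, by omega, by omega, by omega, by omega, by omega, by omega,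
      by omega, hQ _ _ (fun r hr => ?_) ?_ ?_ ?_ hmem hout (by omega)⟩
    · simp only [State.setReg_reg]
      iterate 9 rw [if_neg (by omega)]
      exact ha r hr
    · simp [Params.defect, q15]
    · simp [hpk, q15]
    · simp

theorem horner_lt {f : ℕ → ℕ} (hf : ∀ j, f j ≤ 1) (b l : ℕ) : horner f b l < 2 ^ l := by
  induction l generalizing b with
  | zero => simp [horner]
  | succ l ih =>
    have h1 := ih (b + 1)
    have h2 := hf b
    rw [horner, pow_succ]
    omega

theorem Params.bit_le (hF : Fits P W) (j : ℕ) : P.bit u i j ≤ 1 := by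
  unfold Params.bit
  split_ifs
  · exact hF.inp_le _
  · exact Nat.zero_le _

/-- The block is read from its last vertex down, so that Horner's rule makes the vertex at offset
`c` the bit of `2 ^ c`. A round takes at most 12 steps besides the loop test; this is the origin of
the constant 13 in the running time. -/
theorem wp_readPass (hE : Env P s) (hF : Fits P W) (hu : s.reg 13 = u) (hi : s.reg 11 = i)
    (hk : s.reg 16 = P.key u i P.D + 1) (ht : s.reg 17 = P.top u i)
    (huY : u < P.n ^ (P.D + 1)) (him : i < P.m)
    (hQ : ∀ s' c', (∀ r < 18, s'.reg r = s.reg r) → s'.reg 18 = P.code u i →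
      s'.mem = s.mem → s'.out = s.out → c' ≤ c + 13 * P.k + 3 → Q s' c') :
    WP P.inp W readPass s c Q := by
  have hn := Params.n_pos_of_lt huY
  have h2 := hF.lt₂
  have h3 := hF.lt₃
  have h4 := hF.lt₄
  have h5 := hF.lt₅
  have hmk : P.k ≤ P.m * P.k := Nat.le_mul_of_pos_left _ hF.m_pos
  have hik : i * P.k + P.k ≤ P.m * P.k := by
    have := Nat.mul_le_mul_right P.k him
    rwa [Nat.succ_mul] at this
  have htop : P.top u i ≤ P.m * P.n := Nat.mul_le_mul_right _ (Params.rank_lt hF _ _).le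
  have hkey := Params.key_le (u := u) (i := i) hF hn P.D
  have h1W : 1 < W := by omega
  simp only [readPass, block, wp_seq, wp_mul, wp_const, State.setReg_reg]
  simp [hE.h1, hE.h2]
  refine ⟨by omega, by omega, ?_⟩
  refine wp_loop_up (fun j s' => (∀ r < 18, s'.reg r = s.reg r) ∧ s'.mem = s.mem ∧ s'.out = s.out ∧
    s'.reg 21 = P.k - j ∧ s'.reg 18 = horner (P.bit u i) (P.k - j) j)
    12 P.k (fun j s h => h.2.2.2.1) ?_ ?_ ?_
  · rintro j hj s' c' ⟨ha, hmem, hout, hcnt, hS⟩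
    have e1 : s'.reg 1 = 1 := by rw [ha _ (by omega), hE.h1]
    have e2 : s'.reg 2 = P.k := by rw [ha _ (by omega), hE.h2]
    have e6 : s'.reg 6 = P.n ^ (P.D + 1) := by rw [ha _ (by omega), hE.h6]
    have e8 : s'.reg 8 = 2 := by rw [ha _ (by omega), hE.h8]
    have e11 : s'.reg 11 = i := by rw [ha _ (by omega), hi]
    have e13 : s'.reg 13 = u := by rw [ha _ (by omega), hu]
    have e16 : s'.reg 16 = P.key u i P.D + 1 := by rw [ha _ (by omega), hk]
    have e17 : s'.reg 17 = P.top u i := by rw [ha _ (by omega), ht]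
    obtain ⟨l, hl⟩ : ∃ l, P.k = j + 1 + l := ⟨P.k - (j + 1), by omega⟩
    have e21 : P.k - j - 1 = l := by omega
    have q1 : (i * P.k + l) * P.n ^ (P.D + 1) ≤ P.m * P.k * P.n ^ (P.D + 1) :=
      Nat.mul_le_mul_right _ (by omega)
    have q2 : horner (P.bit u i) (l + 1) j < 2 ^ j := horner_lt (Params.bit_le hF) _ _
    have q3 : 2 ^ j ≤ 2 ^ P.k := Nat.pow_le_pow_right (by omega) hj.le
    have q4 : P.inp (u + (i * P.k + l) * P.n ^ (P.D + 1)) ≤ 1 := hF.inp_le _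
    have e22 : P.k - j = l + 1 := by omega
    have e23 : P.k - (j + 1) = l := by omega
    have q5 : horner (P.bit u i) l (j + 1) = 2 * horner (P.bit u i) (l + 1) j + P.bit u i l := rfl
    have q6 : i * P.k + l < P.m * P.k := by omega
    have q7 : i * P.k ≤ P.m * P.k := by omega
    have hcomm : (i * P.k + l) * P.n ^ (P.D + 1) + u = u + (i * P.k + l) * P.n ^ (P.D + 1) :=
      add_comm _ _
    rw [e22] at hcnt hS
    simp only [wp_seq, wp_mul, wp_sub, wp_add, wp_ite, wp_skip, wp_read, State.setReg_reg]
    simp [e1, e2, e6, e8, e11, e13, e16, e17, hcnt, hS, e23, q5, hcomm]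
    refine ⟨by omega, by omega, by omega, by omega, by omega, by omega, by omega, by omega, ?_⟩
    have hb : P.bit u i l = if P.key u i P.D + 1 - (P.top u i + (i * P.k + l)) = 0 then
        P.inp (u + (i * P.k + l) * P.n ^ (P.D + 1)) else 0 := by
      simp only [Params.bit, Nat.sub_eq_zero_iff_le, Nat.add_one_le_iff]
    rw [hb]
    split_ifs with h
    · refine ⟨by omega, by omega, fun r hr => ?_, hmem, hout, rfl⟩
      iterate 6 rw [if_neg (by omega)]
      exact ha r hr
    · refine ⟨fun r hr => ?_, hmem, hout, rfl⟩
      iterate 5 rw [if_neg (by omega)]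
      exact ha r hr
  · simp only [State.setReg_reg, State.setReg_mem, State.setReg_out]
    refine ⟨fun r hr => ?_, trivial, trivial, by simp, by simp [horner]⟩
    iterate 2 rw [if_neg (by omega)]
  · rintro s' c' ⟨ha, hmem, hout, -, hS⟩ hc
    exact hQ s' c' ha (by simpa [Params.code] using hS) hmem hout (by omega)

end

end WordRAM

/-! ### Collecting the vertices with equal extensions in buckets. -/

namespace WordRAM

open Program

/-- The list `B S` is stored in the bucket `S` of the memory, for every `S`. -/
structure Buckets (P : Params) (mem : ℕ → ℕ) (B : ℕ → List ℕ) : Prop where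
  length : ∀ S < 2 ^ P.k, mem S = (B S).length
  getElem : ∀ S < 2 ^ P.k, ∀ (c : ℕ) (h : c < (B S).length),
    mem (2 ^ P.k + S * P.n + c) = (B S)[c]
  le : ∀ S < 2 ^ P.k, (B S).length ≤ P.n

section Buckets

variable {P : Params} {mem : ℕ → ℕ} {B : ℕ → List ℕ} {S : ℕ}

theorem Buckets.empty (h : ∀ S < 2 ^ P.k, mem S = 0) : Buckets P mem fun _ => [] :=
  ⟨h, fun _ _ _ hc => absurd hc (by simp), by simp⟩

theorem Buckets.congr (h : Buckets P mem B) {B' : ℕ → List ℕ} (hB : ∀ S < 2 ^ P.k, B' S = B S) :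
    Buckets P mem B' := by
  refine ⟨fun S hS => by rw [hB S hS, h.length S hS], fun S hS c hc => ?_,
    fun S hS => by rw [hB S hS]; exact h.le S hS⟩
  simp only [hB S hS] at hc ⊢
  exact h.getElem S hS c hc

/-- Only the size has to be reset. Stale entries beyond the size are harmless, so a bucket is
emptied in constant time. -/
theorem Buckets.clear (h : Buckets P mem B) (hS : S < 2 ^ P.k) :
    Buckets P (Function.update mem S 0) (Function.update B S []) := by
  refine ⟨fun S' hS' => ?_, fun S' hS' c hc => ?_, fun S' hS' => ?_⟩
  · rcases eq_or_ne S' S with rfl | hne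
    · simp
    · simp [hne, h.length S' hS']
  · rcases eq_or_ne S' S with rfl | hne
    · simp at hc
    · simp only [Function.update_of_ne hne] at hc ⊢
      rw [Function.update_of_ne (by omega)]
      exact h.getElem S' hS' c hc
  · rcases eq_or_ne S' S with rfl | hne
    · simp
    · simp [hne, h.le S' hS']

theorem Buckets.push (h : Buckets P mem B) (hS : S < 2 ^ P.k) (hlt : (B S).length < P.n) (b : ℕ) :
    Buckets P (Function.update
        (Function.update mem (2 ^ P.k + S * P.n + (B S).length) b) S ((B S).length + 1))
      (Function.update B S (B S ++ [b])) := by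
  refine ⟨fun S' hS' => ?_, fun S' hS' c hc => ?_, fun S' hS' => ?_⟩
  · rcases eq_or_ne S' S with rfl | hne
    · simp
    · rw [Function.update_of_ne hne, Function.update_of_ne (by omega), Function.update_of_ne hne,
        h.length S' hS']
  · rw [Function.update_of_ne (by omega)]
    rcases eq_or_ne S' S with rfl | hne
    · simp only [Function.update_self, List.length_append, List.length_singleton] at hc ⊢
      rcases Nat.lt_succ_iff_lt_or_eq.1 hc with hc' | rfl
      · rw [Function.update_of_ne (by omega), h.getElem _ hS' _ hc', List.getElem_append_left hc']
      · simp
    · simp only [Function.update_of_ne hne] at hc ⊢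
      rw [Function.update_of_ne, h.getElem S' hS' c hc]
      intro he
      have h1 := h.le S' hS'
      have h2 : S' * P.n + c = S * P.n + (B S).length := by omega
      -- Each bucket has room for `n` entries, so division by `n` recovers the bucket from an
      -- address and different buckets do not overlap.
      have h3 : (S' * P.n + c) / P.n = (S * P.n + (B S).length) / P.n := by rw [h2]
      rw [mul_comm, Nat.mul_add_div (by omega), mul_comm, Nat.mul_add_div (by omega),
        Nat.div_eq_of_lt (by omega), Nat.div_eq_of_lt hlt] at h3
      exact hne (by simpa using h3)
  · rcases eq_or_ne S' S with rfl | hne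
    · simp
      omega
    · simp [hne, h.le S' hS']

end Buckets

/-- Adds a vertex to the bucket of the code that was read. -/
def pushPass : Program :=
  .ite 18 (block [.load 22 18, .mul 23 18 0, .add 23 23 3, .add 23 23 22, .store 23 12,
    .add 22 22 1, .store 18 22]) .skip

/-- Handles one vertex. -/
def vertexPass (D : ℕ) : Program :=
  block [.sub 12 12 1, .mul 13 12 5, .add 13 13 10, sumPass D, keyPass D,
    .ite 15 .skip (.seq readPass pushPass)]

/-- The vertices from `j` on with the extensions `S` in the block `i`, in descending order. -/
def Params.pushed (P : Params) (t i j S : ℕ) : List ℕ :=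
  if S = 0 then [] else ((List.range' j (P.n - j)).filter fun b =>
    P.Accepts (t + b * P.n ^ P.D) i ∧ P.code (t + b * P.n ^ P.D) i = S).reverse

theorem Params.pushed_length_le (P : Params) (t i j S : ℕ) :
    (P.pushed t i j S).length ≤ P.n - j := by
  unfold Params.pushed
  split_ifs
  · simp
  · rw [List.length_reverse]
    exact (List.length_filter_le _ _).trans (by simp)

/-- The vertices are handled in descending order, and each bucket is later written out from its top;
the two reversals cancel. -/
theorem Params.pushed_zero (P : Params) (t i S : ℕ) :
    P.pushed t i 0 S = (P.bucket t i S).reverse := by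
  unfold Params.pushed Params.bucket
  split_ifs <;> simp [List.range_eq_range']

theorem Params.pushed_self (P : Params) (t i S : ℕ) : P.pushed t i P.n S = [] := by
  simp [Params.pushed]

theorem Params.pushed_step (P : Params) (t i j S : ℕ) (hj : j < P.n) :
    P.pushed t i j S =
      if S ≠ 0 ∧ P.Accepts (t + j * P.n ^ P.D) i ∧ P.code (t + j * P.n ^ P.D) i = S then
        P.pushed t i (j + 1) S ++ [j] else P.pushed t i (j + 1) S := by
  unfold Params.pushed
  rw [show P.n - j = P.n - (j + 1) + 1 by omega, List.range'_succ, List.filter_cons]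
  by_cases hS : S = 0
  · simp [hS]
  · by_cases h : P.Accepts (t + j * P.n ^ P.D) i ∧ P.code (t + j * P.n ^ P.D) i = S
    · simp [hS, h]
    · simp [hS, h]

section

variable {P : Params} {W : ℕ} {s : State} {c : ℕ} {Q : State → ℕ → Prop} {t i j : ℕ}

/-- A rejected vertex costs only `O(D)` steps, and the `O(k)` steps for reading are spent on
accepted vertices alone. This distinction saves the factor `d!` in the running time. -/
theorem wp_vertexPass (hE : Env P s) (hF : Fits P W) (ht : s.reg 10 = t) (hi : s.reg 11 = i)
    (hj : s.reg 12 = j + 1) (htX : t < P.n ^ P.D) (him : i < P.m) (hjn : j < P.n)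
    (hB : Buckets P s.mem (P.pushed t i (j + 1)))
    (hQ : ∀ s' c', (∀ r < 12, s'.reg r = s.reg r) → s'.reg 12 = j →
      Buckets P s'.mem (P.pushed t i j) → s'.out = s.out →
      c' ≤ c + (25 * (P.D + 1) + 24 +
        if P.Accepts (t + j * P.n ^ P.D) i then 13 * P.k + 11 else 0) → Q s' c') :
    WP P.inp W (vertexPass P.D) s c Q := by
  have huY : t + j * P.n ^ P.D < P.n ^ (P.D + 1) := by
    have := Nat.mul_le_mul_right (P.n ^ P.D) hjn
    rw [Nat.succ_mul] at this
    rw [pow_succ']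
    omega
  have hY : P.n ^ (P.D + 1) < W := by have := hF.lt₃; omega
  have hnW := hF.n_lt
  have h6 := hF.lt₆
  simp only [vertexPass, block, wp_seq, wp_mul, wp_add, wp_sub, State.setReg_reg]
  simp [hE.h1, hE.h5, hj, ht]
  refine ⟨by omega, by omega, by omega, ?_⟩
  have hcomm : j * P.n ^ P.D + t = t + j * P.n ^ P.D := add_comm _ _
  rw [hcomm]
  refine wp_sumPass (u := t + j * P.n ^ P.D) (i := i)
    (hE.of_agree (c := 12) (by omega) fun r hr => ?_) hF (by simp) (by simpa using hi) huY ?_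
  · simp only [State.setReg_reg]
    iterate 3 rw [if_neg (by omega)]
  intro s₁ c₁ ha₁ hσ₁ hm₁ ho₁ hc₁
  have hr₁ : ∀ r < 12, s₁.reg r = s.reg r := by
    intro r hr
    rw [ha₁ r (by omega)]
    simp only [State.setReg_reg]
    iterate 3 rw [if_neg (by omega)]
  have hE₁ := hE.of_agree (by omega) hr₁
  refine wp_keyPass (u := t + j * P.n ^ P.D) (i := i) hE₁ hF
    (by rw [ha₁ _ (by omega)]; simp) (by rw [hr₁ _ (by omega), hi]) hσ₁ huY him ?_
  intro s₂ c₂ ha₂ hd₂ hk₂ ht₂ hm₂ ho₂ hc₂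
  have hr₂ : ∀ r < 12, s₂.reg r = s.reg r := fun r hr => by rw [ha₂ r (by omega), hr₁ r hr]
  have h12₂ : s₂.reg 12 = j := by rw [ha₂ _ (by omega), ha₁ _ (by omega)]; simp
  have hB₂ : Buckets P s₂.mem (P.pushed t i (j + 1)) := by rw [hm₂, hm₁]; exact hB
  have ho₂' : s₂.out = s.out := by rw [ho₂, ho₁]; rfl
  have hE₂ := hE.of_agree (by omega) hr₂
  rw [wp_ite, hd₂, wp_skip, wp_seq]
  by_cases hacc : P.Accepts (t + j * P.n ^ P.D) i
  · rw [if_pos (Params.defect_eq_zero.2 hacc)]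
    rw [if_pos hacc] at hQ
    refine wp_readPass (u := t + j * P.n ^ P.D) (i := i) hE₂ hF
      (by rw [ha₂ _ (by omega), ha₁ _ (by omega)]; simp) (by rw [hr₂ _ (by omega), hi]) hk₂ ht₂ huY
      him ?_
    intro s₃ c₃ ha₃ hS₃ hm₃ ho₃ hc₃
    have hr₃ : ∀ r < 12, s₃.reg r = s.reg r := fun r hr => by rw [ha₃ r (by omega), hr₂ r hr]
    have h12₃ : s₃.reg 12 = j := by rw [ha₃ _ (by omega), h12₂]
    have hE₃ := hE.of_agree (by omega) hr₃
    have hB₃ : Buckets P s₃.mem (P.pushed t i (j + 1)) := by rw [hm₃]; exact hB₂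
    have hcode : P.code (t + j * P.n ^ P.D) i < 2 ^ P.k := horner_lt (Params.bit_le hF) _ _
    generalize hSe : P.code (t + j * P.n ^ P.D) i = S at hS₃ hcode
    rw [pushPass, wp_ite, hS₃]
    split_ifs with hS0
    · rw [wp_skip]
      refine hQ _ _ hr₃ h12₃ (hB₃.congr fun S' _ => ?_) (by rw [ho₃, ho₂']) (by omega)
      rw [P.pushed_step _ _ _ _ hjn, if_neg]
      rintro ⟨h1, -, h2⟩
      omega
    · have hlen : (P.pushed t i (j + 1) S).length < P.n := by
        have := P.pushed_length_le t i (j + 1) S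
        omega
      have q1 : S * P.n + P.n ≤ 2 ^ P.k * P.n := by
        have := Nat.mul_le_mul_right P.n hcode
        rwa [Nat.succ_mul] at this
      simp only [block, wp_seq, wp_load, wp_mul, wp_add, wp_store, State.setReg_reg]
      simp [hE₃.h0, hE₃.h1, hE₃.h3, hS₃, h12₃, hB₃.length S hcode]
      have hcomm' : S * P.n + 2 ^ P.k = 2 ^ P.k + S * P.n := add_comm _ _
      rw [hcomm']
      refine ⟨by omega, by omega, by omega, by omega, hQ _ _ (fun r hr => ?_) ?_
        ((hB₃.push hcode hlen j).congr fun S' hS' => ?_) (by rw [← ho₂', ← ho₃]) (by omega)⟩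
      · simp only [State.setReg_reg]
        iterate 5 rw [if_neg (by omega)]
        exact hr₃ r hr
      · simpa using h12₃
      · rw [P.pushed_step _ _ _ _ hjn]
        rcases eq_or_ne S' S with rfl | hne
        · simp [hS0, hacc, hSe]
        · rw [Function.update_of_ne hne, if_neg]
          rintro ⟨-, -, h⟩
          exact hne (by rw [← h, hSe])
  · rw [if_neg (fun h => hacc (Params.defect_eq_zero.1 h))]
    rw [if_neg hacc] at hQ
    refine hQ _ _ hr₂ h12₂ (hB₂.congr fun S' _ => ?_) ho₂' (by omega)
    rw [P.pushed_step _ _ _ _ hjn, if_neg]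
    rintro ⟨-, h, -⟩
    exact hacc h

end

end WordRAM

/-! ### Writing out a clique. -/

namespace WordRAM

open Program

/-- Writes out the parts with one vertex. -/
def emitSingles (D : ℕ) : Program :=
  block [.mul 20 10 1, .const 21 D, .loop 21 (block
    [.div 24 20 0, .mul 25 24 0, .sub 22 20 25, .mul 20 24 1, .emit 1, .emit 22, .sub 21 21 1])]

/-- Writes out a bucket, whose size is in register `13`. -/
def emitBucket : Program :=
  block [.emit 13, .mul 22 12 0, .add 22 22 3, .loop 13 (block
    [.sub 13 13 1, .add 23 22 13, .load 24 23, .emit 24])]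

/-- Writes out the set that is coded by the bits of register `12`. -/
def emitMembers : Program :=
  block [.mul 20 12 1, .mul 21 2 1, .const 22 0, .loop 21 (block
    [.div 24 20 8, .mul 25 24 8, .sub 25 20 25, .mul 20 24 1, .add 22 22 25, .sub 21 21 1]),
    .emit 22, .mul 20 12 1, .mul 21 2 1, .mul 22 11 2, .loop 21 (block
    [.div 24 20 8, .mul 25 24 8, .sub 25 20 25, .mul 20 24 1, .ite 25 (.emit 22) .skip,
      .add 22 22 1, .sub 21 21 1])]

/-- Writes out a clique and empties its bucket. -/
def emitPass (D : ℕ) : Program :=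
  block [.sub 12 12 1, .load 13 12, .ite 13 (block
    [emitSingles D, emitBucket, emitMembers, .const 14 0, .store 12 14]) .skip]

/-- What is written out for a clique that may be empty. -/
def Params.output (P : Params) (t i S : ℕ) : List ℕ :=
  if P.bucket t i S = [] then [] else P.word t i S

section

variable {P : Params} {W : ℕ} {s : State} {c : ℕ} {Q : State → ℕ → Prop} {t i j S : ℕ}

theorem wp_emitSingles (hE : Env P s) (hF : Fits P W) (ht : s.reg 10 = t) (htW : t < W)
    (hQ : ∀ s' c', (∀ r < 20, s'.reg r = s.reg r) → s'.mem = s.mem →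
      s'.out = s.out ++ (List.range P.D).flatMap (fun j => [1, P.digit t j]) →
      c' ≤ c + 8 * P.D + 3 → Q s' c') :
    WP P.inp W (emitSingles P.D) s c Q := by
  have hm := hF.m_pos
  have h1 := hF.lt₁
  have hDm : P.D + 2 ≤ (P.D + 2) * P.m := Nat.le_mul_of_pos_right _ hm
  simp only [emitSingles, block, wp_seq, wp_mul, wp_const]
  simp [ht, hE.h1]
  refine ⟨by omega, by omega, ?_⟩
  refine wp_loop_up (fun j s' => (∀ r < 20, s'.reg r = s.reg r) ∧ s'.mem = s.mem ∧
    s'.reg 20 = t / P.n ^ j ∧ s'.reg 21 = P.D - j ∧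
    s'.out = s.out ++ (List.range j).flatMap (fun j => [1, P.digit t j]))
    7 P.D (fun j s h => h.2.2.2.1) ?_ ?_ ?_
  · rintro j hj s' c' ⟨ha, hmem, hq, hcnt, hout⟩
    have e0 : s'.reg 0 = P.n := by rw [ha _ (by omega), hE.h0]
    have e1 : s'.reg 1 = 1 := by rw [ha _ (by omega), hE.h1]
    have q1 : t / P.n ^ j ≤ t := Nat.div_le_self _ _
    have q2 : t / P.n ^ (j + 1) ≤ t := Nat.div_le_self _ _
    have q3 : t / P.n ^ j / P.n * P.n ≤ t := (Nat.div_mul_le_self _ _).trans q1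
    have q5 : P.digit t j ≤ t := (Nat.mod_le _ _).trans q1
    simp [wp_seq, wp_mul, wp_div, wp_sub, wp_emit, e0, e1, hq, hcnt, P.digit_succ,
      P.div_pow_succ]
    refine ⟨by omega, by rw [pow_succ, ← Nat.div_div_eq_div_mul]; omega, by omega, by omega,
      by omega, fun r hr => ?_, hmem, by omega, ?_⟩
    · iterate 5 rw [if_neg (by omega)]
      exact ha r hr
    · simp [hout, List.range_succ]
  · simp only [State.setReg_reg, State.setReg_mem, State.setReg_out]
    refine ⟨fun r hr => ?_, trivial, by simp, by simp, by simp⟩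
    iterate 2 rw [if_neg (by omega)]
  · rintro s' c' ⟨ha, hmem, -, -, hout⟩ hc
    exact hQ s' c' ha hmem hout (by omega)

theorem wp_emitBucket {B : ℕ → List ℕ} (hE : Env P s) (hF : Fits P W) (hS : s.reg 12 = S)
    (hS2 : S < 2 ^ P.k) (hB : Buckets P s.mem B) (h13 : s.reg 13 = (B S).length)
    (hQ : ∀ s' c', (∀ r < 13, s'.reg r = s.reg r) → s'.mem = s.mem →
      s'.out = s.out ++ ((B S).length :: (B S).reverse) →
      c' ≤ c + 5 * (B S).length + 4 → Q s' c') :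
    WP P.inp W emitBucket s c Q := by
  have h6 := hF.lt₆
  have q1 : S * P.n + P.n ≤ 2 ^ P.k * P.n := by
    have := Nat.mul_le_mul_right P.n hS2
    rwa [Nat.succ_mul] at this
  have q2 := hB.le S hS2
  simp only [emitBucket, block, wp_seq, wp_mul, wp_add, wp_emit, State.setReg_reg]
  simp [h13, hS, hE.h0, hE.h3]
  refine ⟨by omega, by omega, ?_⟩
  refine wp_loop_down (fun j s' => (∀ r < 13, s'.reg r = s.reg r) ∧ s'.mem = s.mem ∧
    s'.reg 22 = S * P.n + 2 ^ P.k ∧ s'.reg 13 = j ∧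
    s'.out = s.out ++ ((B S).length :: ((B S).drop j).reverse))
    (fun _ => 4) (B S).length (fun j s h => h.2.2.2.1) ?_ ?_ ?_
  · rintro j hj s' c' ⟨ha, hmem, h22, hcnt, hout⟩
    have e1 : s'.reg 1 = 1 := by rw [ha _ (by omega), hE.h1]
    have hget := hB.getElem S hS2 j hj
    simp [wp_seq, wp_add, wp_sub, wp_emit, wp_load, e1, hcnt, h22]
    refine ⟨by omega, by omega, fun r hr => ?_, hmem, ?_⟩
    · iterate 3 rw [if_neg (by omega)]
      exact ha r hr
    · rw [hout, hmem, add_comm (S * P.n), hget, List.drop_eq_getElem_cons hj,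
        List.reverse_cons, List.append_assoc, List.cons_append]
  · simp only [State.setReg_reg, State.setReg_mem, State.setReg_out]
    refine ⟨fun r hr => ?_, trivial, by simp, by simpa using h13, by simp⟩
    iterate 2 rw [if_neg (by omega)]
  · rintro s' c' ⟨ha, hmem, -, -, hout⟩ hc
    refine hQ s' c' ha hmem (by simpa using hout) ?_
    simp at hc
    omega

/-- The size must precede the vertices, so the bits of `S` are run through twice, first to count
them and then to list them. -/
theorem wp_emitMembers (hE : Env P s) (hF : Fits P W) (hS : s.reg 12 = S) (hi : s.reg 11 = i)
    (him : i < P.m) (hS2 : S < 2 ^ P.k)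
    (hQ : ∀ s' c', (∀ r < 13, s'.reg r = s.reg r) → s'.mem = s.mem →
      s'.out = s.out ++ ((P.members i S).length :: P.members i S) →
      c' ≤ c + 16 * P.k + 9 → Q s' c') :
    WP P.inp W emitMembers s c Q := by
  have h4 := hF.lt₄
  have h5 := hF.lt₅
  have hmk : P.k ≤ P.m * P.k := Nat.le_mul_of_pos_left _ hF.m_pos
  have hik : i * P.k + P.k ≤ P.m * P.k := by
    have := Nat.mul_le_mul_right P.k him
    rwa [Nat.succ_mul] at this
  have hdiv : ∀ j, S / 2 ^ j / 2 = S / 2 ^ (j + 1) := fun j => by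
    rw [Nat.div_div_eq_div_mul, pow_succ]
  have hmod : ∀ j, S / 2 ^ j - S / 2 ^ (j + 1) * 2 = S / 2 ^ j % 2 := fun j => by
    rw [← hdiv]
    omega
  have hsucc : ∀ j, (List.range (j + 1)).filter (fun c => S / 2 ^ c % 2 = 1) =
      (List.range j).filter (fun c => S / 2 ^ c % 2 = 1) ++
        if S / 2 ^ j % 2 = 1 then [j] else [] := by
    intro j
    rw [List.range_succ, List.filter_append]
    by_cases h : S / 2 ^ j % 2 = 1 <;> simp [h]
  have hlen : ∀ j, ((List.range j).filter (fun c => S / 2 ^ c % 2 = 1)).length ≤ j := fun j =>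
    (List.length_filter_le _ _).trans (by simp)
  simp only [emitMembers, block, wp_seq, wp_mul, wp_const]
  simp [hS, hE.h1, hE.h2]
  refine ⟨by omega, by omega, by omega, ?_⟩
  refine wp_loop_up (fun j s' => (∀ r < 13, s'.reg r = s.reg r) ∧ s'.mem = s.mem ∧
    s'.out = s.out ∧ s'.reg 20 = S / 2 ^ j ∧ s'.reg 21 = P.k - j ∧
    s'.reg 22 = ((List.range j).filter (fun c => S / 2 ^ c % 2 = 1)).length)
    6 P.k (fun j s h => h.2.2.2.2.1) ?_ ?_ ?_
  · rintro j hj s' c' ⟨ha, hmem, hout, hq, hcnt, hpop⟩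
    have e1 : s'.reg 1 = 1 := by rw [ha _ (by omega), hE.h1]
    have e8 : s'.reg 8 = 2 := by rw [ha _ (by omega), hE.h8]
    have q1 : S / 2 ^ j ≤ S := Nat.div_le_self _ _
    have q2 : S / 2 ^ (j + 1) ≤ S := Nat.div_le_self _ _
    have q3 := hlen j
    simp [wp_seq, wp_add, wp_mul, wp_div, wp_sub, e1, e8, hq, hcnt, hpop, hdiv, hmod]
    refine ⟨by omega, by omega, by omega, by omega, by omega, by omega, fun r hr => ?_, hmem,
      hout, by omega, ?_⟩
    · iterate 6 rw [if_neg (by omega)]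
      exact ha r hr
    · rw [hsucc]
      split_ifs with h
      · simp [h]
      · have : S / 2 ^ j % 2 = 0 := by omega
        simp [this]
  · simp only [State.setReg_reg, State.setReg_mem, State.setReg_out]
    refine ⟨fun r hr => ?_, trivial, trivial, by simp, by simp, by simp⟩
    iterate 3 rw [if_neg (by omega)]
  rintro s₁ c₁ ⟨ha₁, hmem₁, hout₁, -, -, hpop₁⟩ hc₁
  have e1 : s₁.reg 1 = 1 := by rw [ha₁ _ (by omega), hE.h1]
  have e2 : s₁.reg 2 = P.k := by rw [ha₁ _ (by omega), hE.h2]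
  have e11 : s₁.reg 11 = i := by rw [ha₁ _ (by omega), hi]
  have e12 : s₁.reg 12 = S := by rw [ha₁ _ (by omega), hS]
  simp only [wp_emit]
  simp [e1, e2, e11, e12, hpop₁]
  refine ⟨by omega, by omega, by omega, ?_⟩
  refine wp_loop_up (fun j s' => (∀ r < 13, s'.reg r = s.reg r) ∧ s'.mem = s.mem ∧
    s'.reg 20 = S / 2 ^ j ∧ s'.reg 21 = P.k - j ∧ s'.reg 22 = i * P.k + j ∧
    s'.out = s.out ++ ((P.members i S).length ::
      ((List.range j).filter (fun c => S / 2 ^ c % 2 = 1)).map fun c => i * P.k + c))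
    8 P.k (fun j s h => h.2.2.2.1) ?_ ?_ ?_
  · rintro j hj s' c' ⟨ha, hmem, hq, hcnt, ha22, hout⟩
    have e1 : s'.reg 1 = 1 := by rw [ha _ (by omega), hE.h1]
    have e8 : s'.reg 8 = 2 := by rw [ha _ (by omega), hE.h8]
    have q1 : S / 2 ^ j ≤ S := Nat.div_le_self _ _
    have q2 : S / 2 ^ (j + 1) ≤ S := Nat.div_le_self _ _
    have q6 : i * P.k ≤ P.m * P.k := by omega
    simp [wp_seq, wp_add, wp_mul, wp_div, wp_sub, wp_ite, wp_emit, wp_skip, e1, e8, hq, hcnt, ha22,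
      hdiv, hmod]
    refine ⟨by omega, by omega, by omega, by omega, ?_⟩
    split_ifs with h
    · refine ⟨by omega, by omega, ⟨fun r hr => ?_, hmem, by omega, by omega, ?_⟩⟩
      · iterate 5 rw [if_neg (by omega)]
        exact ha r hr
      · rw [hsucc, hout]
        simp [h]
    · have h1 : S / 2 ^ j % 2 = 1 := by omega
      refine ⟨by omega, by omega, ⟨fun r hr => ?_, hmem, by omega, by omega, ?_⟩⟩
      · iterate 5 rw [if_neg (by omega)]
        exact ha r hr
      · rw [hsucc, hout]
        simp [h1]
  · simp only [State.setReg_reg, State.setReg_mem, State.setReg_out]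
    refine ⟨fun r hr => ?_, hmem₁, by simp, by simp, by simp, ?_⟩
    · iterate 3 rw [if_neg (by omega)]
      exact ha₁ r hr
    · simp [hout₁, Params.members]
  · rintro s' c' ⟨ha, hmem, -, -, -, hout⟩ hc
    exact hQ s' c' ha hmem hout (by omega)

theorem wp_emitPass {B : ℕ → List ℕ} (hE : Env P s) (hF : Fits P W) (ht : s.reg 10 = t)
    (hi : s.reg 11 = i) (hS : s.reg 12 = S + 1) (htW : t < W) (him : i < P.m) (hS2 : S < 2 ^ P.k)
    (hB : Buckets P s.mem B) (hBS : B S = (P.bucket t i S).reverse)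
    (hQ : ∀ s' c', (∀ r < 12, s'.reg r = s.reg r) → s'.reg 12 = S →
      Buckets P s'.mem (Function.update B S []) → s'.out = s.out ++ P.output t i S →
      c' ≤ c + (8 * P.D + 5 * (P.bucket t i S).length + 16 * P.k + 21) → Q s' c') :
    WP P.inp W (emitPass P.D) s c Q := by
  have h5 := hF.lt₅
  have hlen : (B S).length = (P.bucket t i S).length := by rw [hBS, List.length_reverse]
  simp only [emitPass, block, wp_seq, wp_sub, wp_load, wp_ite, State.setReg_reg]
  simp [hS, hE.h1, hB.length S hS2]
  refine ⟨by omega, ?_⟩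
  split_ifs with h
  · rw [wp_skip]
    refine hQ _ _ (fun r hr => ?_) ?_ (hB.congr fun S' hS' => ?_) ?_ (by omega)
    · simp only [State.setReg_reg]
      iterate 2 rw [if_neg (by omega)]
    · simp
    · rcases eq_or_ne S' S with rfl | hne
      · simp [h]
      · simp [hne]
    · have : P.bucket t i S = [] := by simpa [hBS] using h
      simp [Params.output, this]
  · have hne : P.bucket t i S ≠ [] := by simpa [hBS] using h
    refine wp_emitSingles (t := t) (hE.of_agree (c := 12) (by omega) fun r hr => ?_) hF
      (by simpa using ht) htW ?_
    · simp only [State.setReg_reg]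
      iterate 2 rw [if_neg (by omega)]
    intro s₁ c₁ ha₁ hm₁ ho₁ hc₁
    have hr₁ : ∀ r < 12, s₁.reg r = s.reg r := by
      intro r hr
      rw [ha₁ r (by omega)]
      simp only [State.setReg_reg]
      iterate 2 rw [if_neg (by omega)]
    refine wp_emitBucket (S := S) (B := B) (hE.of_agree (by omega) hr₁) hF
      (by rw [ha₁ _ (by omega)]; simp) hS2 (by rw [hm₁]; exact hB)
      (by rw [ha₁ _ (by omega)]; simp) ?_
    intro s₂ c₂ ha₂ hm₂ ho₂ hc₂
    have hr₂ : ∀ r < 12, s₂.reg r = s.reg r := fun r hr => by rw [ha₂ r (by omega), hr₁ r hr]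
    have h12 : s₂.reg 12 = S := by rw [ha₂ _ (by omega), ha₁ _ (by omega)]; simp
    refine wp_emitMembers (S := S) (i := i) (hE.of_agree (by omega) hr₂) hF h12
      (by rw [hr₂ _ (by omega), hi]) him hS2 ?_
    intro s₃ c₃ ha₃ hm₃ ho₃ hc₃
    have h12' : s₃.reg 12 = S := by rw [ha₃ _ (by omega), h12]
    simp only [wp_const, wp_store]
    refine ⟨by omega, hQ _ _ (fun r hr => ?_) ?_ ?_ ?_ (by omega)⟩
    · simp only [State.setReg_reg]
      rw [if_neg (by omega), ha₃ r (by omega), hr₂ r hr]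
    · simpa using h12'
    · simp [h12', hm₃, hm₂, hm₁]
      exact hB.clear hS2
    · simp [ho₃, ho₂, ho₁, Params.output, hne, Params.word, hBS]

end

end WordRAM

/-! ### The nested loops and their total cost. -/

namespace WordRAM

open Program

/-- Handles all cliques with given one-vertex parts and a given block. -/
def blockPass (D : ℕ) : Program :=
  block [.sub 11 11 1, .mul 12 0 1, .loop 12 (vertexPass D), .mul 12 3 1, .loop 12 (emitPass D)]

/-- Handles all cliques with given one-vertex parts. -/
def tuplePass (D : ℕ) : Program :=
  block [.sub 10 10 1, .mul 11 4 1, .loop 11 (blockPass D)]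

/-- The main part of the program. -/
def mainPass (D : ℕ) : Program :=
  block [.mul 10 5 1, .loop 10 (tuplePass D)]

/-- The concatenation of `f (N - 1), f (N - 2), …, f j`. -/
def descFlat (f : ℕ → List ℕ) (N j : ℕ) : List ℕ := (List.range' j (N - j)).reverse.flatMap f

theorem descFlat_self (f : ℕ → List ℕ) (N : ℕ) : descFlat f N N = [] := by simp [descFlat]

theorem descFlat_step (f : ℕ → List ℕ) {N j : ℕ} (hj : j < N) :
    descFlat f N j = descFlat f N (j + 1) ++ f j := by
  unfold descFlat
  rw [show N - j = N - (j + 1) + 1 by omega, List.range'_succ]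
  simp

/-- The number of vertices that are accepted. -/
def Params.accepted (P : Params) (t i : ℕ) : ℕ :=
  ((Finset.range P.n).filter fun b => P.Accepts (t + b * P.n ^ P.D) i).card

/-- A bound for the time of a run of `blockPass`. -/
def Params.cost (P : Params) (t i : ℕ) : ℕ :=
  P.n * (25 * (P.D + 1) + 25) + 2 ^ P.k * (8 * P.D + 16 * P.k + 22) +
    (13 * P.k + 16) * P.accepted t i + 6

section

variable {P : Params} {W : ℕ} {s : State} {c : ℕ} {Q : State → ℕ → Prop} {t i : ℕ}

theorem Params.bucket_length (S : ℕ) (hS : S ≠ 0) :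
    (P.bucket t i S).length = (((Finset.range P.n).filter
      fun b => P.Accepts (t + b * P.n ^ P.D) i).filter
        fun b => P.code (t + b * P.n ^ P.D) i = S).card := by
  rw [Finset.filter_filter, Params.bucket, if_neg hS, ← Multiset.coe_card, ← Multiset.filter_coe]
  rfl

/-- The buckets are the fibres of `code` on the accepted vertices, except that the fibre of `0` is
discarded. The cost of writing them out can therefore be charged to the accepted vertices. -/
theorem Params.sum_bucket_length_le (hF : Fits P W) (t i : ℕ) :
    ∑ S ∈ Finset.range (2 ^ P.k), (P.bucket t i S).length ≤ P.accepted t i := by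
  unfold Params.accepted
  rw [Finset.card_eq_sum_card_fiberwise (f := fun b => P.code (t + b * P.n ^ P.D) i)
    (t := Finset.range (2 ^ P.k))
    fun b _ => Finset.mem_coe.2 (Finset.mem_range.2 (horner_lt (Params.bit_le hF) _ _))]
  refine Finset.sum_le_sum fun S _ => ?_
  rcases eq_or_ne S 0 with rfl | hS
  · simp [Params.bucket]
  · exact (P.bucket_length S hS).le

theorem wp_blockPass (hE : Env P s) (hF : Fits P W) (ht : s.reg 10 = t) (hi : s.reg 11 = i + 1)
    (htX : t < P.n ^ P.D) (htW : t < W) (him : i < P.m) (hmem : ∀ S < 2 ^ P.k, s.mem S = 0)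
    (hQ : ∀ s' c', (∀ r < 11, s'.reg r = s.reg r) → s'.reg 11 = i →
      (∀ S < 2 ^ P.k, s'.mem S = 0) →
      s'.out = s.out ++ descFlat (P.output t i) (2 ^ P.k) 0 → c' ≤ c + P.cost t i → Q s' c') :
    WP P.inp W (blockPass P.D) s c Q := by
  have h4 := hF.lt₄
  have h5 := hF.lt₅
  have hn := hF.n_lt
  have hmk : P.m ≤ P.m * P.k := Nat.le_mul_of_pos_right _ hF.k_pos
  simp only [blockPass, block, wp_seq, wp_sub, wp_mul, State.setReg_reg]
  simp [hi, hE.h0, hE.h1]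
  refine ⟨by omega, by omega, ?_⟩
  refine wp_loop_down (fun j s' => (∀ r < 11, s'.reg r = s.reg r) ∧ s'.reg 11 = i ∧
    s'.reg 12 = j ∧ Buckets P s'.mem (P.pushed t i j) ∧ s'.out = s.out)
    (fun j => 25 * (P.D + 1) + 24 +
        if P.Accepts (t + j * P.n ^ P.D) i then 13 * P.k + 11 else 0)
    P.n (fun j s h => h.2.2.1) ?_ ?_ ?_
  · rintro j hj s' c' ⟨ha, h11, h12, hB, hout⟩
    refine wp_vertexPass (t := t) (i := i) (hE.of_agree (by omega) ha) hF
      (by rw [ha _ (by omega), ht]) h11 h12 htX him hj hB ?_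
    intro s'' c'' ha' h12' hB' hout' hc'
    exact ⟨⟨fun r hr => by rw [ha' r (by omega), ha r hr], by rw [ha' _ (by omega), h11], h12',
      hB', by rw [hout', hout]⟩, hc'⟩
  · refine ⟨fun r hr => ?_, by simp, by simp, ?_, rfl⟩
    · simp only [State.setReg_reg]
      iterate 2 rw [if_neg (by omega)]
    · refine (Buckets.empty (P := P) hmem).congr fun S _ => ?_
      exact P.pushed_self t i S
  rintro s₁ c₁ ⟨ha₁, h11₁, -, hB₁, hout₁⟩ hc₁
  have e1 : s₁.reg 1 = 1 := by rw [ha₁ _ (by omega), hE.h1]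
  have e3 : s₁.reg 3 = 2 ^ P.k := by rw [ha₁ _ (by omega), hE.h3]
  simp [e1, e3]
  refine ⟨by omega, ?_⟩
  -- The buckets from `j` on have been written out and emptied. At the end all sizes are zero again,
  -- which is the precondition for the next block.
  refine wp_loop_down (fun j s' => (∀ r < 11, s'.reg r = s.reg r) ∧ s'.reg 11 = i ∧
    s'.reg 12 = j ∧ Buckets P s'.mem (fun S => if S < j then P.pushed t i 0 S else []) ∧
    s'.out = s.out ++ descFlat (P.output t i) (2 ^ P.k) j)
    (fun S => 8 * P.D + 5 * (P.bucket t i S).length + 16 * P.k + 21)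
    (2 ^ P.k) (fun j s h => h.2.2.1) ?_ ?_ ?_
  · rintro S hS s' c' ⟨ha, h11, h12, hB, hout⟩
    refine wp_emitPass (t := t) (i := i) (S := S) (hE.of_agree (by omega) ha) hF
      (by rw [ha _ (by omega), ht]) h11 h12 htW him hS hB (by simp [P.pushed_zero]) ?_
    intro s'' c'' ha' h12' hB' hout' hc'
    refine ⟨⟨fun r hr => by rw [ha' r (by omega), ha r hr], by rw [ha' _ (by omega), h11], h12',
      hB'.congr fun S' _ => ?_, by rw [hout', hout, descFlat_step _ hS, List.append_assoc]⟩, hc'⟩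
    rcases lt_trichotomy S' S with h | rfl | h
    · rw [Function.update_of_ne (by omega), if_pos h, if_pos (by omega)]
    · simp
    · rw [Function.update_of_ne (by omega), if_neg (by omega), if_neg (by omega)]
  · refine ⟨fun r hr => ?_, by simpa using h11₁, by simp, hB₁.congr fun S hS => if_pos hS, ?_⟩
    · simp only [State.setReg_reg]
      rw [if_neg (by omega)]
      exact ha₁ r hr
    · simpa [descFlat_self] using hout₁
  · rintro s₂ c₂ ⟨ha₂, h11₂, -, hB₂, hout₂⟩ hc₂
    refine hQ s₂ c₂ ha₂ h11₂ (fun S hS => by simpa using hB₂.length S hS) hout₂ ?_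
    have hs : ∀ (N a : ℕ) (f : ℕ → ℕ), ∑ j ∈ Finset.range N, (a + f j) =
        N * a + ∑ j ∈ Finset.range N, f j := fun N a f => by simp [Finset.sum_add_distrib]
    have h1 : ∑ j ∈ Finset.range P.n, (25 * (P.D + 1) + 24 +
        (if P.Accepts (t + j * P.n ^ P.D) i then 13 * P.k + 11 else 0) + 1) =
        P.n * (25 * (P.D + 1) + 25) + (13 * P.k + 11) * P.accepted t i := by
      rw [Params.accepted, Finset.card_filter, Finset.mul_sum, ← hs]
      refine Finset.sum_congr rfl fun j _ => ?_
      split_ifs <;> ring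
    have h2 : ∑ S ∈ Finset.range (2 ^ P.k),
        (8 * P.D + 5 * (P.bucket t i S).length + 16 * P.k + 21 + 1) =
        2 ^ P.k * (8 * P.D + 16 * P.k + 22) +
          5 * ∑ S ∈ Finset.range (2 ^ P.k), (P.bucket t i S).length := by
      rw [Finset.mul_sum, ← hs]
      refine Finset.sum_congr rfl fun j _ => ?_
      ring
    have h3 := Params.sum_bucket_length_le hF t i
    rw [h1] at hc₁
    rw [h2] at hc₂
    -- An accepted vertex costs `13 k + 11` steps for reading and storing, and `5` more for being
    -- written out.
    have h4 : (13 * P.k + 16) * P.accepted t i =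
      (13 * P.k + 11) * P.accepted t i + 5 * P.accepted t i := by ring
    rw [Params.cost, h4]
    omega

theorem wp_tuplePass (hE : Env P s) (hF : Fits P W) (ht : s.reg 10 = t + 1)
    (htX : t < P.n ^ P.D) (htW : t < W) (hmem : ∀ S < 2 ^ P.k, s.mem S = 0)
    (hQ : ∀ s' c', (∀ r < 10, s'.reg r = s.reg r) → s'.reg 10 = t →
      (∀ S < 2 ^ P.k, s'.mem S = 0) →
      s'.out = s.out ++ descFlat (fun i => descFlat (P.output t i) (2 ^ P.k) 0) P.m 0 →
      c' ≤ c + (∑ i ∈ Finset.range P.m, (P.cost t i + 1) + 3) → Q s' c') :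
    WP P.inp W (tuplePass P.D) s c Q := by
  have h4 := hF.lt₄
  have hmk : P.m ≤ P.m * P.k := Nat.le_mul_of_pos_right _ hF.k_pos
  simp only [tuplePass, block, wp_seq, wp_sub, wp_mul, State.setReg_reg]
  simp [ht, hE.h4, hE.h1]
  refine ⟨by omega, by omega, ?_⟩
  refine wp_loop_down (fun j s' => (∀ r < 10, s'.reg r = s.reg r) ∧ s'.reg 10 = t ∧
    s'.reg 11 = j ∧ (∀ S < 2 ^ P.k, s'.mem S = 0) ∧
    s'.out = s.out ++ descFlat (fun i => descFlat (P.output t i) (2 ^ P.k) 0) P.m j)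
    (P.cost t) P.m (fun j s h => h.2.2.1) ?_ ?_ ?_
  · rintro i hi s' c' ⟨ha, h10, h11, hm, hout⟩
    refine wp_blockPass (t := t) (i := i) (hE.of_agree (by omega) ha) hF h10 h11 htX htW hi hm ?_
    intro s'' c'' ha' h11' hm' hout' hc'
    exact ⟨⟨fun r hr => by rw [ha' r (by omega), ha r hr], by rw [ha' _ (by omega), h10], h11',
      hm', by rw [hout', hout, descFlat_step _ hi, List.append_assoc]⟩, hc'⟩
  · refine ⟨fun r hr => ?_, by simp, by simp, hmem, by simp [descFlat_self]⟩
    simp only [State.setReg_reg]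
    iterate 2 rw [if_neg (by omega)]
  · rintro s' c' ⟨ha, h10, -, hm, hout⟩ hc
    exact hQ s' c' ha h10 hm hout (by omega)

/-- All that is written out. -/
def Params.result (P : Params) : List ℕ :=
  descFlat (fun t => descFlat (fun i => descFlat (P.output t i) (2 ^ P.k) 0) P.m 0) (P.n ^ P.D) 0

/-- A bound for the time of a run of `mainPass`. -/
def Params.totalCost (P : Params) : ℕ :=
  ∑ t ∈ Finset.range (P.n ^ P.D), (∑ i ∈ Finset.range P.m, (P.cost t i + 1) + 4) + 2

theorem wp_mainPass (hE : Env P s) (hF : Fits P W) (hX : P.n ^ P.D < W)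
    (hmem : ∀ S < 2 ^ P.k, s.mem S = 0)
    (hQ : ∀ s' c', s'.out = s.out ++ P.result → c' ≤ c + P.totalCost → Q s' c') :
    WP P.inp W (mainPass P.D) s c Q := by
  simp only [mainPass, block, wp_seq, wp_mul]
  simp [hE.h5, hE.h1]
  refine ⟨by omega, ?_⟩
  refine wp_loop_down (fun j s' => (∀ r < 10, s'.reg r = s.reg r) ∧ s'.reg 10 = j ∧
    (∀ S < 2 ^ P.k, s'.mem S = 0) ∧
    s'.out = s.out ++ descFlat (fun t => descFlat (fun i => descFlat (P.output t i)
      (2 ^ P.k) 0) P.m 0) (P.n ^ P.D) j)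
    (fun t => ∑ i ∈ Finset.range P.m, (P.cost t i + 1) + 3)
    (P.n ^ P.D) (fun j s h => h.2.1) ?_ ?_ ?_
  · rintro t ht s' c' ⟨ha, h10, hm, hout⟩
    refine wp_tuplePass (t := t) (hE.of_agree (by omega) ha) hF h10 ht (by omega) hm ?_
    intro s'' c'' ha' h10' hm' hout' hc'
    exact ⟨⟨fun r hr => by rw [ha' r (by omega), ha r hr], h10', hm',
      by rw [hout', hout, descFlat_step _ ht, List.append_assoc]⟩, hc'⟩
  · refine ⟨fun r hr => ?_, by simp, hmem, by simp [descFlat_self]⟩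
    simp only [State.setReg_reg]
    rw [if_neg (by omega)]
  · rintro s' c' ⟨ha, -, hm, hout⟩ hc
    have h : P.totalCost = ∑ t ∈ Finset.range (P.n ^ P.D),
        (∑ i ∈ Finset.range P.m, (P.cost t i + 1) + 3 + 1) + 2 := rfl
    exact hQ s' c' hout (by omega)

end

end WordRAM

/-! ### The choice of the block size and of the number of blocks, and the setup. -/

namespace WordRAM

open Program

theorem exists_lt_sq_mul_two_pow (n : ℕ) : ∃ j, n < (j + 2) ^ 2 * 2 ^ (j + 2) :=
  ⟨n, by
    have h1 : n + 2 < 2 ^ (n + 2) := Nat.lt_two_pow_self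
    have h2 : 1 ≤ (n + 2) ^ 2 := Nat.one_le_pow _ _ (by omega)
    nlinarith⟩

/-- The number of rounds in the computation of the size of the blocks. -/
def blockRounds (n : ℕ) : ℕ := Nat.find (exists_lt_sq_mul_two_pow n)

/-- The size of the blocks, which is the largest `k ≥ 1` with `k ^ 2 * 2 ^ k ≤ n` unless `n` is
very small. -/
def blockSize (n : ℕ) : ℕ := blockRounds n + 1

/-- The number of blocks. -/
def blockCount (D n : ℕ) : ℕ := (n / (blockSize n * (D + 2)) + 1) * (D + 2) + 1

/-- The parameters that the program uses. -/
def params (D n : ℕ) (inp : ℕ → ℕ) : Params := ⟨D, n, blockSize n, blockCount D n, inp⟩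

theorem lt_blockSize (n : ℕ) : n < (blockSize n + 1) ^ 2 * 2 ^ (blockSize n + 1) :=
  Nat.find_spec (exists_lt_sq_mul_two_pow n)

theorem le_of_lt_blockRounds {n j : ℕ} (hj : j < blockRounds n) :
    (j + 2) ^ 2 * 2 ^ (j + 2) ≤ n :=
  not_lt.1 (Nat.find_min (exists_lt_sq_mul_two_pow n) hj)

theorem blockSize_le_or (n : ℕ) :
    blockSize n = 1 ∨ blockSize n ^ 2 * 2 ^ blockSize n ≤ n := by
  rcases h : blockRounds n with _ | j
  · exact Or.inl (by rw [blockSize, h])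
  · refine Or.inr ?_
    rw [blockSize, h]
    exact le_of_lt_blockRounds (by omega)

theorem two_pow_blockSize_le (n : ℕ) : 2 ^ blockSize n ≤ n + 2 := by
  rcases blockSize_le_or n with h | h
  · rw [h]
    omega
  · have h1 : 1 ≤ blockSize n ^ 2 := Nat.one_le_pow _ _ (Nat.succ_pos _)
    nlinarith

theorem blockSize_le (n : ℕ) : blockSize n ≤ n + 2 :=
  Nat.lt_two_pow_self.le.trans (two_pow_blockSize_le n)

theorem le_blockCount_mul (D n : ℕ) : n ≤ blockCount D n * blockSize n := by
  have hk : 0 < blockSize n := Nat.succ_pos _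
  have h := Nat.lt_div_mul_add (a := n) (b := blockSize n * (D + 2)) (by positivity)
  rw [blockCount]
  nlinarith

theorem blockCount_mul_le (D n : ℕ) :
    blockCount D n * blockSize n ≤ n + (D + 3) * blockSize n := by
  have h := Nat.div_mul_le_self n (blockSize n * (D + 2))
  rw [blockCount]
  nlinarith

theorem blockCount_le (D n : ℕ) : blockCount D n ≤ n + D + 3 := by
  have h := Nat.div_mul_le_self n (blockSize n * (D + 2))
  have hk : 0 < blockSize n := Nat.succ_pos _
  rw [blockCount]
  have : n / (blockSize n * (D + 2)) * (D + 2) ≤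
      n / (blockSize n * (D + 2)) * (blockSize n * (D + 2)) :=
    Nat.mul_le_mul_left _ (Nat.le_mul_of_pos_left _ hk)
  nlinarith

/-- All quantities are bounded by short sums and products of powers of `n + 2`; the exponent `4 D +
20` is generous. Since `n + 2 ≥ 2`, even constants such as `D + 2` are below a power of it, so that
the word size is sufficient for every `n`. -/
theorem fits_params (D n : ℕ) {inp : ℕ → ℕ} (hinp : ∀ a, inp a ≤ 1) :
    Fits (params D n inp) ((n + 2) ^ (4 * D + 20)) ∧ 8 * n + 16 < (n + 2) ^ (4 * D + 20) ∧
      2 ^ (D + 2) < (n + 2) ^ (4 * D + 20) := by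
  set N := n + 2 with hN
  have hN2 : 2 ≤ N := by omega
  have hmono : ∀ {a b : ℕ}, a ≤ b → N ^ a ≤ N ^ b := fun h => Nat.pow_le_pow_right (by omega) h
  have hlt : ∀ {a b : ℕ}, a < b → N ^ a < N ^ b := fun h => Nat.pow_lt_pow_right (by omega) h
  have two : ∀ (a x y : ℕ), x ≤ N ^ a → y ≤ N ^ a → x + y ≤ N ^ (a + 1) := by
    intro a x y hx hy
    rw [pow_succ]
    nlinarith
  have hmul : ∀ {a b x y : ℕ}, x ≤ N ^ a → y ≤ N ^ b → x * y ≤ N ^ (a + b) := by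
    intro a b x y hx hy
    rw [pow_add]
    exact Nat.mul_le_mul hx hy
  have hpow2 : 2 ^ (D + 2) ≤ N ^ (D + 2) := Nat.pow_le_pow_left hN2 _
  have hd : D + 2 ≤ N ^ (D + 2) := Nat.lt_two_pow_self.le.trans hpow2
  have h2 : 2 ≤ N ^ 1 := by simpa using hN2
  have hn : n ≤ N ^ 1 := by rw [pow_one]; omega
  have hm : blockCount D n ≤ N ^ (D + 3) := by
    refine (blockCount_le D n).trans ?_
    have : n + 2 ≤ N ^ (D + 2) := by simpa using hmono (a := 1) (b := D + 2) (by omega)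
    have h1 := two (D + 2) (n + 2) (D + 2) this hd
    have e : D + 2 + 1 = D + 3 := rfl
    rw [e] at h1
    omega
  have hk : blockSize n ≤ N ^ 1 := by simpa using blockSize_le n
  have hK : 2 ^ blockSize n ≤ N ^ 1 := by simpa using two_pow_blockSize_le n
  have hY : n ^ (D + 1) ≤ N ^ (D + 1) := Nat.pow_le_pow_left (by omega) _
  have lift : ∀ {a b x : ℕ}, x ≤ N ^ a → a ≤ b → x ≤ N ^ b := fun hx h => hx.trans (hmono h)
  refine ⟨⟨Nat.succ_pos _, Nat.succ_pos _, ?_, hinp, le_blockCount_mul D n, ?_, ?_, ?_, ?_, ?_, ?_⟩,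
    ?_, hpow2.trans_lt (hlt (by omega))⟩
  · exact hn.trans_lt (hlt (by omega))
  · exact (hmul h2 (hmul hd hm)).trans_lt (hlt (by omega))
  · have h3 := two (D + 4) _ _ (lift (hmul hm hn) (by omega))
      (lift (show n + 1 ≤ N ^ 1 by rw [pow_one]; omega) (by omega))
    exact (hmul hd (by rw [← add_assoc] at h3; exact h3)).trans_lt (hlt (by omega))
  · exact (two (2 * D + 5) _ _ (lift (hmul (hmul hm hk) hY) (by omega))
      (lift hY (by omega))).trans_lt (hlt (by omega))
  · exact (two (D + 4) _ _ (hmul (a := D + 3) (b := 1) hm hn)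
      (hmul (a := D + 3) (b := 1) hm hk)).trans_lt (hlt (by omega))
  · exact (hmul h2 hK).trans_lt (hlt (by omega))
  · exact (two 3 _ _ (two 2 _ _ (hmul hK hn) (lift hK (by omega)))
      (lift hn (by omega))).trans_lt (hlt (by omega))
  · have h8 : 8 ≤ N ^ 3 := by
      calc 8 = 2 ^ 3 := rfl
        _ ≤ N ^ 3 := Nat.pow_le_pow_left hN2 3
    have h9 := hmul h8 (show n + 2 ≤ N ^ 1 by rw [pow_one])
    have h10 : N ^ (3 + 1) < N ^ (4 * D + 20) := hlt (by omega)
    omega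

/-- The test whether the blocks can be made larger. -/
def growTest : Program :=
  block [.add 22 2 1, .mul 22 22 22, .mul 22 22 3, .mul 22 8 22, .add 23 0 1, .sub 21 23 22]

/-- Computes the parameters. -/
def setup (D : ℕ) : Program :=
  block [.const 1 1, .const 2 1, .const 3 2, .const 7 (D + 2), .const 8 2, .const 5 1, growTest,
    .loop 21 (block [.add 2 2 1, .mul 3 8 3, growTest]),
    .const 21 D, .loop 21 (block [.mul 5 5 0, .sub 21 21 1]), .mul 6 5 0,
    .mul 22 2 7, .div 22 0 22, .add 22 22 1, .mul 22 22 7, .add 4 22 1]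

/-- The program that constructs the clique partition. -/
def partitionProgram (D : ℕ) : Program := .seq (setup D) (mainPass D)

/-- The search must not overflow at the first value that fails the test. That value is at most `8`
times the previous one, which was at most `n`: the square grows by a factor of at most `4` and the
power of two by a factor of `2`. The summand `16` is the value at `j = 0`. -/
theorem grow_bounds {n j : ℕ} (hj : j ≤ blockRounds n) :
    (j + 2) * (j + 2) ≤ 8 * n + 16 ∧ 2 ^ (j + 2) ≤ 8 * n + 16 ∧
      (j + 2) * (j + 2) * 2 ^ (j + 1) ≤ 8 * n + 16 ∧ 2 ^ (j + 1) ≤ 8 * n + 16 ∧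
      2 * ((j + 2) * (j + 2) * 2 ^ (j + 1)) = (j + 2) ^ 2 * 2 ^ (j + 2) ∧
      (j + 2) ^ 2 * 2 ^ (j + 2) ≤ 8 * n + 16 := by
  have h1 : (j + 2) ^ 2 * 2 ^ (j + 2) ≤ 8 * n + 16 := by
    rcases j with _ | j
    · norm_num
    · have h1 := le_of_lt_blockRounds (n := n) (j := j) (by omega)
      have h2 : (j + 1 + 2) ^ 2 ≤ 4 * (j + 2) ^ 2 := by nlinarith
      have h3 : 2 ^ (j + 1 + 2) = 2 * 2 ^ (j + 2) := by rw [← pow_succ']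
      rw [h3]
      nlinarith [Nat.mul_le_mul_right (2 * 2 ^ (j + 2)) h2]
  have h2 : 2 ^ (j + 2) = 2 * 2 ^ (j + 1) := by rw [← pow_succ']
  have h3 : 1 ≤ 2 ^ (j + 1) := Nat.one_le_two_pow
  rw [h2] at h1 ⊢
  generalize 2 ^ (j + 1) = p at h1 h3 ⊢
  have h4 : 1 ≤ (j + 2) * (j + 2) := by nlinarith
  have h5 : (j + 2) ^ 2 = (j + 2) * (j + 2) := sq _
  rw [h5] at h1 ⊢
  generalize (j + 2) * (j + 2) = q at h1 h4 ⊢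
  have h6 : q ≤ q * p := by nlinarith
  have h7 : p ≤ q * p := by nlinarith
  have h8 : q * (2 * p) = 2 * (q * p) := by ring
  omega

theorem wp_setup (D n : ℕ) {inp : ℕ → ℕ} (hinp : ∀ a, inp a ≤ 1) {Q : State → ℕ → Prop}
    (hQ : ∀ s' c', Env (params D n inp) s' → s'.mem = (fun _ => 0) → s'.out = [] →
      c' ≤ 9 * n + 3 * D + 40 → Q s' c') :
    WP inp ((n + 2) ^ (4 * D + 20)) (setup D) (start n) 0 Q := by
  obtain ⟨hF, h8, hD⟩ := fits_params D n hinp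
  generalize hW : (n + 2) ^ (4 * D + 20) = W at hF h8 hD
  have hDW : D + 2 < W := Nat.lt_two_pow_self.trans hD
  -- A crude bound, sufficient because a linear setup time is negligible against `n ^ d`.
  have hrn : blockRounds n ≤ n := by
    by_contra! h
    have h1 := le_of_lt_blockRounds h
    have h2 : n + 2 < 2 ^ (n + 2) := Nat.lt_two_pow_self
    have h3 : 1 ≤ (n + 2) ^ 2 := Nat.one_le_pow _ _ (by omega)
    nlinarith
  have hbound' := fun j hj => grow_bounds (n := n) (j := j) hj
  have hzero : ∀ j ≤ blockRounds n,
      (n + 1 - (j + 2) ^ 2 * 2 ^ (j + 2) = 0 ↔ blockRounds n ≤ j) := by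
    intro j hj
    constructor
    · intro h
      by_contra! hlt
      have := le_of_lt_blockRounds hlt
      omega
    · intro h
      have : j = blockRounds n := le_antisymm hj h
      have h1 := lt_blockSize n
      rw [blockSize, ← this] at h1
      have e : j + 1 + 1 = j + 2 := rfl
      rw [e] at h1
      omega
  simp only [setup, growTest, block, wp_seq, wp_const, wp_add, wp_mul, wp_sub, State.setReg_reg]
  simp [start]
  refine ⟨by omega, by omega, by omega, by omega, by omega, by omega, by omega, by omega, by omega,
    by omega, by omega, ?_⟩
  -- This loop is controlled by a test and not by a counter: register `21` is zero exactly when the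
  -- current block size is the final one.
  refine wp_loop (fun j s => s.reg 0 = n ∧ s.reg 1 = 1 ∧ s.reg 2 = blockRounds n - j + 1 ∧
    s.reg 3 = 2 ^ (blockRounds n - j + 1) ∧ s.reg 5 = 1 ∧ s.reg 7 = D + 2 ∧ s.reg 8 = 2 ∧
    s.mem = (fun _ => 0) ∧ s.out = [] ∧
    s.reg 21 = n + 1 - (blockRounds n - j + 2) ^ 2 * 2 ^ (blockRounds n - j + 2))
    (fun _ => 8) (blockRounds n) ?_ ?_ ?_ ?_
  · rintro j hj s ⟨-, -, -, -, -, -, -, -, -, h21⟩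
    rw [h21, hzero _ (by omega)]
    omega
  · rintro j hj s c ⟨h0, h1, h2, h3, h5, h7, h8', hm, ho, -⟩
    obtain ⟨g, hg⟩ : ∃ g, blockRounds n = j + 1 + g := ⟨blockRounds n - (j + 1), by omega⟩
    have e1 : blockRounds n - (j + 1) = g := by omega
    have e2 : blockRounds n - j = g + 1 := by omega
    obtain ⟨b1, b2, b3, b4, b5, b6⟩ := hbound' (g + 1) (by omega)
    rw [e1] at h2 h3
    have e3 : 2 * 2 ^ (g + 1) = 2 ^ (g + 1 + 1) := (pow_succ' _ _).symm
    simp [wp_seq, wp_add, wp_mul, wp_sub, h0, h1, h2, h3, h5, h7, h8', hm, ho, e2, e3]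
    rw [show g + 1 + 1 + 1 = g + 1 + 2 from rfl, b5]
    exact ⟨by omega, by omega, by omega, by omega, by omega, by omega, by omega, by omega, rfl⟩
  · simp
  rintro s₁ c₁ ⟨h0, h1, h2, h3, h5, h7, h8', hm, ho, -⟩ hc₁
  rw [Nat.sub_zero] at h2 h3
  refine ⟨by omega, ?_⟩
  refine wp_loop_up (fun j s => s.reg 0 = n ∧ s.reg 1 = 1 ∧ s.reg 2 = blockSize n ∧
    s.reg 3 = 2 ^ blockSize n ∧ s.reg 5 = n ^ j ∧ s.reg 7 = D + 2 ∧ s.reg 8 = 2 ∧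
    s.mem = (fun _ => 0) ∧ s.out = [] ∧ s.reg 21 = D - j)
    2 D (fun j s h => h.2.2.2.2.2.2.2.2.2) ?_ ?_ ?_
  · rintro j hj s c ⟨h0, h1, h2, h3, h5, h7, h8', hm, ho, h21⟩
    simp [wp_seq, wp_mul, wp_sub, h0, h1, h2, h3, h5, h7, h8', hm, ho, h21]
    have h1 : n ^ j * n ≤ (n + 2) ^ (j + 1) := by
      rw [← pow_succ]
      exact Nat.pow_le_pow_left (by omega) _
    have h2 : (n + 2) ^ (j + 1) < W := by
      rw [← hW]
      exact Nat.pow_lt_pow_right (by omega) (by omega)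
    exact ⟨by omega, by omega, (pow_succ _ _).symm, by omega⟩
  · simp [h0, h1, h2, h3, h5, h7, h8', hm, ho, blockSize]
  rintro s₂ c₂ ⟨h0, h1, h2, h3, h5, h7, h8', hm, ho, -⟩ hc₂
  have hm1 := hF.lt₁
  have hmm : blockCount D n ≤ (D + 2) * blockCount D n := Nat.le_mul_of_pos_left _ (by omega)
  have hmm' : blockCount D n < W := by
    have : 2 * ((D + 2) * blockCount D n) < W := hm1
    omega
  have hY : n ^ (D + 1) < W := by
    rw [← hW]
    exact (Nat.pow_le_pow_left (by omega) _).trans_lt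
      (Nat.pow_lt_pow_right (show 1 < n + 2 by omega) (show D + 1 < 4 * D + 20 by omega))
  have hkd : blockSize n * (D + 2) < W := by
    rw [← hW]
    calc blockSize n * (D + 2) ≤ (n + 2) * 2 ^ (D + 2) :=
          Nat.mul_le_mul (blockSize_le n) Nat.lt_two_pow_self.le
      _ ≤ (n + 2) * (n + 2) ^ (D + 2) :=
          Nat.mul_le_mul_left _ (Nat.pow_le_pow_left (by omega) _)
      _ = (n + 2) ^ (D + 3) := (pow_succ' _ _).symm
      _ < _ := Nat.pow_lt_pow_right (by omega) (by omega)
  have hq : n / (blockSize n * (D + 2)) + 1 ≤ (n / (blockSize n * (D + 2)) + 1) * (D + 2) :=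
    Nat.le_mul_of_pos_right _ (by omega)
  have hbc : (n / (blockSize n * (D + 2)) + 1) * (D + 2) + 1 = blockCount D n := rfl
  simp [wp_div, h0, h1, h2, h5, h7, ← pow_succ, hbc]
  have hdl := Nat.div_le_self n (blockSize n * (D + 2))
  refine ⟨by omega, by omega, by omega, by omega, by omega, hmm', hQ _ _ ?_ (by simpa using hm)
    (by simpa using ho) ?_⟩
  · constructor <;> simp [params, h0, h1, h2, h3, h5, h7, h8']
  · simp at hc₁
    omega

theorem wp_partitionProgram (D n : ℕ) {inp : ℕ → ℕ} (hinp : ∀ a, inp a ≤ 1) :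
    ∃ s t, Exec inp ((n + 2) ^ (4 * D + 20)) (partitionProgram D) (start n) s t ∧
      s.out = (params D n inp).result ∧
      t ≤ 9 * n + 3 * D + 40 + (params D n inp).totalCost := by
  obtain ⟨hF, -⟩ := fits_params D n hinp
  have hX : n ^ D < (n + 2) ^ (4 * D + 20) :=
    (Nat.pow_le_pow_left (by omega) _).trans_lt
      (Nat.pow_lt_pow_right (show 1 < n + 2 by omega) (show D < 4 * D + 20 by omega))
  have h : WP inp ((n + 2) ^ (4 * D + 20)) (partitionProgram D) (start n) 0 fun s t =>
      s.out = (params D n inp).result ∧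
        t ≤ 9 * n + 3 * D + 40 + (params D n inp).totalCost := by
    rw [partitionProgram, wp_seq]
    refine wp_setup D n hinp fun s c hE hm ho hc => ?_
    refine wp_mainPass (P := params D n inp) hE hF hX (by simp [hm]) fun s' c' ho' hc' => ?_
    exact ⟨by rw [ho', ho, List.nil_append], by omega⟩
  obtain ⟨s, t, he, hs, ht⟩ := h
  exact ⟨s, t, he, hs, by omega⟩

end WordRAM

/-! ### Sorting by keys, and tuples with repeated entries. -/

/-- Tuples that are sorted by the same key and have the same entries are equal. -/
theorem eq_of_strictMono_comp {α β : Type*} [LinearOrder β] {d : ℕ} {f : α → β} {v w : Fin d → α}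
    (hv : StrictMono (f ∘ v)) (hw : StrictMono (f ∘ w)) (h : Set.range v = Set.range w) :
    v = w := by
  have h1 : f ∘ v = f ∘ w := by
    rw [← hv.range_inj hw, Set.range_comp, Set.range_comp, h]
  funext j
  obtain ⟨l, hl⟩ : v j ∈ Set.range w := h ▸ Set.mem_range_self j
  have h2 : (f ∘ w) l = (f ∘ w) j := by
    change f (w l) = _
    rw [hl, ← h1]
    rfl
  rw [← hl, hw.injective h2]

theorem exists_strictMono_comp {α β : Type*} [DecidableEq α] [LinearOrder β] {d : ℕ} {f : α → β}
    (hf : Function.Injective f) {e : Finset α} (he : e.card = d) :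
    ∃ v : Fin d → α, StrictMono (f ∘ v) ∧ Finset.univ.image v = e := by
  have hc : (e.image f).card = d := by rw [Finset.card_image_of_injective _ hf, he]
  have hmem : ∀ j, ∃ a ∈ e, f a = (e.image f).orderEmbOfFin hc j := fun j =>
    Finset.mem_image.1 (Finset.orderEmbOfFin_mem _ hc j)
  choose v hv hfv using hmem
  have hmono : StrictMono (f ∘ v) := fun a b hab => by
    simp only [Function.comp_apply, hfv]
    exact (Finset.orderEmbOfFin _ hc).strictMono hab
  refine ⟨v, hmono, Finset.eq_of_subset_of_card_le ?_ ?_⟩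
  · intro a ha
    obtain ⟨j, -, rfl⟩ := Finset.mem_image.1 ha
    exact hv j
  · rw [Finset.card_image_of_injective _ (Function.Injective.of_comp hmono.injective), he]
    simp

/-- At most a fraction `d ^ 2 / m` of all `d`-tuples from `m` elements have a repeated entry; the
inequality is multiplied by `m` to stay in `ℕ`. -/
theorem Nat.pow_le_descFactorial_add (m d : ℕ) :
    m * m ^ d ≤ m * m.descFactorial d + d ^ 2 * m ^ d := by
  induction d with
  | zero => simp
  | succ d ih =>
    rw [Nat.descFactorial_succ]
    have h1 : m.descFactorial d ≤ m ^ d := Nat.descFactorial_le_pow m d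
    have h2 : m ≤ m - d + d := by omega
    have h3 : m * m.descFactorial d ≤ (m - d) * m.descFactorial d + d * m ^ d := by
      calc m * m.descFactorial d ≤ (m - d + d) * m.descFactorial d := Nat.mul_le_mul_right _ h2
        _ = (m - d) * m.descFactorial d + d * m.descFactorial d := by ring
        _ ≤ _ := by gcongr
    have h4 : m * m ^ d ≤ (m - d) * m.descFactorial d + (d + 1) ^ 2 * m ^ d := by
      nlinarith [Nat.zero_le (d * m ^ d), Nat.zero_le (m ^ d)]
    calc m * m ^ (d + 1) = m * (m * m ^ d) := by ring
      _ ≤ m * ((m - d) * m.descFactorial d + (d + 1) ^ 2 * m ^ d) := Nat.mul_le_mul_left _ h4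
      _ = _ := by ring

/-! ### A shift-invariant way of sorting tuples of residues. -/

namespace SortedTuples

variable {d m : ℕ}

/-- The position of `x` relative to the sum of a tuple. -/
def rank (w : Fin d → ZMod m) (x : ZMod m) : ℕ := ((d : ZMod m) * x - ∑ j, w j).val

/-- A shift by `c` adds `d c` both to `d x` and to the sum of the `d` entries. This symmetry makes
all residues equally frequent in every position of the sorted tuples. -/
theorem rank_shift (w : Fin d → ZMod m) (x c : ZMod m) :
    rank (fun j => w j + c) (x + c) = rank w x := by
  unfold rank
  rw [Finset.sum_add_distrib]
  simp only [Finset.sum_const, Finset.card_univ, Fintype.card_fin, nsmul_eq_mul]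
  congr 1
  ring

variable [NeZero m]

/-- Coprimality makes multiplication by `d` invertible modulo `m`. -/
theorem rank_injective (h : d.Coprime m) (w : Fin d → ZMod m) : Function.Injective (rank w) := by
  intro x y hxy
  have h1 := ZMod.val_injective m hxy
  have h2 : (d : ZMod m) * x = (d : ZMod m) * y := by simpa using h1
  exact ((ZMod.isUnit_iff_coprime d m).2 h).mul_left_cancel h2

/-- The tuples with weakly increasing ranks. -/
def Sorted (w : Fin d → ZMod m) : Prop := Monotone fun j => rank w (w j)

open Classical in
/-- The number of sorted tuples whose `p`-th entry is `x`. -/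
theorem card_sorted_le (h : d.Coprime m) (p : Fin d) (x : ZMod m) :
    m * (Finset.univ.filter fun w : Fin d → ZMod m => Sorted w ∧ w p = x).card ≤
      m.choose d + (m ^ d - m.descFactorial d) := by
  -- Shifting by `y - x` shows that no residue is more frequent at position `p` than another, so `m`
  -- times one count is at most the number of all sorted tuples.
  have hshift : ∀ y, (Finset.univ.filter fun w : Fin d → ZMod m => Sorted w ∧ w p = x).card ≤
      (Finset.univ.filter fun w : Fin d → ZMod m => Sorted w ∧ w p = y).card := by
    intro y
    refine Finset.card_le_card_of_injOn (fun w j => w j + (y - x)) ?_ ?_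
    · intro w hw
      obtain ⟨h1, h2⟩ := (Finset.mem_filter.1 hw).2
      refine Finset.mem_coe.2 (Finset.mem_filter.2 ⟨Finset.mem_univ _, ?_, by simp [h2]⟩)
      unfold Sorted
      simp only [rank_shift]
      exact h1
    · intro w _ w' _ hww
      funext j
      simpa using congrFun hww j
  have hsum : m * (Finset.univ.filter fun w : Fin d → ZMod m => Sorted w ∧ w p = x).card ≤
      (Finset.univ.filter fun w : Fin d → ZMod m => Sorted w).card := by
    rw [Finset.card_eq_sum_card_fiberwise
      (s := Finset.univ.filter fun w : Fin d → ZMod m => Sorted w) (f := fun w => w p) (t := Finset.univ)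
      fun _ _ => Finset.mem_coe.2 (Finset.mem_univ _)]
    calc m * (Finset.univ.filter fun w : Fin d → ZMod m => Sorted w ∧ w p = x).card
        = ∑ _y : ZMod m,
          (Finset.univ.filter fun w : Fin d → ZMod m => Sorted w ∧ w p = x).card := by simp
      _ ≤ _ := Finset.sum_le_sum fun y _ => by
        rw [Finset.filter_filter]
        exact hshift y
  refine hsum.trans ?_
  have hsplit : (Finset.univ.filter fun w : Fin d → ZMod m => Sorted w) ⊆
      (Finset.univ.filter fun w : Fin d → ZMod m => StrictMono (rank w ∘ w)) ∪
        Finset.univ.filter fun w : Fin d → ZMod m => ¬ Function.Injective w := by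
    intro w hw
    have hs : Sorted w := (Finset.mem_filter.1 hw).2
    by_cases hi : Function.Injective w
    · refine Finset.mem_union_left _ (Finset.mem_filter.2 ⟨Finset.mem_univ _, ?_⟩)
      exact hs.strictMono_of_injective ((rank_injective h w).comp hi)
    · exact Finset.mem_union_right _ (Finset.mem_filter.2 ⟨Finset.mem_univ _, hi⟩)
  refine (Finset.card_le_card hsplit).trans ((Finset.card_union_le _ _).trans
    (Nat.add_le_add ?_ ?_))
  · have : ((Finset.univ : Finset (ZMod m)).powersetCard d).card = m.choose d := by simp
    rw [← this]
    have hinj : ∀ w : Fin d → ZMod m, StrictMono (rank w ∘ w) → Function.Injective w :=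
      fun w hw => Function.Injective.of_comp hw.injective
    refine Finset.card_le_card_of_injOn (fun w => Finset.univ.image w) ?_ ?_
    · intro w hw
      refine Finset.mem_coe.2 (Finset.mem_powersetCard.2 ⟨Finset.subset_univ _, ?_⟩)
      rw [Finset.card_image_of_injective _ (hinj w (Finset.mem_filter.1 hw).2)]
      simp
    · intro w hw w' hw' hww
      have h1 := (Finset.mem_filter.1 hw).2
      have h2 := (Finset.mem_filter.1 hw').2
      have hww' : Finset.univ.image w = Finset.univ.image w' := hww
      -- The set of entries of an injective tuple determines their sum, hence the rank function,
      -- hence the sorted order.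
      have hsum : ∑ j, w j = ∑ j, w' j := by
        have e1 := Finset.sum_image (s := Finset.univ) (g := w) (f := fun x => x)
          fun _ _ _ _ h => hinj w h1 h
        have e2 := Finset.sum_image (s := Finset.univ) (g := w') (f := fun x => x)
          fun _ _ _ _ h => hinj w' h2 h
        rw [← e1, ← e2, hww']
      have hr : rank w = rank w' := by
        funext y
        simp [rank, hsum]
      rw [← hr] at h2
      refine eq_of_strictMono_comp h1 h2 ?_
      simpa using congrArg (fun s : Finset (ZMod m) => (s : Set (ZMod m))) hww'
  · rw [Finset.filter_not, Finset.card_sdiff_of_subset (Finset.filter_subset _ _)]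
    have hi : (Finset.univ.filter fun w : Fin d → ZMod m => Function.Injective w).card =
        m.descFactorial d := by
      have e := Fintype.card_embedding_eq (α := Fin d) (β := ZMod m)
      rw [ZMod.card, Fintype.card_fin] at e
      rw [← e, ← Fintype.card_subtype]
      exact Fintype.card_congr (Equiv.subtypeInjectiveEquivEmbedding (Fin d) (ZMod m))
    rw [hi]
    simp

-- The main term is `m.choose d / m`, at most `m ^ (D + 1) / d!`. Tuples with repeated entries
-- contribute at most `d ^ 2 * m ^ D`.
open Classical in
theorem factorial_mul_card_sorted_le {D : ℕ} (h : (D + 2).Coprime m) (p : Fin (D + 2))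
    (x : ZMod m) :
    (D + 2).factorial * (Finset.univ.filter
      fun w : Fin (D + 2) → ZMod m => Sorted w ∧ w p = x).card ≤
      m ^ (D + 1) + (D + 2).factorial * (D + 2) ^ 2 * m ^ D := by
  have hm : 0 < m := NeZero.pos m
  have h1 := card_sorted_le h p x
  generalize (Finset.univ.filter
      fun w : Fin (D + 2) → ZMod m => Sorted w ∧ w p = x).card = c at h1 ⊢
  have h2 := Nat.pow_le_descFactorial_add m (D + 2)
  have h3 : m.descFactorial (D + 2) ≤ m ^ (D + 2) := Nat.descFactorial_le_pow m _
  have h4 := Nat.descFactorial_eq_factorial_mul_choose m (D + 2)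
  have h5 : m ^ (D + 2) ≤ m.descFactorial (D + 2) + (D + 2) ^ 2 * m ^ (D + 1) := by
    refine Nat.le_of_mul_le_mul_left ?_ hm
    calc _ ≤ _ := h2
      _ = _ := by ring
  have h6 : m ^ (D + 2) - m.descFactorial (D + 2) ≤ (D + 2) ^ 2 * m ^ (D + 1) := by omega
  refine Nat.le_of_mul_le_mul_left ?_ hm
  calc m * ((D + 2).factorial * c) = (D + 2).factorial * (m * c) := by ring
    _ ≤ (D + 2).factorial * (m.choose (D + 2) + (D + 2) ^ 2 * m ^ (D + 1)) :=
        Nat.mul_le_mul_left _ (h1.trans (Nat.add_le_add_left h6 _))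
    _ = m.descFactorial (D + 2) + (D + 2).factorial * ((D + 2) ^ 2 * m ^ (D + 1)) := by
        rw [h4, mul_add]
    _ ≤ m ^ (D + 2) + (D + 2).factorial * ((D + 2) ^ 2 * m ^ (D + 1)) :=
        Nat.add_le_add_right h3 _
    _ = _ := by ring

end SortedTuples

namespace WordRAM

/-! ### Digits -/

theorem sum_mul_pow_lt {n : ℕ} {w : ℕ → ℕ} {l : ℕ} (hw : ∀ j < l, w j < n) :
    ∑ j ∈ Finset.range l, w j * n ^ j < n ^ l := by
  induction l with
  | zero => simp
  | succ l ih =>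
    have h1 := ih fun j hj => hw j (by omega)
    have h2 := Nat.mul_le_mul_right (n ^ l) (hw l (by omega))
    rw [Finset.sum_range_succ, pow_succ']
    rw [Nat.succ_mul] at h2
    omega

theorem sum_mul_pow_div_mod {n : ℕ} {w : ℕ → ℕ} {l : ℕ} (hw : ∀ j < l, w j < n) {j : ℕ}
    (hj : j < l) : (∑ j ∈ Finset.range l, w j * n ^ j) / n ^ j % n = w j := by
  have hn : 0 < n := (Nat.zero_le _).trans_lt (hw j hj)
  induction l with
  | zero => omega
  | succ l ih =>
    rw [Finset.sum_range_succ]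
    have h1 := sum_mul_pow_lt (l := l) fun j hj => hw j (by omega)
    rcases Nat.lt_succ_iff_lt_or_eq.1 hj with h | rfl
    · have h3 : w l * n ^ l = n ^ j * (n * (w l * n ^ (l - j - 1))) := by
        have : n ^ l = n ^ j * (n * n ^ (l - j - 1)) := by
          rw [← pow_succ', ← pow_add]
          congr 1
          omega
        rw [this]
        ring
      rw [h3, Nat.add_mul_div_left _ _ (by positivity), Nat.add_mul_mod_self_left]
      exact ih (fun j hj => hw j (by omega)) h
    · rw [Nat.add_mul_div_right _ _ (by positivity), Nat.div_eq_of_lt h1, zero_add,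
        Nat.mod_eq_of_lt (hw j hj)]

theorem sum_digit_mul_pow (n u l : ℕ) (hu : u < n ^ l) :
    ∑ j ∈ Finset.range l, u / n ^ j % n * n ^ j = u := by
  have h : ∀ l, ∑ j ∈ Finset.range l, u / n ^ j % n * n ^ j = u % n ^ l := by
    intro l
    induction l with
    | zero => simp [Nat.mod_one]
    | succ l ih =>
      rw [Finset.sum_range_succ, ih, pow_succ, Nat.mod_mul, mul_comm (n ^ l)]
  rw [h, Nat.mod_eq_of_lt hu]

theorem eq_of_add_mul_eq {N x y a b : ℕ} (hx : x < N) (hy : y < N)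
    (h : x + a * N = y + b * N) : x = y ∧ a = b := by
  have h1 : (x + a * N) % N = (y + b * N) % N := by rw [h]
  rw [Nat.add_mul_mod_self_right, Nat.add_mul_mod_self_right, Nat.mod_eq_of_lt hx,
    Nat.mod_eq_of_lt hy] at h1
  subst h1
  exact ⟨rfl, Nat.eq_of_mul_eq_mul_right (by omega : 0 < N) (by omega)⟩

/-! ### Binary digits -/

theorem horner_div_mod {f : ℕ → ℕ} (hf : ∀ j, f j ≤ 1) (b l : ℕ) {j : ℕ} (hj : j < l) :
    horner f b l / 2 ^ j % 2 = f (b + j) := by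
  induction l generalizing b j with
  | zero => omega
  | succ l ih =>
    have h1 := hf b
    rw [horner]
    rcases j with _ | j
    · rw [pow_zero, Nat.div_one, add_zero]
      omega
    · rw [pow_succ', ← Nat.div_div_eq_div_mul,
        show (2 * horner f (b + 1) l + f b) / 2 = horner f (b + 1) l by omega,
        ih (b + 1) (by omega)]
      congr 1
      omega

theorem exists_ne_zero_of_horner_ne_zero {f : ℕ → ℕ} {b l : ℕ} (h : horner f b l ≠ 0) :
    ∃ j < l, f (b + j) ≠ 0 := by
  induction l generalizing b with
  | zero => exact absurd rfl h
  | succ l ih =>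
    by_cases h0 : f b = 0
    · rw [horner, h0] at h
      obtain ⟨j, hj, hne⟩ := ih (b := b + 1) (by omega)
      exact ⟨j + 1, by omega, by rwa [show b + (j + 1) = b + 1 + j by omega]⟩
    · exact ⟨0, by omega, h0⟩

section

variable {D n : ℕ}

/-- The entries of a tuple of vertices as numbers. -/
def entry (v : Fin (D + 2) → Fin n) (j : ℕ) : ℕ := if h : j < D + 2 then v ⟨j, h⟩ else 0

theorem entry_val (v : Fin (D + 2) → Fin n) (j : Fin (D + 2)) : entry v j = v j := by
  simp [entry]

theorem entry_lt (v : Fin (D + 2) → Fin n) {j : ℕ} (hj : j < D + 2) : entry v j < n := by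
  simp [entry, hj]

/-- The number with the first `l` entries of a tuple as its digits. -/
def address (v : Fin (D + 2) → Fin n) (l : ℕ) : ℕ := ∑ j ∈ Finset.range l, entry v j * n ^ j

theorem address_lt (v : Fin (D + 2) → Fin n) {l : ℕ} (hl : l ≤ D + 2) : address v l < n ^ l :=
  sum_mul_pow_lt fun _ hj => entry_lt v (by omega)

theorem address_succ (v : Fin (D + 2) → Fin n) (l : ℕ) :
    address v (l + 1) = address v l + entry v l * n ^ l := Finset.sum_range_succ _ _

theorem address_div_mod (v : Fin (D + 2) → Fin n) {l j : ℕ} (hl : l ≤ D + 2) (hj : j < l) :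
    address v l / n ^ j % n = entry v j :=
  sum_mul_pow_div_mod (fun _ hj => entry_lt v (by omega)) hj

theorem address_injective {v w : Fin (D + 2) → Fin n}
    (h : address v (D + 2) = address w (D + 2)) : v = w := by
  funext j
  apply Fin.ext
  rw [← entry_val, ← entry_val, ← address_div_mod v le_rfl j.2, h, address_div_mod w le_rfl j.2]

theorem adjacencyArray_address (H : UniformHypergraph (D + 2) (Fin n))
    (v : Fin (D + 2) → Fin n) :
    adjacencyArray H (address v (D + 2)) = 1 ↔ Finset.univ.image v ∈ H.edges := by
  have haddr : ∀ w : Fin (D + 2) → Fin n,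
      ∑ i, (w i : ℕ) * n ^ (i : ℕ) = address w (D + 2) := by
    intro w
    rw [address, ← Fin.sum_univ_eq_sum_range fun j => entry w j * n ^ j]
    simp only [entry_val]
  unfold adjacencyArray
  simp only [haddr]
  constructor
  · intro h
    split_ifs at h with h'
    obtain ⟨w, hw, he⟩ := h'
    rw [address_injective hw]
    convert he
  · intro h
    rw [if_pos ⟨v, rfl, by convert h⟩]

/-- The blocks may reach beyond the last vertex. Reading there yields zero, because such an address
belongs to no tuple, so no spurious vertex gets into a clique. -/
theorem exists_address_of_adjacencyArray_ne_zero {H : UniformHypergraph (D + 2) (Fin n)} {a : ℕ}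
    (h : adjacencyArray H a ≠ 0) : ∃ v : Fin (D + 2) → Fin n, a = address v (D + 2) := by
  unfold adjacencyArray at h
  split_ifs at h with h'
  · obtain ⟨w, hw, -⟩ := h'
    refine ⟨w, hw.trans ?_⟩
    rw [address, ← Fin.sum_univ_eq_sum_range fun j => entry w j * n ^ j]
    simp only [entry_val]
  · exact absurd rfl h

theorem adjacencyArray_le_one (H : UniformHypergraph (D + 2) (Fin n)) (a : ℕ) :
    adjacencyArray H a ≤ 1 := by
  unfold adjacencyArray
  split_ifs <;> omega

end

end WordRAM

/-! ### Edges as canonical tuples, and the clique of each tuple. -/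

namespace WordRAM.Params

variable {P : Params}

/-- The sum of the blocks of the entries of a tuple. -/
def tupleSum (P : Params) (v : Fin (P.D + 2) → Fin P.n) : ℕ := ∑ j, (v j : ℕ) / P.k

/-- The key of a vertex with respect to a sum of blocks. -/
def vertexKey (P : Params) (σ : ℕ) (a : Fin P.n) : ℕ := P.rank σ (a / P.k) * P.n + a

/-- The entries of the tuple are sorted by their keys. -/
def Canonical (P : Params) (v : Fin (P.D + 2) → Fin P.n) : Prop :=
  StrictMono (P.vertexKey (P.tupleSum v) ∘ v)

/-- The parts of a clique. -/
def part (P : Params) (t i S : ℕ) (p : Fin (P.D + 2)) : Finset (Fin P.n) :=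
  Finset.univ.filter fun a => if (p : ℕ) < P.D then (a : ℕ) = P.digit t p else
    if (p : ℕ) = P.D then (a : ℕ) ∈ P.bucket t i S else (a : ℕ) ∈ P.members i S

theorem vertexKey_injective (σ : ℕ) : Function.Injective (P.vertexKey σ) := by
  intro a b h
  have h' : (a : ℕ) + P.rank σ (a / P.k) * P.n = b + P.rank σ (b / P.k) * P.n := by
    simpa [vertexKey, add_comm] using h
  exact Fin.ext (eq_of_add_mul_eq a.2 b.2 h').1

theorem tupleSum_eq_of_image {v : Fin (P.D + 2) → Fin P.n} (hv : Function.Injective v)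
    {e : Finset (Fin P.n)} (he : Finset.univ.image v = e) :
    P.tupleSum v = ∑ a ∈ e, (a : ℕ) / P.k := by
  rw [← he, Finset.sum_image fun _ _ _ _ h => hv h, tupleSum]

/-- The sum of the blocks depends only on the edge, so all its orderings are compared by the same
injective key. Coprimality of `m` and `d` is not needed here, as ties between ranks are broken by
the vertex; it matters only for the loads. -/
theorem existsUnique_canonical {e : Finset (Fin P.n)} (he : e.card = P.D + 2) :
    ∃! v, P.Canonical v ∧ Finset.univ.image v = e := by
  obtain ⟨v, hv, hve⟩ := exists_strictMono_comp (f := P.vertexKey (∑ a ∈ e, (a : ℕ) / P.k))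
    (vertexKey_injective _) he
  have hvs := tupleSum_eq_of_image (Function.Injective.of_comp hv.injective) hve
  refine ⟨v, ⟨?_, hve⟩, ?_⟩
  · rw [Canonical, hvs]
    exact hv
  · rintro w ⟨hw, hwe⟩
    rw [Canonical, tupleSum_eq_of_image (Function.Injective.of_comp hw.injective) hwe] at hw
    refine eq_of_strictMono_comp hw hv ?_
    simpa using congrArg (fun s : Finset (Fin P.n) => (s : Set (Fin P.n))) (hwe.trans hve.symm)

theorem digit_address (v : Fin (P.D + 2) → Fin P.n) {l j : ℕ} (hl : l ≤ P.D + 2) (hj : j < l) :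
    P.digit (address v l) j = entry v j := address_div_mod v hl hj

theorem blockSum_address (v : Fin (P.D + 2) → Fin P.n) :
    P.blockSum (address v (P.D + 1)) (entry v (P.D + 1) / P.k) = P.tupleSum v := by
  unfold tupleSum blockSum
  simp only [← entry_val]
  rw [Fin.sum_univ_eq_sum_range (fun j => (entry v j / P.k : ℕ)) (P.D + 2),
    Finset.sum_range_succ (fun j => (entry v j / P.k : ℕ))]
  refine congrArg (fun x : ℕ => x + entry v (P.D + 1) / P.k)
    (Finset.sum_congr rfl fun j hj => ?_)
  rw [digit_address v (by omega) (Finset.mem_range.1 hj)]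

theorem key_address (v : Fin (P.D + 2) → Fin P.n) {j : ℕ} (hj : j < P.D + 1) :
    P.key (address v (P.D + 1)) (entry v (P.D + 1) / P.k) j =
      P.vertexKey (P.tupleSum v) (v ⟨j, by omega⟩) := by
  rw [key, blockSum_address, digit_address v (by omega) hj, vertexKey, ← entry_val]

theorem top_address (v : Fin (P.D + 2) → Fin P.n) :
    P.top (address v (P.D + 1)) (entry v (P.D + 1) / P.k) + entry v (P.D + 1) =
      P.vertexKey (P.tupleSum v) (v (Fin.last _)) := by
  have h : entry v (P.D + 1) = v (Fin.last _) := entry_val v (Fin.last _)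
  rw [top, blockSum_address, h, vertexKey]

/-- The block of the last vertex already determines `σ` and all ranks. So most of the test can be
made once per block, and only the last comparison involves the last vertex itself. -/
theorem canonical_iff (v : Fin (P.D + 2) → Fin P.n) :
    P.Canonical v ↔ P.Accepts (address v (P.D + 1)) (entry v (P.D + 1) / P.k) ∧
      P.key (address v (P.D + 1)) (entry v (P.D + 1) / P.k) P.D <
        P.top (address v (P.D + 1)) (entry v (P.D + 1) / P.k) + entry v (P.D + 1) := by
  have hlt := entry_lt v (show P.D + 1 < P.D + 2 by omega)
  rw [Canonical, Fin.strictMono_iff_lt_succ, Accepts, top_address, key_address v (by omega)]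
  constructor
  · intro h
    have h1 := h (Fin.last _)
    refine ⟨⟨fun j hj => ?_, ?_⟩, h1⟩
    · rw [key_address v (by omega), key_address v (by omega)]
      exact h ⟨j, by omega⟩
    · refine lt_trans h1 ?_
      have h2 := top_address v
      rw [Fin.succ_last, Function.comp_apply, ← h2]
      omega
  · rintro ⟨⟨h1, -⟩, h2⟩ ⟨j, hj⟩
    rcases Nat.lt_succ_iff_lt_or_eq.1 hj with h | rfl
    · have h3 := h1 j h
      rw [key_address v (by omega), key_address v (by omega)] at h3
      exact h3
    · exact h2

theorem mem_bucket {t i S b : ℕ} : b ∈ P.bucket t i S ↔ S ≠ 0 ∧ b < P.n ∧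
    P.Accepts (t + b * P.n ^ P.D) i ∧ P.code (t + b * P.n ^ P.D) i = S := by
  unfold bucket
  split_ifs with h
  · simp [h]
  · simp [h]

theorem mem_members {i S a : ℕ} : a ∈ P.members i S ↔
    ∃ c < P.k, S / 2 ^ c % 2 = 1 ∧ i * P.k + c = a := by
  simp [members, and_assoc]

section

variable {H : UniformHypergraph (P.D + 2) (Fin P.n)} (hP : P.inp = adjacencyArray H)
  (hk : 0 < P.k)

include hP

theorem bit_le_one (u i c : ℕ) : P.bit u i c ≤ 1 := by
  unfold bit
  split_ifs
  · rw [hP]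
    exact adjacencyArray_le_one H _
  · omega

theorem code_lt (u i : ℕ) : P.code u i < 2 ^ P.k := horner_lt (bit_le_one hP u i) _ _

theorem code_div_mod (u i : ℕ) {c : ℕ} (hc : c < P.k) :
    P.code u i / 2 ^ c % 2 = P.bit u i c := by
  rw [code, horner_div_mod (bit_le_one hP u i) _ _ hc, zero_add]

theorem bit_address_eq_one (v : Fin (P.D + 2) → Fin P.n) {c : ℕ}
    (hc : entry v (P.D + 1) / P.k * P.k + c = entry v (P.D + 1)) :
    P.bit (address v (P.D + 1)) (entry v (P.D + 1) / P.k) c = 1 ↔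
      P.key (address v (P.D + 1)) (entry v (P.D + 1) / P.k) P.D <
        P.top (address v (P.D + 1)) (entry v (P.D + 1) / P.k) + entry v (P.D + 1) ∧
      Finset.univ.image v ∈ H.edges := by
  rw [bit, hc, ← address_succ, hP]
  split_ifs with h
  · rw [adjacencyArray_address]
    simp [h]
  · simp [h]

include hk

/-- The edges of a clique as sorted tuples. -/
theorem mem_piFinset_part {t i S : ℕ} (ht : t < P.n ^ P.D) (v : Fin (P.D + 2) → Fin P.n) :
    v ∈ Fintype.piFinset (P.part t i S) ↔
      (address v P.D = t ∧ entry v (P.D + 1) / P.k = i ∧ P.code (address v (P.D + 1)) i = S) ∧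
        P.Canonical v ∧ Finset.univ.image v ∈ H.edges := by
  have hparts : v ∈ Fintype.piFinset (P.part t i S) ↔
      (∀ j < P.D, entry v j = P.digit t j) ∧ entry v P.D ∈ P.bucket t i S ∧
        entry v (P.D + 1) ∈ P.members i S := by
    rw [Fintype.mem_piFinset]
    simp only [part, Finset.mem_filter, Finset.mem_univ, true_and, ← entry_val]
    constructor
    · intro h
      refine ⟨fun j hj => ?_, ?_, ?_⟩
      · have := h ⟨j, by omega⟩
        rwa [if_pos hj] at this
      · have := h ⟨P.D, by omega⟩
        rwa [if_neg (by simp), if_pos rfl] at this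
      · have := h ⟨P.D + 1, by omega⟩
        rwa [if_neg (by simp), if_neg (by simp)] at this
    · rintro ⟨h1, h2, h3⟩ ⟨j, hj⟩
      split_ifs with h h'
      · exact h1 j h
      · simp only at h'
        subst h'
        exact h2
      · simp only at h h'
        have : j = P.D + 1 := by omega
        subst this
        exact h3
  have haddr : (∀ j < P.D, entry v j = P.digit t j) ↔ address v P.D = t := by
    constructor
    · intro h
      rw [← sum_digit_mul_pow P.n t P.D ht]
      refine Finset.sum_congr rfl fun j hj => ?_
      rw [h j (Finset.mem_range.1 hj), digit]
    · rintro rfl j hj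
      rw [digit_address v (by omega) hj]
  rw [hparts, haddr, mem_bucket, mem_members, canonical_iff]
  constructor
  · rintro ⟨rfl, ⟨hS, hb, hacc, hcode⟩, c, hc, hbit, ha⟩
    rw [← address_succ] at hacc hcode
    have hi : entry v (P.D + 1) / P.k = i := by
      rw [← ha, mul_comm, Nat.mul_add_div hk, Nat.div_eq_of_lt hc, add_zero]
    subst hi
    rw [← hcode, code_div_mod hP _ _ hc, bit_address_eq_one hP v ha] at hbit
    exact ⟨⟨rfl, rfl, hcode⟩, ⟨hacc, hbit.1⟩, hbit.2⟩
  · rintro ⟨⟨rfl, rfl, hS⟩, ⟨hacc, hlt⟩, he⟩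
    have hc : entry v (P.D + 1) % P.k < P.k := Nat.mod_lt _ hk
    have ha : entry v (P.D + 1) / P.k * P.k + entry v (P.D + 1) % P.k = entry v (P.D + 1) := by
      rw [mul_comm, Nat.div_add_mod]
    have hbit := (bit_address_eq_one hP v ha).2 ⟨hlt, he⟩
    rw [← code_div_mod hP _ _ hc, hS] at hbit
    rw [← address_succ]
    refine ⟨rfl, ⟨?_, entry_lt v (by omega), hacc, hS⟩, _, hc, hbit, ha⟩
    -- The bit of the last entry of `v` is set in `S`, so `S` is not zero.
    rintro rfl
    simp at hbit

/-- A nonempty bucket has a nonzero code, and a set bit of the code gives an edge. So every clique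
that is written out has an edge, and its parts are not empty. -/
theorem exists_mem_piFinset_part {t i S : ℕ} (ht : t < P.n ^ P.D) (hne : P.bucket t i S ≠ []) :
    ∃ v, v ∈ Fintype.piFinset (P.part t i S) := by
  obtain ⟨b, hb⟩ := List.exists_mem_of_ne_nil _ hne
  obtain ⟨hS, hbn, hacc, hcode⟩ := mem_bucket.1 hb
  obtain ⟨c, hc, hbit⟩ := exists_ne_zero_of_horner_ne_zero (f := P.bit (t + b * P.n ^ P.D) i)
    (b := 0) (l := P.k) (by rw [← code, hcode]; exact hS)
  rw [zero_add] at hbit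
  have hbit' := hbit
  rw [bit] at hbit'
  split_ifs at hbit' with hlt
  · rw [hP] at hbit'
    obtain ⟨v, hv⟩ := exists_address_of_adjacencyArray_ne_zero hbit'
    have hbX : t + b * P.n ^ P.D < P.n ^ (P.D + 1) := by
      have := Nat.mul_le_mul_right (P.n ^ P.D) hbn
      rw [Nat.succ_mul] at this
      rw [pow_succ']
      omega
    rw [address_succ] at hv
    obtain ⟨hu, ha⟩ := eq_of_add_mul_eq hbX (address_lt v (by omega)) hv
    rw [address_succ] at hu
    obtain ⟨ht', hb'⟩ := eq_of_add_mul_eq ht (address_lt v (by omega)) hu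
    have hi : entry v (P.D + 1) / P.k = i := by
      rw [← ha, mul_comm, Nat.mul_add_div hk, Nat.div_eq_of_lt hc, add_zero]
    have hbit1 : P.bit (t + b * P.n ^ P.D) i c = 1 := by
      have := bit_le_one hP (t + b * P.n ^ P.D) i c
      omega
    rw [ht', hb', ← address_succ, ← hi] at hbit1 hacc hcode
    have h1 := (bit_address_eq_one hP v (by rw [hi, ha])).1 hbit1
    refine ⟨v, (mem_piFinset_part hP hk ht v).2 ⟨⟨ht'.symm, hi, by rw [← hi, hcode]⟩,
      (canonical_iff v).2 ⟨hacc, h1.1⟩, h1.2⟩⟩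
  · exact absurd rfl hbit'

end

end WordRAM.Params

/-! ### The output describes a partition. -/

namespace WordRAM

theorem describes_of_lists {d n : ℕ} {K : DClique d (Fin n)} (l : Fin d → List ℕ)
    (hn : ∀ p, (l p).Nodup) (hlt : ∀ p, ∀ a ∈ l p, a < n)
    (hK : ∀ p (a : Fin n), a ∈ K.parts p ↔ (a : ℕ) ∈ l p) :
    Describes ((List.ofFn l).flatMap fun l => l.length :: l) K := by
  have hex : ∀ p, ∃ q : List (Fin n), q.map Fin.val = l p := by
    intro p
    refine ⟨(l p).attach.map fun a => ⟨a.1, hlt p a.1 a.2⟩, ?_⟩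
    rw [List.map_map]
    exact List.attach_map_subtype_val (l p)
  choose q hq using hex
  refine ⟨q, fun p => ⟨?_, ?_⟩, ?_⟩
  · refine List.Nodup.of_map Fin.val ?_
    rw [hq]
    exact hn p
  · ext a
    rw [List.mem_toFinset, hK, ← hq, List.mem_map_of_injective Fin.val_injective]
  · have : l = fun p => (q p).map Fin.val := funext fun p => (hq p).symm
    rw [this, List.ofFn_eq_map, List.ofFn_eq_map, List.flatMap_map, List.flatMap_map]
    simp

namespace Params

variable {P : Params}

theorem members_nodup (i S : ℕ) : (P.members i S).Nodup :=
  ((List.nodup_range).filter _).map fun a b h => by simpa using h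

theorem bucket_nodup (t i S : ℕ) : (P.bucket t i S).Nodup := by
  unfold bucket
  split_ifs
  · exact List.nodup_nil
  · exact List.nodup_range.filter _

/-- The lists of the vertices in the parts of a clique. -/
def partList (P : Params) (t i S p : ℕ) : List ℕ :=
  if p < P.D then [P.digit t p] else if p = P.D then P.bucket t i S else P.members i S

theorem word_eq (t i S : ℕ) :
    P.word t i S = (List.ofFn fun p : Fin (P.D + 2) => P.partList t i S p).flatMap
      fun l => l.length :: l := by
  rw [List.ofFn_eq_map, List.flatMap_map]
  have h : ((List.finRange (P.D + 2)).flatMap fun a : Fin (P.D + 2) => (P.partList t i S a).length ::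
      P.partList t i S a) = (List.range (P.D + 2)).flatMap fun a => (P.partList t i S a).length ::
      P.partList t i S a := by
    rw [← List.map_coe_finRange_eq_range, List.flatMap_map]
  rw [h, List.range_succ, List.range_succ, List.flatMap_append, List.flatMap_append]
  have h2 : ((List.range P.D).flatMap fun a => (P.partList t i S a).length ::
      P.partList t i S a) = (List.range P.D).flatMap fun j => [1, P.digit t j] := by
    refine List.flatMap_congr fun j hj => ?_
    simp [partList, List.mem_range.1 hj]
  rw [h2]
  simp [word, partList]

/-- The indices of the cliques that are written out. -/
def indices (P : Params) : List (ℕ × ℕ × ℕ) :=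
  (List.product (List.range (P.n ^ P.D)).reverse
    (List.product (List.range P.m).reverse (List.range (2 ^ P.k)).reverse)).filter
      fun x => P.bucket x.1 x.2.1 x.2.2 ≠ []

theorem mem_indices {x : ℕ × ℕ × ℕ} : x ∈ P.indices ↔ (x.1 < P.n ^ P.D ∧ x.2.1 < P.m ∧
    x.2.2 < 2 ^ P.k) ∧ P.bucket x.1 x.2.1 x.2.2 ≠ [] := by
  obtain ⟨t, i, S⟩ := x
  simp [indices]

theorem indices_nodup : P.indices.Nodup :=
  (List.Nodup.product (List.nodup_reverse.2 List.nodup_range)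
    (List.Nodup.product (List.nodup_reverse.2 List.nodup_range)
      (List.nodup_reverse.2 List.nodup_range))).filter _

theorem indices_length_le : P.indices.length ≤ P.n ^ P.D * (P.m * 2 ^ P.k) := by
  unfold indices
  refine (List.length_filter_le _ _).trans ?_
  change ((List.range (P.n ^ P.D)).reverse ×ˢ
    ((List.range P.m).reverse ×ˢ (List.range (2 ^ P.k)).reverse)).length ≤ _
  rw [List.length_product, List.length_product]
  simp

theorem flatMap_filter_eq {α : Type*} (l : List α) (p : α → Bool) (f : α → List ℕ) :
    (l.filter p).flatMap f = l.flatMap fun x => if p x then f x else [] := by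
  induction l with
  | nil => rfl
  | cons a l ih =>
    rw [List.filter_cons, List.flatMap_cons, ← ih]
    split_ifs with h <;> simp

theorem result_eq : P.result = P.indices.flatMap fun x => P.word x.1 x.2.1 x.2.2 := by
  rw [indices, flatMap_filter_eq]
  unfold result descFlat List.product
  simp only [List.flatMap_assoc, List.flatMap_map, Nat.sub_zero, ← List.range_eq_range']
  refine List.flatMap_congr fun t _ => List.flatMap_congr fun i _ =>
    List.flatMap_congr fun S _ => ?_
  by_cases h : P.bucket t i S = [] <;> simp [output, h]

section

variable {H : UniformHypergraph (P.D + 2) (Fin P.n)} (hP : P.inp = adjacencyArray H)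
  (hk : 0 < P.k)

include hP hk

theorem exists_clique {t i S : ℕ} (ht : t < P.n ^ P.D) (hne : P.bucket t i S ≠ []) :
    ∃ K : DClique (P.D + 2) (Fin P.n), K.parts = P.part t i S ∧ Describes (P.word t i S) K := by
  obtain ⟨v, hv⟩ := exists_mem_piFinset_part hP hk ht hne
  have hmem := Fintype.mem_piFinset.1 hv
  refine ⟨⟨P.part t i S, fun p => ⟨v p, hmem p⟩, fun p q hpq => ?_⟩, rfl, ?_⟩
  · rw [Finset.disjoint_left]
    intro a hap haq
    -- If `a` lay in the parts `p` and `q`, it could be put in both positions. The new tuple would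
    -- still be in the product of the parts, hence canonical and injective, so `p = q`.
    have h1 : Function.update (Function.update v p a) q a ∈
        Fintype.piFinset (P.part t i S) := by
      rw [Fintype.mem_piFinset]
      intro r
      by_cases hrq : r = q
      · subst hrq
        simpa using haq
      · by_cases hrp : r = p
        · subst hrp
          simpa [hrq] using hap
        · simpa [hrq, hrp] using hmem r
    have h2 := ((mem_piFinset_part hP hk ht _).1 h1).2.1
    have h3 := Function.Injective.of_comp h2.injective
    exact hpq (h3 (by simp [hpq]))
  · rw [word_eq]
    have hnpos : 0 < P.n := (Nat.zero_le _).trans_lt (v 0).2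
    refine describes_of_lists _ (fun p => ?_) (fun p a ha => ?_) (fun p a => ?_)
    · unfold partList
      split_ifs
      · exact List.nodup_singleton _
      · exact bucket_nodup _ _ _
      · exact members_nodup _ _
    · unfold partList at ha
      split_ifs at ha
      · rw [List.mem_singleton.1 ha]
        exact Nat.mod_lt _ hnpos
      · exact (mem_bucket.1 ha).2.1
      · obtain ⟨c, hc, hS, rfl⟩ := mem_members.1 ha
        -- That a member of `S` is a vertex below `n` follows from the array: its bit is set, so its
        -- input cell is nonzero and has the address of a tuple.
        obtain ⟨⟨rfl, rfl, hSv⟩, -⟩ := (mem_piFinset_part hP hk ht v).1 hv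
        rw [← hSv, code_div_mod hP _ _ hc, bit] at hS
        split_ifs at hS
        · rw [hP] at hS
          obtain ⟨w, hw⟩ := exists_address_of_adjacencyArray_ne_zero (by rw [hS]; omega)
          have hw' := hw.trans (address_succ w (P.D + 1))
          rw [(eq_of_add_mul_eq (address_lt v (by omega)) (address_lt w (by omega)) hw').2]
          exact entry_lt w (by omega)
    · simp only [part, partList, Finset.mem_filter, Finset.mem_univ, true_and]
      split_ifs <;> simp

theorem mem_edges_iff {K : DClique (P.D + 2) (Fin P.n)} {t i S : ℕ} (ht : t < P.n ^ P.D)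
    (hK : K.parts = P.part t i S) {e : Finset (Fin P.n)} : e ∈ K.edges ↔
      ∃ v, (address v P.D = t ∧ entry v (P.D + 1) / P.k = i ∧
        P.code (address v (P.D + 1)) i = S) ∧ P.Canonical v ∧ e ∈ H.edges ∧
        Finset.univ.image v = e := by
  rw [DClique.edges, Finset.mem_image, hK]
  simp only [mem_piFinset_part hP hk ht]
  constructor
  · rintro ⟨v, ⟨h1, h2, h3⟩, rfl⟩
    exact ⟨v, h1, h2, h3, rfl⟩
  · rintro ⟨v, h1, h2, h3, rfl⟩
    exact ⟨v, ⟨h1, h2, h3⟩, rfl⟩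

/-- The output of the program describes a partition into cliques with parts `P.part t i S`. -/
theorem exists_cliqueList (hmk : P.n ≤ P.m * P.k) :
    ∃ L : List (DClique (P.D + 2) (Fin P.n)), DescribesList P.result L ∧ L.Nodup ∧
      H.IsPartition L.toFinset ∧ L.length ≤ P.n ^ P.D * (P.m * 2 ^ P.k) ∧
      ∀ K ∈ L, ∃ x ∈ P.indices, K.parts = P.part x.1 x.2.1 x.2.2 := by
  have hex : ∀ x : {x // x ∈ P.indices}, ∃ K : DClique (P.D + 2) (Fin P.n),
      K.parts = P.part x.1.1 x.1.2.1 x.1.2.2 ∧ Describes (P.word x.1.1 x.1.2.1 x.1.2.2) K :=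
    fun x => exists_clique hP hk (mem_indices.1 x.2).1.1 (mem_indices.1 x.2).2
  choose K hKp hKd using hex
  have hmem : ∀ {C}, C ∈ P.indices.attach.map K ↔ ∃ x, K x = C := by simp
  refine ⟨P.indices.attach.map K, ?_, ?_, ⟨?_, ?_⟩, ?_, ?_⟩
  · refine ⟨P.indices.attach.map fun x => P.word x.1.1 x.1.2.1 x.1.2.2, ?_, ?_⟩
    · rw [List.forall₂_map_left_iff, List.forall₂_map_right_iff, List.forall₂_same]
      exact fun x _ => hKd x
    · rw [result_eq, ← List.flatMap_def]
      conv_lhs => rw [← List.attach_map_subtype_val P.indices, List.flatMap_map]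
  · refine (List.nodup_attach.2 indices_nodup).map fun x y hxy => ?_
    -- Any one tuple of a clique determines all three components of its index, so different indices
    -- give different cliques.
    obtain ⟨v, hv⟩ := exists_mem_piFinset_part hP hk (mem_indices.1 x.2).1.1 (mem_indices.1 x.2).2
    have hv' := hv
    rw [← hKp, hxy, hKp] at hv'
    obtain ⟨⟨a1, a2, a3⟩, -⟩ := (mem_piFinset_part hP hk (mem_indices.1 x.2).1.1 v).1 hv
    obtain ⟨⟨b1, b2, b3⟩, -⟩ := (mem_piFinset_part hP hk (mem_indices.1 y.2).1.1 v).1 hv'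
    refine Subtype.ext (Prod.ext (a1.symm.trans b1) (Prod.ext (a2.symm.trans b2) ?_))
    rw [← a3, ← b3, ← a2, ← b2]
  · intro C hC e he
    obtain ⟨x, rfl⟩ := hmem.1 (List.mem_toFinset.1 hC)
    obtain ⟨v, -, -, h, -⟩ := (mem_edges_iff hP hk (mem_indices.1 x.2).1.1 (hKp x)).1 he
    exact h
  · intro e he
    obtain ⟨v, ⟨hvc, hve⟩, huniq⟩ := existsUnique_canonical (H.uniform e he)
    have ht : address v P.D < P.n ^ P.D := address_lt v (by omega)
    have hi : entry v (P.D + 1) / P.k < P.m := Nat.div_lt_of_lt_mul (by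
      have := entry_lt v (show P.D + 1 < P.D + 2 by omega)
      rw [mul_comm]
      omega)
    have hv := (mem_piFinset_part hP hk ht v).2 ⟨⟨rfl, rfl, rfl⟩, hvc, hve ▸ he⟩
    have hne : P.bucket (address v P.D) (entry v (P.D + 1) / P.k)
        (P.code (address v (P.D + 1)) (entry v (P.D + 1) / P.k)) ≠ [] := by
      have h1 := Fintype.mem_piFinset.1 hv ⟨P.D, by omega⟩
      simp only [part, Finset.mem_filter, lt_irrefl, if_false, if_true] at h1
      exact List.ne_nil_of_mem h1.2
    have hx : (address v P.D, entry v (P.D + 1) / P.k,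
        P.code (address v (P.D + 1)) (entry v (P.D + 1) / P.k)) ∈ P.indices :=
      mem_indices.2 ⟨⟨ht, hi, code_lt hP _ _⟩, hne⟩
    refine ⟨K ⟨_, hx⟩, ⟨List.mem_toFinset.2 (hmem.2 ⟨_, rfl⟩), ?_⟩, ?_⟩
    · exact (mem_edges_iff hP hk ht (hKp ⟨_, hx⟩)).2 ⟨v, ⟨rfl, rfl, rfl⟩, hvc, he, hve⟩
    · rintro C ⟨hC, heC⟩
      obtain ⟨y, rfl⟩ := hmem.1 (List.mem_toFinset.1 hC)
      obtain ⟨w, ⟨a1, a2, a3⟩, hwc, -, hwe⟩ :=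
        (mem_edges_iff hP hk (mem_indices.1 y.2).1.1 (hKp y)).1 heC
      have : w = v := huniq w ⟨hwc, hwe⟩
      subst this
      congr 1
      refine Subtype.ext (Prod.ext a1.symm (Prod.ext a2.symm ?_))
      rw [← a3, ← a2]
  · rw [List.length_map, List.length_attach]
    exact indices_length_le
  · intro C hC
    obtain ⟨x, rfl⟩ := hmem.1 hC
    exact ⟨x.1, x.2, hKp x⟩

end

end Params

end WordRAM

/-! ### Acceptance counts and loads. -/

namespace WordRAM

theorem card_digit_eq_le (n D p v : ℕ) (hp : p < D) :
    ((Finset.range (n ^ D)).filter fun t => t / n ^ p % n = v).card ≤ n ^ (D - 1) := by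
  rcases Nat.eq_zero_or_pos n with rfl | hn
  · have : 0 ^ D = 0 := zero_pow (by omega)
    simp [this]
  have hN : 0 < n ^ p := by positivity
  have hlt : ∀ t, t % n ^ p < n ^ p := fun t => Nat.mod_lt _ hN
  rw [← Finset.card_range (n ^ (D - 1))]
  -- The digit at position `p` is prescribed, so `t` is determined by what remains when it is
  -- deleted.
  refine Finset.card_le_card_of_injOn (fun t => t % n ^ p + t / n ^ (p + 1) * n ^ p) ?_ ?_
  · intro t ht
    have h1 := Finset.mem_range.1 (Finset.mem_filter.1 ht).1
    have h2 : t / n ^ (p + 1) < n ^ (D - 1 - p) := Nat.div_lt_of_lt_mul (by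
      rw [← pow_add]
      convert h1 using 2
      omega)
    have h3 := Nat.mul_le_mul_right (n ^ p) h2
    rw [Nat.succ_mul, ← pow_add, show D - 1 - p + p = D - 1 by omega] at h3
    refine Finset.mem_coe.2 (Finset.mem_range.2 ?_)
    have := hlt t
    simp only
    omega
  · intro t ht t' ht' h
    have e := (Finset.mem_filter.1 ht).2
    have e' := (Finset.mem_filter.1 ht').2
    obtain ⟨h1, h2⟩ := eq_of_add_mul_eq (hlt t) (hlt t') h
    rw [pow_succ, ← Nat.div_div_eq_div_mul, ← Nat.div_div_eq_div_mul] at h2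
    rw [← Nat.div_add_mod t (n ^ p), ← Nat.div_add_mod t' (n ^ p), h1,
      ← Nat.div_add_mod (t / n ^ p) n, ← Nat.div_add_mod (t' / n ^ p) n, h2, e, e']

namespace Params

variable {P : Params}

/-- The number of pairs `(t, i)` for which the vertex `b` is accepted. -/
def vertexAccepted (P : Params) (b : ℕ) : ℕ :=
  ((Finset.range (P.n ^ P.D) ×ˢ Finset.range P.m).filter
    fun x => P.Accepts (x.1 + b * P.n ^ P.D) x.2).card

theorem sum_accepted :
    ∑ t ∈ Finset.range (P.n ^ P.D), ∑ i ∈ Finset.range P.m, P.accepted t i =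
      ∑ b ∈ Finset.range P.n, P.vertexAccepted b := by
  unfold accepted vertexAccepted
  simp only [Finset.card_filter, Finset.sum_product]
  rw [Finset.sum_comm]
  conv_rhs => rw [Finset.sum_comm]
  rw [Finset.sum_comm]
  refine Finset.sum_congr rfl fun t _ => ?_
  rw [Finset.sum_comm]

theorem digit_add {t b : ℕ} (ht : t < P.n ^ P.D) (hb : b < P.n) {j : ℕ} (hj : j < P.D + 1) :
    P.digit (t + b * P.n ^ P.D) j = if j = P.D then b else P.digit t j := by
  have h1 : t + b * P.n ^ P.D =
      ∑ j ∈ Finset.range (P.D + 1), (if j = P.D then b else P.digit t j) * P.n ^ j := by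
    rw [Finset.sum_range_succ, if_pos rfl]
    congr 1
    conv_lhs => rw [← sum_digit_mul_pow P.n t P.D ht]
    refine Finset.sum_congr rfl fun j hj => ?_
    rw [if_neg (Finset.mem_range.1 hj).ne, digit]
  rw [digit, h1, sum_mul_pow_div_mod (fun j _ => ?_) hj]
  split_ifs
  · exact hb
  · exact Nat.mod_lt _ (by omega)

theorem div_lt_of_le_mul (hmk : P.n ≤ P.m * P.k) {a : ℕ} (ha : a < P.n) : a / P.k < P.m :=
  Nat.div_lt_of_lt_mul (by rw [mul_comm]; omega)

theorem rank_le_of_key_lt {r r' a a' n : ℕ} (ha' : a' < n) (h : r * n + a < r' * n + a') :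
    r ≤ r' := by
  by_contra! hlt
  have := Nat.mul_le_mul_right n hlt
  rw [Nat.succ_mul] at this
  omega

open Classical in
/-- Every vertex is accepted about equally often. -/
theorem factorial_mul_vertexAccepted_le (hk : 0 < P.k) (hm : 0 < P.m) (hmk : P.n ≤ P.m * P.k)
    (hcop : (P.D + 2).Coprime P.m) {b : ℕ} (hb : b < P.n) :
    (P.D + 2).factorial * P.vertexAccepted b ≤
      (P.m ^ (P.D + 1) + (P.D + 2).factorial * (P.D + 2) ^ 2 * P.m ^ P.D) * P.k ^ P.D := by
  have : NeZero P.m := ⟨hm.ne'⟩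
  have hn : 0 < P.n := by omega
  -- A pair `(t, i)` is encoded by the tuple of the `D + 2` blocks and the offsets of the `D`
  -- vertices of `t` in their blocks. If `b` is accepted, the blocks are sorted and the one at
  -- position `D` is that of `b`; the offsets contribute the factor `k ^ D`.
  let w : ℕ × ℕ → Fin (P.D + 2) → ZMod P.m := fun x j =>
    ((if (j : ℕ) < P.D + 1 then P.digit (x.1 + b * P.n ^ P.D) j / P.k else x.2 : ℕ) : ZMod P.m)
  let q : ℕ × ℕ → Fin P.D → Fin P.k := fun x j => ⟨P.digit x.1 j % P.k, Nat.mod_lt _ hk⟩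
  have hsum : ∀ x, ∑ j, w x j = (P.blockSum (x.1 + b * P.n ^ P.D) x.2 : ZMod P.m) := by
    intro x
    rw [Fin.sum_univ_castSucc, blockSum, Nat.cast_add, Nat.cast_sum,
      ← Fin.sum_univ_eq_sum_range fun j =>
        ((P.digit (x.1 + b * P.n ^ P.D) j / P.k : ℕ) : ZMod P.m)]
    refine congrArg₂ (· + ·) (Finset.sum_congr rfl fun j _ => ?_) (by simp [w])
    simp only [w, Fin.val_castSucc, if_pos j.2]
  have hrank : ∀ x : ℕ × ℕ, x.2 < P.m → ∀ β : ℕ, SortedTuples.rank (w x) (β : ZMod P.m) =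
      P.rank (P.blockSum (x.1 + b * P.n ^ P.D) x.2) β := by
    intro x hx β
    -- There are `D + 2` blocks, all below `m`, so the subtraction in `rank` is not truncated and
    -- computes the negative of the sum modulo `m`.
    have hle : P.blockSum (x.1 + b * P.n ^ P.D) x.2 ≤ (P.D + 2) * P.m := by
      have h1 : ∑ j ∈ Finset.range (P.D + 1), P.digit (x.1 + b * P.n ^ P.D) j / P.k ≤
          (Finset.range (P.D + 1)).card • P.m := Finset.sum_le_card_nsmul _ _ _ fun j _ =>
        (div_lt_of_le_mul hmk (Nat.mod_lt _ hn)).le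
      rw [Finset.card_range, smul_eq_mul] at h1
      rw [blockSum]
      nlinarith
    rw [SortedTuples.rank, hsum, rank, ← ZMod.val_natCast]
    congr 1
    have h2 : (((P.D + 2) * P.m - P.blockSum (x.1 + b * P.n ^ P.D) x.2 : ℕ) : ZMod P.m) =
        -(P.blockSum (x.1 + b * P.n ^ P.D) x.2 : ZMod P.m) := by
      rw [Nat.cast_sub hle]
      simp
    rw [Nat.cast_add ((P.D + 2) * β), h2]
    push_cast
    ring
  have hcard : P.vertexAccepted b ≤ ((Finset.univ.filter fun w : Fin (P.D + 2) → ZMod P.m =>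
      SortedTuples.Sorted w ∧ w ⟨P.D, by omega⟩ = ((b / P.k : ℕ) : ZMod P.m)) ×ˢ
        (Finset.univ : Finset (Fin P.D → Fin P.k))).card := by
    refine Finset.card_le_card_of_injOn (fun x => (w x, q x)) ?_ ?_
    · rintro ⟨t, i⟩ hx
      obtain ⟨hx1, hacc⟩ := Finset.mem_filter.1 hx
      obtain ⟨ht, hi⟩ := Finset.mem_product.1 hx1
      replace ht := Finset.mem_range.1 ht
      replace hi := Finset.mem_range.1 hi
      simp only at ht hi hacc
      refine Finset.mem_coe.2 (Finset.mem_product.2 ⟨Finset.mem_filter.2 ⟨Finset.mem_univ _, ?_, ?_⟩,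
        Finset.mem_univ _⟩)
      · rw [SortedTuples.Sorted, Fin.monotone_iff_le_succ]
        rintro ⟨j, hj⟩
        have hdig := Nat.mod_lt (( t + b * P.n ^ P.D) / P.n ^ (j + 1)) hn
        rcases Nat.lt_succ_iff_lt_or_eq.1 hj with h | rfl
        · have h1 := rank_le_of_key_lt hdig (hacc.1 j h)
          have e1 : w (t, i) (Fin.castSucc ⟨j, hj⟩) =
              ((P.digit (t + b * P.n ^ P.D) j / P.k : ℕ) : ZMod P.m) := by
            simp [w, show ¬ P.D < j by omega]
          have e2 : w (t, i) (Fin.succ ⟨j, hj⟩) =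
              ((P.digit (t + b * P.n ^ P.D) (j + 1) / P.k : ℕ) : ZMod P.m) := by simp [w, h]
          simp only [e1, e2, hrank (t, i) hi]
          exact h1
        · have h0 := hacc.2
          have h1 : P.rank (P.blockSum (t + b * P.n ^ P.D) i)
              (P.digit (t + b * P.n ^ P.D) P.D / P.k) ≤
              P.rank (P.blockSum (t + b * P.n ^ P.D) i) i := by
            by_contra! hlt
            have := Nat.mul_le_mul_right P.n hlt
            rw [Nat.succ_mul] at this
            rw [key, top] at h0
            omega
          have e1 : w (t, i) (Fin.castSucc ⟨P.D, hj⟩) =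
              ((P.digit (t + b * P.n ^ P.D) P.D / P.k : ℕ) : ZMod P.m) := by simp [w]
          have e2 : w (t, i) (Fin.succ ⟨P.D, hj⟩) = (i : ZMod P.m) := by simp [w]
          simp only [e1, e2, hrank (t, i) hi]
          exact h1
      · simp [w, digit_add ht hb]
    · rintro ⟨t, i⟩ hx ⟨t', i'⟩ hx' h
      obtain ⟨hx1, -⟩ := Finset.mem_filter.1 hx
      obtain ⟨hx1', -⟩ := Finset.mem_filter.1 hx'
      obtain ⟨ht, hi⟩ := Finset.mem_product.1 hx1
      obtain ⟨ht', hi'⟩ := Finset.mem_product.1 hx1'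
      replace ht := Finset.mem_range.1 ht
      replace hi := Finset.mem_range.1 hi
      replace ht' := Finset.mem_range.1 ht'
      replace hi' := Finset.mem_range.1 hi'
      simp only at ht hi ht' hi'
      obtain ⟨hw, hq⟩ := Prod.mk.inj h
      have hcast : ∀ {x y : ℕ}, x < P.m → y < P.m → (x : ZMod P.m) = y → x = y := by
        intro x y hx hy hxy
        have := congrArg ZMod.val hxy
        rwa [ZMod.val_natCast, ZMod.val_natCast, Nat.mod_eq_of_lt hx, Nat.mod_eq_of_lt hy] at this
      have hi2 : i = i' := hcast hi hi' (by simpa [w] using congrFun hw (Fin.last _))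
      have hd : ∀ j < P.D, P.digit t j = P.digit t' j := by
        intro j hj
        have h1 := congrFun hw ⟨j, by omega⟩
        have h2 := congrArg Fin.val (congrFun hq ⟨j, hj⟩)
        simp only [w, q, digit_add ht hb (show j < P.D + 1 by omega),
          digit_add ht' hb (show j < P.D + 1 by omega), if_pos (show j < P.D + 1 by omega),
          if_neg hj.ne] at h1 h2
        have h3 := hcast (div_lt_of_le_mul hmk (Nat.mod_lt _ hn))
          (div_lt_of_le_mul hmk (Nat.mod_lt _ hn)) h1
        rw [← Nat.div_add_mod (P.digit t j) P.k, ← Nat.div_add_mod (P.digit t' j) P.k, h2]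
        congr 2
      refine Prod.ext ?_ hi2
      simp only
      rw [← sum_digit_mul_pow P.n t P.D ht, ← sum_digit_mul_pow P.n t' P.D ht']
      refine Finset.sum_congr rfl fun j hj => ?_
      have := hd j (Finset.mem_range.1 hj)
      rw [digit, digit] at this
      rw [this]
  rw [Finset.card_product, Finset.card_univ, Fintype.card_fun, Fintype.card_fin,
    Fintype.card_fin] at hcard
  calc _ ≤ _ := Nat.mul_le_mul_left _ hcard
    _ = _ := (mul_assoc _ _ _).symm
    _ ≤ _ := Nat.mul_le_mul_right _ (SortedTuples.factorial_mul_card_sorted_le hcop _ _)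

/-- A bound for the loads. -/
theorem load_le (L : List (DClique (P.D + 2) (Fin P.n)))
    (hL : ∀ K ∈ L, ∃ x ∈ P.indices, K.parts = P.part x.1 x.2.1 x.2.2) (hk : 0 < P.k)
    (v : Fin P.n) :
    DClique.load L.toFinset v ≤ P.vertexAccepted v + P.n ^ P.D * 2 ^ P.k +
      P.D * P.n ^ (P.D - 1) * (P.m * 2 ^ P.k) := by
  -- The cliques containing `v` are sorted by its role. In a bucket, the pair `(t, i)` determines
  -- `S`. In the last part, `i` is the block of `v`. In a singleton, `v` is a digit of `t`.
  let s₁ := ((Finset.range (P.n ^ P.D) ×ˢ Finset.range P.m).filter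
    fun x => P.Accepts (x.1 + (v : ℕ) * P.n ^ P.D) x.2).image
      fun x => (x.1, x.2, P.code (x.1 + (v : ℕ) * P.n ^ P.D) x.2)
  let s₂ := Finset.range (P.n ^ P.D) ×ˢ {(v : ℕ) / P.k} ×ˢ Finset.range (2 ^ P.k)
  let s₃ := ((Finset.range P.D).biUnion fun p =>
    (Finset.range (P.n ^ P.D)).filter fun t => t / P.n ^ p % P.n = v) ×ˢ
      Finset.range P.m ×ˢ Finset.range (2 ^ P.k)
  have h1 : DClique.load L.toFinset v ≤ (s₁ ∪ s₂ ∪ s₃).card := by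
    refine Finset.card_le_card_of_forall_subsingleton
      (fun K x => K.parts = P.part x.1 x.2.1 x.2.2) (fun K hK => ?_) (fun x _ K hK K' hK' => ?_)
    · obtain ⟨hKL, hv⟩ := Finset.mem_filter.1 hK
      obtain ⟨⟨t, i, S⟩, hx, hparts⟩ := hL K (List.mem_toFinset.1 hKL)
      obtain ⟨⟨ht, hi, hS⟩, -⟩ := mem_indices.1 hx
      simp only at ht hi hS hparts
      refine ⟨(t, i, S), ?_, hparts⟩
      obtain ⟨p, hp⟩ := DClique.mem_vertices.1 hv
      rw [hparts] at hp
      have hp' := (Finset.mem_filter.1 hp).2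
      split_ifs at hp' with h h'
      · refine Finset.mem_union_right _ (Finset.mem_product.2
          ⟨Finset.mem_biUnion.2 ⟨p, Finset.mem_range.2 h, Finset.mem_filter.2
            ⟨Finset.mem_range.2 ht, hp'.symm⟩⟩, Finset.mem_product.2
              ⟨Finset.mem_range.2 hi, Finset.mem_range.2 hS⟩⟩)
      · obtain ⟨-, -, hacc, hcode⟩ := mem_bucket.1 hp'
        refine Finset.mem_union_left _ (Finset.mem_union_left _ (Finset.mem_image.2
          ⟨(t, i), Finset.mem_filter.2 ⟨Finset.mem_product.2
            ⟨Finset.mem_range.2 ht, Finset.mem_range.2 hi⟩, hacc⟩, by rw [hcode]⟩))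
      · obtain ⟨c, hc, -, ha⟩ := mem_members.1 hp'
        have hi' : i = (v : ℕ) / P.k := by
          rw [← ha, mul_comm, Nat.mul_add_div hk, Nat.div_eq_of_lt hc, add_zero]
        exact Finset.mem_union_left _ (Finset.mem_union_right _ (Finset.mem_product.2
          ⟨Finset.mem_range.2 ht, Finset.mem_product.2
            ⟨Finset.mem_singleton.2 hi', Finset.mem_range.2 hS⟩⟩))
    · exact DClique.parts_injective (hK.2.trans hK'.2.symm)
  have h2 : s₁.card ≤ P.vertexAccepted v := Finset.card_image_le
  have h3 : s₂.card = P.n ^ P.D * 2 ^ P.k := by simp [s₂, Finset.card_product]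
  have h4 : s₃.card ≤ P.D * P.n ^ (P.D - 1) * (P.m * 2 ^ P.k) := by
    rw [Finset.card_product, Finset.card_product, Finset.card_range, Finset.card_range]
    refine Nat.mul_le_mul_right _ ?_
    have := Finset.card_biUnion_le_card_mul (Finset.range P.D) (fun p =>
      (Finset.range (P.n ^ P.D)).filter fun t => t / P.n ^ p % P.n = v) (P.n ^ (P.D - 1))
      fun p hp => card_digit_eq_le _ _ _ _ (Finset.mem_range.1 hp)
    rwa [Finset.card_range] at this
  have h5 := Finset.card_union_le (s₁ ∪ s₂) s₃
  have h6 := Finset.card_union_le s₁ s₂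
  omega

end Params

end WordRAM

/-! ### Asymptotics of the bounds. -/

namespace WordRAM

open Filter Topology

theorem tendsto_blockSize : Tendsto blockSize atTop atTop := by
  refine tendsto_atTop.2 fun c => ?_
  filter_upwards [eventually_ge_atTop ((c + 1) ^ 2 * 2 ^ (c + 1))] with n hn
  by_contra! h
  have h1 := lt_blockSize n
  have h2 : (blockSize n + 1) ^ 2 * 2 ^ (blockSize n + 1) ≤ (c + 1) ^ 2 * 2 ^ (c + 1) :=
    Nat.mul_le_mul (Nat.pow_le_pow_left (by omega) 2) (Nat.pow_le_pow_right two_pos (by omega))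
  omega

theorem tendsto_inv_blockSize : Tendsto (fun n => ((blockSize n : ℝ))⁻¹) atTop (𝓝 0) :=
  tendsto_inv_atTop_zero.comp (tendsto_natCast_atTop_atTop.comp tendsto_blockSize)

theorem eventually_blockSize_sq_mul_le :
    ∀ᶠ n in atTop, (2 : ℝ) ^ blockSize n * (blockSize n : ℝ) ^ 2 ≤ n := by
  filter_upwards [tendsto_blockSize.eventually_ge_atTop 2] with n hn
  rcases blockSize_le_or n with h | h
  · omega
  · rw [mul_comm]
    exact_mod_cast h

theorem tendsto_logb_div_self : Tendsto (fun x : ℝ => Real.logb 2 x / x) atTop (𝓝 0) := by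
  have h := Real.isLittleO_log_id_atTop.tendsto_div_nhds_zero
  have h2 := h.div_const (Real.log 2)
  rw [zero_div] at h2
  refine h2.congr fun x => ?_
  simp only [id, Real.logb]
  ring

/-- The choice of `k` gives `k ≤ lg n ≤ k + 1 + 2 lg (k + 1)` for large `n`. -/
theorem tendsto_logb_div_blockSize :
    Tendsto (fun n : ℕ => Real.logb 2 n / blockSize n) atTop (𝓝 1) := by
  have hu : Tendsto (fun k : ℕ => 1 + (k : ℝ)⁻¹ +
      2 * (Real.logb 2 ((k + 1 : ℕ) : ℝ) / ((k + 1 : ℕ) : ℝ)) * (1 + (k : ℝ)⁻¹)) atTop (𝓝 1) := by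
    have h1 : Tendsto (fun k : ℕ => (k : ℝ)⁻¹) atTop (𝓝 0) := tendsto_inv_atTop_nhds_zero_nat
    have h2 : Tendsto (fun k : ℕ => Real.logb 2 ((k + 1 : ℕ) : ℝ) / ((k + 1 : ℕ) : ℝ)) atTop (𝓝 0) :=
      tendsto_logb_div_self.comp (tendsto_natCast_atTop_atTop.comp (tendsto_add_atTop_nat 1))
    have := (h1.const_add 1).add ((h2.const_mul 2).mul (h1.const_add 1))
    simpa using this
  refine tendsto_of_tendsto_of_tendsto_of_le_of_le' tendsto_const_nhds
    (hu.comp tendsto_blockSize) ?_ ?_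
  · filter_upwards [tendsto_blockSize.eventually_ge_atTop 1, eventually_blockSize_sq_mul_le,
      eventually_ge_atTop 1] with n hk h hn
    have hk' : (1 : ℝ) ≤ blockSize n := by exact_mod_cast hk
    have hn' : (0 : ℝ) < n := by exact_mod_cast hn
    rw [le_div_iff₀ (by linarith), one_mul, Real.le_logb_iff_rpow_le one_lt_two hn',
      Real.rpow_natCast]
    refine le_trans ?_ h
    exact le_mul_of_one_le_right (by positivity) (one_le_pow₀ hk')
  · filter_upwards [tendsto_blockSize.eventually_ge_atTop 1, eventually_ge_atTop 1] with n hk hn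
    have hk' : (1 : ℝ) ≤ blockSize n := by exact_mod_cast hk
    have hn' : (0 : ℝ) < n := by exact_mod_cast hn
    have h1 : (n : ℝ) ≤ ((blockSize n + 1 : ℕ) : ℝ) ^ 2 * 2 ^ (blockSize n + 1) := by
      exact_mod_cast (lt_blockSize n).le
    have h2 := Real.logb_le_logb_of_le one_lt_two hn' h1
    rw [Real.logb_mul (by positivity) (by positivity), Real.logb_pow, Real.logb_pow,
      Real.logb_self_eq_one one_lt_two] at h2
    simp only [Function.comp_apply]
    rw [div_le_iff₀ (by linarith)]
    refine h2.trans (le_of_eq ?_)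
    push_cast
    field_simp
    ring

theorem tendsto_blockSize_div : Tendsto (fun n : ℕ => (blockSize n : ℝ) / n) atTop (𝓝 0) := by
  refine tendsto_of_tendsto_of_tendsto_of_le_of_le' tendsto_const_nhds tendsto_inv_blockSize
    (Eventually.of_forall fun n => by positivity) ?_
  filter_upwards [tendsto_blockSize.eventually_ge_atTop 1, eventually_blockSize_sq_mul_le,
    eventually_ge_atTop 1] with n hk h hn
  have hk' : (0 : ℝ) < blockSize n := by exact_mod_cast hk
  have hn' : (0 : ℝ) < n := by exact_mod_cast hn
  rw [inv_eq_one_div, div_le_div_iff₀ hn' hk', one_mul, ← sq]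
  refine le_trans ?_ h
  exact le_mul_of_one_le_left (by positivity) (one_le_pow₀ one_le_two)

/-- This is why `k ^ 2 * 2 ^ k ≤ n` is required: one factor `k` makes the load `n ^ D * 2 ^ k`
comparable with the main term `n ^ (D + 1) / k`, and the other makes it negligible. -/
theorem tendsto_two_pow_blockSize_mul_div :
    Tendsto (fun n : ℕ => (2 : ℝ) ^ blockSize n * blockSize n / n) atTop (𝓝 0) := by
  refine tendsto_of_tendsto_of_tendsto_of_le_of_le' tendsto_const_nhds tendsto_inv_blockSize
    (Eventually.of_forall fun n => by positivity) ?_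
  filter_upwards [tendsto_blockSize.eventually_ge_atTop 1, eventually_blockSize_sq_mul_le,
    eventually_ge_atTop 1] with n hk h hn
  have hk' : (0 : ℝ) < blockSize n := by exact_mod_cast hk
  have hn' : (0 : ℝ) < n := by exact_mod_cast hn
  rw [inv_eq_one_div, div_le_div_iff₀ hn' hk', one_mul]
  linarith

theorem tendsto_blockCount_mul_div (D : ℕ) :
    Tendsto (fun n : ℕ => (blockCount D n : ℝ) * blockSize n / n) atTop (𝓝 1) := by
  have hu : Tendsto (fun n : ℕ => 1 + (D + 3 : ℝ) * ((blockSize n : ℝ) / n)) atTop (𝓝 1) := by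
    simpa using (tendsto_blockSize_div.const_mul (D + 3 : ℝ)).const_add 1
  refine tendsto_of_tendsto_of_tendsto_of_le_of_le' tendsto_const_nhds hu ?_ ?_
  · filter_upwards [eventually_ge_atTop 1] with n hn
    have hn' : (0 : ℝ) < n := by exact_mod_cast hn
    rw [le_div_iff₀ hn', one_mul]
    exact_mod_cast le_blockCount_mul D n
  · filter_upwards [eventually_ge_atTop 1] with n hn
    have hn' : (0 : ℝ) < n := by exact_mod_cast hn
    have h : (blockCount D n : ℝ) * blockSize n ≤ n + (D + 3) * blockSize n := by
      exact_mod_cast blockCount_mul_le D n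
    rw [div_le_iff₀ hn']
    refine h.trans (le_of_eq ?_)
    field_simp

/-- The number of blocks is chosen to be `1` modulo `d`. -/
theorem coprime_blockCount (D n : ℕ) : (D + 2).Coprime (blockCount D n) := by
  rw [blockCount, Nat.coprime_mul_right_add_right]
  exact Nat.coprime_one_right _

/-- A bound for the number of pairs for which a given vertex is accepted. -/
noncomputable def acceptedBound (D n : ℕ) : ℝ :=
  ((blockCount D n : ℝ) ^ (D + 1) / (D + 2).factorial + (D + 2) ^ 2 * (blockCount D n : ℝ) ^ D) *
    (blockSize n : ℝ) ^ D

/-- A bound for the loads. -/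
noncomputable def loadBound (D n : ℕ) : ℝ :=
  acceptedBound D n + (n : ℝ) ^ D * 2 ^ blockSize n +
    D * (n : ℝ) ^ (D - 1) * (blockCount D n * 2 ^ blockSize n)

/-- A bound for the number of cliques. -/
noncomputable def lengthBound (D n : ℕ) : ℝ :=
  (n : ℝ) ^ D * (blockCount D n * 2 ^ blockSize n)

/-- A bound for the number of steps. -/
noncomputable def timeBound (D n : ℕ) : ℝ :=
  9 * n + 3 * D + 42 + (n : ℝ) ^ D * (blockCount D n * (n * (25 * (D + 1) + 25) +
    2 ^ blockSize n * (8 * D + 16 * blockSize n + 22) + 7) + 4) +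
    (13 * blockSize n + 16) * (n * acceptedBound D n)

theorem tendsto_loadBound (D : ℕ) :
    Tendsto (fun n : ℕ => loadBound D n * (Real.logb 2 n / (n : ℝ) ^ (D + 1))) atTop
      (𝓝 (1 / (D + 2).factorial)) := by
  have hu := tendsto_blockCount_mul_div D
  have hl := tendsto_logb_div_blockSize
  have hk := tendsto_blockSize_div
  have hg := tendsto_two_pow_blockSize_mul_div
  -- The summands are, in this order, the main term, the correction for repeated blocks, the load
  -- from the last parts, and the load from the singletons. Only the first survives.
  have h := (((((hu.pow (D + 1)).mul hl).div_const ((D + 2).factorial : ℝ)).add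
    ((((hu.pow D).mul hl).mul hk).const_mul ((D + 2 : ℝ) ^ 2))).add (hg.mul hl)).add
    ((((hu.mul hg).mul hl).mul tendsto_inv_blockSize).const_mul (D : ℝ))
  simp only [one_pow, mul_zero, mul_one, add_zero] at h
  refine h.congr' ?_
  filter_upwards [tendsto_blockSize.eventually_ge_atTop 1, eventually_ge_atTop 1] with n hk hn
  have hk' : (0 : ℝ) < blockSize n := by exact_mod_cast hk
  have hn' : (0 : ℝ) < n := by exact_mod_cast hn
  have hf : (0 : ℝ) < (D + 2).factorial := by exact_mod_cast Nat.factorial_pos _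
  rw [loadBound, acceptedBound]
  rcases D with _ | D
  · simp
    field_simp
  · simp only [Nat.add_sub_cancel, div_pow, mul_pow]
    field_simp
    ring

theorem lengthBound_le (D : ℕ) :
    ∃ B : ℝ, ∀ n : ℕ, 2 ≤ n → lengthBound D n ≤ B * ((n : ℝ) ^ (D + 2) / Real.logb 2 n ^ 3) := by
  have h := (tendsto_blockCount_mul_div D).mul (tendsto_logb_div_blockSize.pow 3)
  have h2 : ∀ᶠ n : ℕ in atTop,
      lengthBound D n / ((n : ℝ) ^ (D + 2) / Real.logb 2 n ^ 3) ≤ 2 := by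
    filter_upwards [h.eventually_lt_const (show 1 * 1 ^ 3 < (2 : ℝ) by norm_num),
      tendsto_blockSize.eventually_ge_atTop 1, eventually_ge_atTop 2,
      eventually_blockSize_sq_mul_le] with n h hk hn he
    have hk' : (0 : ℝ) < blockSize n := by exact_mod_cast hk
    have hn' : (0 : ℝ) < n := by positivity
    have hlog : 0 < Real.logb 2 n := Real.logb_pos one_lt_two (by exact_mod_cast hn)
    have he' : (2 : ℝ) ^ blockSize n * (blockSize n : ℝ) ^ 2 / n ≤ 1 := (div_le_one hn').2 he
    refine le_trans ?_ h.le
    refine le_trans (le_of_eq ?_) (mul_le_of_le_one_right (by positivity) he')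
    rw [lengthBound]
    field_simp
    ring
  obtain ⟨N, hN⟩ := eventually_atTop.1 h2
  -- The sum absorbs the finitely many small `n`, so that one constant works for all `n ≥ 2`.
  refine ⟨2 + ∑ n ∈ Finset.range N,
    |lengthBound D n / ((n : ℝ) ^ (D + 2) / Real.logb 2 n ^ 3)|, fun n hn => ?_⟩
  have hn' : (0 : ℝ) < n := by positivity
  have hlog : 0 < Real.logb 2 n := Real.logb_pos one_lt_two (by exact_mod_cast hn)
  rw [← div_le_iff₀ (by positivity)]
  have h0 : 0 ≤ ∑ n ∈ Finset.range N,
    |lengthBound D n / ((n : ℝ) ^ (D + 2) / Real.logb 2 n ^ 3)| :=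
    Finset.sum_nonneg fun _ _ => abs_nonneg _
  by_cases h : N ≤ n
  · linarith [hN n h]
  · have := Finset.single_le_sum (f := fun n : ℕ =>
      |lengthBound D n / ((n : ℝ) ^ (D + 2) / Real.logb 2 n ^ 3)|)
      (fun _ _ => abs_nonneg _) (Finset.mem_range.2 (not_le.1 h))
    linarith [le_abs_self (lengthBound D n / ((n : ℝ) ^ (D + 2) / Real.logb 2 n ^ 3))]

/-- Only the reading survives, `13 k` steps for each of about `n ^ (D + 2) / (d! k)` accepted
triples. The acceptance tests cost `O_d(n ^ d / k)`, and running through all buckets costs `O_d(n ^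
D * m * 2 ^ k * k) = O_d(n ^ d / k ^ 2)`. -/
theorem tendsto_timeBound (D : ℕ) :
    Tendsto (fun n : ℕ => timeBound D n / (n : ℝ) ^ (D + 2)) atTop
      (𝓝 (13 / (D + 2).factorial)) := by
  have hu := tendsto_blockCount_mul_div D
  have hk := tendsto_blockSize_div
  have hg := tendsto_two_pow_blockSize_mul_div
  have hv := tendsto_inv_blockSize
  have hi : Tendsto (fun n : ℕ => (n : ℝ)⁻¹) atTop (𝓝 0) := tendsto_inv_atTop_nhds_zero_nat
  have h1 := ((hi.pow (D + 1)).const_mul 9).add ((hi.pow (D + 2)).const_mul (3 * D + 42 : ℝ))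
  have h2 := ((hu.mul hv).mul_const (25 * (D + 1) + 25 : ℝ)).add
    (((hu.mul hg).mul ((((hv.pow 2).mul_const (8 * D + 22 : ℝ)).add
      (hv.mul_const 16)))).add (((hu.mul hv).mul hi).mul_const 7))
  have h3 := (hi.pow 2).const_mul 4
  have h4 := (((hv.const_mul 16).const_add 13).mul (hu.pow (D + 1))).div_const
    ((D + 2).factorial : ℝ)
  have h5 := (((hk.const_mul 13).add (hi.const_mul 16)).mul (hu.pow D)).mul_const
    ((D + 2 : ℝ) ^ 2)
  have h := h1.add (h2.add (h3.add (h4.add h5)))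
  simp only [one_pow, mul_zero, mul_one, add_zero, zero_add, zero_mul, zero_pow (Nat.succ_ne_zero _)]
    at h
  refine h.congr' ?_
  filter_upwards [tendsto_blockSize.eventually_ge_atTop 1, eventually_ge_atTop 1] with n hk hn
  have hk' : (0 : ℝ) < blockSize n := by exact_mod_cast hk
  have hn' : (0 : ℝ) < n := by exact_mod_cast hn
  have hf : (0 : ℝ) < (D + 2).factorial := by exact_mod_cast Nat.factorial_pos _
  rw [timeBound, acceptedBound]
  simp only [div_pow, mul_pow, inv_pow]
  field_simp
  ring

end WordRAM

/-! ### The bounds for the program. -/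

namespace WordRAM

theorem Params.totalCost_eq (P : Params) :
    P.totalCost = P.n ^ P.D * (P.m * (P.n * (25 * (P.D + 1) + 25) +
      2 ^ P.k * (8 * P.D + 16 * P.k + 22) + 7) + 4) +
      (13 * P.k + 16) * ∑ b ∈ Finset.range P.n, P.vertexAccepted b + 2 := by
  rw [totalCost, ← sum_accepted]
  simp only [cost, Finset.sum_add_distrib, Finset.sum_const, Finset.card_range, smul_eq_mul,
    ← Finset.mul_sum]
  ring

variable {D n : ℕ} (H : UniformHypergraph (D + 2) (Fin n))

theorem vertexAccepted_le_acceptedBound {b : ℕ} (hb : b < n) :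
    ((params D n (adjacencyArray H)).vertexAccepted b : ℝ) ≤ acceptedBound D n := by
  have h := Params.factorial_mul_vertexAccepted_le (P := params D n (adjacencyArray H))
    (Nat.succ_pos _) (Nat.succ_pos _) (le_blockCount_mul D n) (coprime_blockCount D n) hb
  have hf : (0 : ℝ) < (D + 2).factorial := by exact_mod_cast Nat.factorial_pos _
  have h' : ((D + 2).factorial : ℝ) * (params D n (adjacencyArray H)).vertexAccepted b ≤
      ((blockCount D n : ℝ) ^ (D + 1) + (D + 2).factorial * (D + 2 : ℝ) ^ 2 *
        (blockCount D n : ℝ) ^ D) * (blockSize n : ℝ) ^ D := by exact_mod_cast h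
  rw [acceptedBound, ← mul_le_mul_iff_right₀ hf]
  refine h'.trans (le_of_eq ?_)
  field_simp

theorem exists_outputs :
    ∃ (L : List (DClique (D + 2) (Fin n))) (t : ℕ),
      Outputs (partitionProgram D) (4 * D + 20) H L t ∧ L.Nodup ∧ H.IsPartition L.toFinset ∧
      (∀ v, (DClique.load L.toFinset v : ℝ) ≤ loadBound D n) ∧
      (L.length : ℝ) ≤ lengthBound D n ∧ (t : ℝ) ≤ timeBound D n := by
  obtain ⟨s, t, hs, hout, ht⟩ := wp_partitionProgram D n (adjacencyArray_le_one H)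
  obtain ⟨L, hdesc, hnodup, hpart, hlen, hL⟩ := Params.exists_cliqueList
    (P := params D n (adjacencyArray H)) (H := H) rfl (Nat.succ_pos _) (le_blockCount_mul D n)
  refine ⟨L, t, ⟨s, hs, hout ▸ hdesc⟩, hnodup, hpart, fun v => ?_, ?_, ?_⟩
  · have h := Params.load_le L hL (Nat.succ_pos _) v
    have h' : (DClique.load L.toFinset v : ℝ) ≤
        (params D n (adjacencyArray H)).vertexAccepted v + (n : ℝ) ^ D * 2 ^ blockSize n +
          D * (n : ℝ) ^ (D - 1) * (blockCount D n * 2 ^ blockSize n) := by exact_mod_cast h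
    have := vertexAccepted_le_acceptedBound H v.2
    refine h'.trans ?_
    rw [loadBound]
    gcongr
  · rw [lengthBound]
    exact_mod_cast hlen
  · have h1 : ∑ b ∈ Finset.range n, ((params D n (adjacencyArray H)).vertexAccepted b : ℝ) ≤
        n * acceptedBound D n := by
      have := Finset.sum_le_card_nsmul (Finset.range n)
        (fun b => ((params D n (adjacencyArray H)).vertexAccepted b : ℝ)) _
        fun b hb => vertexAccepted_le_acceptedBound H (Finset.mem_range.1 hb)
      rwa [Finset.card_range, nsmul_eq_mul] at this
    rw [Params.totalCost_eq] at ht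
    have ht' : (t : ℝ) ≤ 9 * n + 3 * D + 40 + ((n : ℝ) ^ D * (blockCount D n *
        (n * (25 * (D + 1) + 25) + 2 ^ blockSize n * (8 * D + 16 * blockSize n + 22) + 7) + 4) +
        (13 * blockSize n + 16) * ∑ b ∈ Finset.range n,
          ((params D n (adjacencyArray H)).vertexAccepted b : ℝ) + 2) := by exact_mod_cast ht
    have h2 := mul_le_mul_of_nonneg_left h1
      (show (0 : ℝ) ≤ 13 * blockSize n + 16 by positivity)
    rw [timeBound]
    linarith

end WordRAM

/-! ### Transport to arbitrary finite vertex sets. -/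

namespace DClique

variable {d : ℕ} {V W : Type*} [DecidableEq V] [DecidableEq W]

/-- The image of a `d`-clique under an equivalence. -/
def map (f : V ≃ W) (K : DClique d V) : DClique d W where
  parts i := (K.parts i).map f.toEmbedding
  nonempty i := (K.nonempty i).map
  disjoint i j h := (Finset.disjoint_map _).2 (K.disjoint i j h)

omit [DecidableEq V] [DecidableEq W] in
theorem map_injective (f : V ≃ W) : Function.Injective (map (d := d) f) := fun _ _ h =>
  parts_injective (funext fun i => Finset.map_injective _ (congrFun (congrArg parts h) i))

theorem edges_map (f : V ≃ W) (K : DClique d V) :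
    (K.map f).edges = K.edges.map (Finset.mapEmbedding f.toEmbedding).toEmbedding := by
  ext e
  simp only [edges, Finset.mem_image, Fintype.mem_piFinset, Finset.mem_map, map]
  constructor
  · rintro ⟨v, hv, rfl⟩
    choose u hu hfu using hv
    refine ⟨_, ⟨u, hu, rfl⟩, ?_⟩
    ext x
    simp [← hfu, Equiv.eq_symm_apply]
  · rintro ⟨_, ⟨u, hu, rfl⟩, rfl⟩
    refine ⟨fun i => f (u i), fun i => ⟨u i, hu i, rfl⟩, ?_⟩
    ext x
    simp [Equiv.eq_symm_apply]

theorem mem_vertices_map (f : V ≃ W) (K : DClique d V) (v : V) :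
    f v ∈ (K.map f).vertices ↔ v ∈ K.vertices := by
  simp [mem_vertices, map]

end DClique

namespace UniformHypergraph

variable {d : ℕ} {V W : Type*} [DecidableEq V] [DecidableEq W]

/-- The image of a hypergraph under an equivalence. -/
def map (f : V ≃ W) (H : UniformHypergraph d V) : UniformHypergraph d W where
  edges := H.edges.map (Finset.mapEmbedding f.toEmbedding).toEmbedding
  uniform e he := by
    obtain ⟨e', he', rfl⟩ := Finset.mem_map.1 he
    simpa using H.uniform e' he'

theorem IsPartition.of_map {f : V ≃ W} {H : UniformHypergraph d V} {C : Finset (DClique d W)}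
    (h : (H.map f).IsPartition C) :
    ∃ C' : Finset (DClique d V), H.IsPartition C' ∧ C'.card = C.card ∧
      ∀ v, DClique.load C' v = DClique.load C (f v) := by
  classical
  have hsymm : ∀ K : DClique d W, (K.map f.symm).map f = K := fun K =>
    DClique.parts_injective (funext fun i => by
      ext x
      simp [DClique.map])
  have hC : C = (C.image (DClique.map f.symm)).image (DClique.map f) := by
    rw [Finset.image_image]
    simp [Function.comp_def, hsymm]
  refine ⟨C.image (DClique.map f.symm), ?_,
    Finset.card_image_of_injective _ (DClique.map_injective _), fun v => ?_⟩
  · generalize C.image (DClique.map f.symm) = C' at hC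
    subst hC
    refine ⟨fun K hK => ?_, fun e he => ?_⟩
    · have := h.1 _ (Finset.mem_image_of_mem _ hK)
      rwa [DClique.edges_map, map, Finset.map_subset_map] at this
    · obtain ⟨K, ⟨hK, heK⟩, huniq⟩ := h.2 (Finset.mapEmbedding f.toEmbedding e)
        (Finset.mem_map_of_mem _ he)
      obtain ⟨K, hKC, rfl⟩ := Finset.mem_image.1 hK
      rw [DClique.edges_map] at heK
      refine ⟨K, ⟨hKC, (Finset.mem_map' _).1 heK⟩, fun K' hK' => ?_⟩
      refine DClique.map_injective f (huniq _ ⟨Finset.mem_image_of_mem _ hK'.1, ?_⟩)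
      rw [DClique.edges_map]
      exact Finset.mem_map_of_mem _ hK'.2
  · generalize C.image (DClique.map f.symm) = C' at hC
    subst hC
    rw [DClique.load, DClique.load, Finset.filter_image,
      Finset.card_image_of_injective _ (DClique.map_injective _)]
    simp [DClique.mem_vertices_map]

end UniformHypergraph

/-! ### Asymptotics of the lower bound, and asymptotic equivalence. -/

namespace UniformHypergraph

open Filter Topology Asymptotics

variable {d : ℕ}

/-- The lower bound for `maxMC d n / n`. -/
noncomputable def coverBound (d n : ℕ) : ℝ :=
  (n.choose d - Real.exp 1 / Real.log 2) / (Real.logb 2 d + Real.logb 2 n) / n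

theorem coverBound_le (hd : 2 ≤ d) {n : ℕ} (hn : 2 ≤ n) : coverBound d n ≤ maxMC d n / n := by
  have h := choose_le_maxMC_mul_logb d n (by omega) (by omega)
  have h1 : 0 < Real.logb 2 d := Real.logb_pos one_lt_two (by exact_mod_cast hd)
  have h2 : 0 < Real.logb 2 n := Real.logb_pos one_lt_two (by exact_mod_cast hn)
  rw [coverBound]
  gcongr
  rw [div_le_iff₀ (by positivity)]
  linarith

theorem tendsto_coverBound (hd : 2 ≤ d) :
    Tendsto (fun n : ℕ => coverBound d n * (Real.logb 2 n / (n : ℝ) ^ (d - 1))) atTop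
      (𝓝 (1 / d.factorial)) := by
  have hd1 : 0 < Real.logb 2 d := Real.logb_pos one_lt_two (by exact_mod_cast hd)
  have hf : (d.factorial : ℝ) ≠ 0 := by positivity
  have hlog : Tendsto (fun n : ℕ => Real.logb 2 n) atTop atTop :=
    (Real.tendsto_logb_atTop one_lt_two).comp tendsto_natCast_atTop_atTop
  have h1 : Tendsto (fun n : ℕ => (n.choose d : ℝ) / (n : ℝ) ^ d) atTop (𝓝 (1 / d.factorial)) := by
    have := (isEquivalent_iff_tendsto_one ?_).1 (isEquivalent_choose d)
    · refine (this.div_const (d.factorial : ℝ)).congr' ?_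
      filter_upwards [eventually_ge_atTop 1] with n hn
      have hn' : (0 : ℝ) < n := by exact_mod_cast hn
      simp only [Pi.div_apply]
      field_simp
    · filter_upwards [eventually_ge_atTop 1] with n hn
      positivity
  have h2 : Tendsto (fun n : ℕ => Real.exp 1 / Real.log 2 / (n : ℝ) ^ d) atTop (𝓝 0) :=
    tendsto_const_nhds.div_atTop
      ((tendsto_pow_atTop (by omega)).comp tendsto_natCast_atTop_atTop)
  have h3 : Tendsto (fun n : ℕ => (1 + Real.logb 2 d / Real.logb 2 n)⁻¹) atTop (𝓝 1) := by
    simpa using ((tendsto_const_nhds (x := Real.logb 2 d)).div_atTop hlog).const_add 1 |>.inv₀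
      (by norm_num)
  have h := (h1.sub h2).mul h3
  rw [sub_zero, mul_one] at h
  refine h.congr' ?_
  filter_upwards [eventually_ge_atTop 2] with n hn
  have hn' : (0 : ℝ) < n := by positivity
  have hlog : 0 < Real.logb 2 n := Real.logb_pos one_lt_two (by exact_mod_cast hn)
  have hsum : 0 < Real.logb 2 n + Real.logb 2 d := by positivity
  obtain ⟨d, rfl⟩ : ∃ e, d = e + 1 := ⟨d - 1, by omega⟩
  simp only [coverBound, Nat.add_sub_cancel]
  rw [add_comm (Real.logb 2 _)]
  field_simp
  ring

theorem maxLMP_le_loadBound (D n : ℕ) : (maxLMP (D + 2) n : ℝ) ≤ WordRAM.loadBound D n := by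
  have h0 : 0 ≤ WordRAM.loadBound D n := by
    unfold WordRAM.loadBound WordRAM.acceptedBound
    positivity
  refine (Nat.le_floor_iff h0).1 (maxLMP_le fun H => ?_)
  obtain ⟨L, -, -, -, hpart, hload, -⟩ := WordRAM.exists_outputs H
  exact lmp_le hpart fun v => Nat.le_floor (hload v)

theorem isEquivalent_of_le {r f g : ℕ → ℝ} {c : ℝ} (hc : 0 < c) (hr : Tendsto r atTop (𝓝 0))
    (hg : ∀ n, 2 ≤ n → 0 < g n)
    (h : ∀ n, 2 ≤ n → (c - r n) * g n ≤ f n ∧ f n ≤ (c + r n) * g n) :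
    f ~[atTop] fun n => c * g n := by
  have h0 : ∀ᶠ n in atTop, c * g n ≠ 0 := by
    filter_upwards [eventually_ge_atTop 2] with n hn
    exact (mul_pos hc (hg n hn)).ne'
  refine (isEquivalent_iff_tendsto_one h0).2 ?_
  have h1 : Tendsto (fun n => (c - r n) / c) atTop (𝓝 1) := by
    simpa [hc.ne'] using (hr.const_sub c).div_const c
  have h2 : Tendsto (fun n => (c + r n) / c) atTop (𝓝 1) := by
    simpa [hc.ne'] using (hr.const_add c).div_const c
  refine tendsto_of_tendsto_of_tendsto_of_le_of_le' h1 h2 ?_ ?_ <;>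
    filter_upwards [eventually_ge_atTop 2] with n hn
  · rw [Pi.div_apply, div_le_div_iff₀ hc (mul_pos hc (hg n hn))]
    nlinarith [(h n hn).1]
  · rw [Pi.div_apply, div_le_div_iff₀ (mul_pos hc (hg n hn)) hc]
    nlinarith [(h n hn).2]

end UniformHypergraph

/-! ### The main theorem. -/

theorem mainTheorem1 :
    ∃ A : ℝ, ∀ d : ℕ, 2 ≤ d →
      -- the optimal loads and weights
      ((∃ r : ℕ → ℝ, Filter.Tendsto r Filter.atTop (nhds 0) ∧ ∀ n : ℕ, 2 ≤ n →
          (1 / (d.factorial : ℝ) - r n) * ((n : ℝ) ^ (d - 1) / Real.logb 2 n)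
              ≤ (UniformHypergraph.maxMC d n : ℝ) / n ∧
          (UniformHypergraph.maxMC d n : ℝ) / n ≤ (UniformHypergraph.maxMP d n : ℝ) / n ∧
          (UniformHypergraph.maxMP d n : ℝ) / n ≤ (UniformHypergraph.maxLMP d n : ℝ) ∧
          (UniformHypergraph.maxLMP d n : ℝ)
              ≤ (1 / (d.factorial : ℝ) + r n) * ((n : ℝ) ^ (d - 1) / Real.logb 2 n)) ∧
        Asymptotics.IsEquivalent Filter.atTop
          (fun n : ℕ => (UniformHypergraph.maxMC d n : ℝ) / n)
          (fun n : ℕ => 1 / (d.factorial : ℝ) * ((n : ℝ) ^ (d - 1) / Real.logb 2 n)) ∧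
        Asymptotics.IsEquivalent Filter.atTop
          (fun n : ℕ => (UniformHypergraph.maxMP d n : ℝ) / n)
          (fun n : ℕ => 1 / (d.factorial : ℝ) * ((n : ℝ) ^ (d - 1) / Real.logb 2 n)) ∧
        Asymptotics.IsEquivalent Filter.atTop
          (fun n : ℕ => (UniformHypergraph.maxLMP d n : ℝ))
          (fun n : ℕ => 1 / (d.factorial : ℝ) * ((n : ℝ) ^ (d - 1) / Real.logb 2 n))) ∧
      -- a partition with optimal loads and few cliques, and a program that constructs it
      ∃ (r : ℕ → ℝ) (B : ℝ), Filter.Tendsto r Filter.atTop (nhds 0) ∧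
        (∀ (V : Type*) [Fintype V] [DecidableEq V] (H : UniformHypergraph d V),
          2 ≤ Fintype.card V →
          ∃ C : Finset (DClique d V), H.IsPartition C ∧
            (∀ v, (DClique.load C v : ℝ) ≤ (1 / (d.factorial : ℝ) + r (Fintype.card V)) *
              ((Fintype.card V : ℝ) ^ (d - 1) / Real.logb 2 (Fintype.card V))) ∧
            (C.card : ℝ) ≤
              B * ((Fintype.card V : ℝ) ^ d / Real.logb 2 (Fintype.card V) ^ 3)) ∧
        ∃ (p : WordRAM.Program) (κ N : ℕ), ∀ (n : ℕ) (H : UniformHypergraph d (Fin n)),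
          ∃ (L : List (DClique d (Fin n))) (t : ℕ),
            WordRAM.Outputs p κ H L t ∧ L.Nodup ∧ H.IsPartition L.toFinset ∧
            (2 ≤ n →
              (∀ v, (DClique.load L.toFinset v : ℝ) ≤
                (1 / (d.factorial : ℝ) + r n) * ((n : ℝ) ^ (d - 1) / Real.logb 2 n)) ∧
              (L.length : ℝ) ≤ B * ((n : ℝ) ^ d / Real.logb 2 n ^ 3)) ∧
            (N ≤ n → (t : ℝ) ≤ A * ((n : ℝ) ^ d / (d.factorial : ℝ))) := by
  -- Any constant above the limit `13` of the normalised running time works.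
  refine ⟨14, fun d hd => ?_⟩
  have hg : ∀ n : ℕ, 2 ≤ n → 0 < (n : ℝ) ^ (d - 1) / Real.logb 2 n := fun n hn =>
    div_pos (by positivity) (Real.logb_pos one_lt_two (by exact_mod_cast hn))
  have hf : (0 : ℝ) < 1 / (d.factorial : ℝ) := by positivity
  have hlow := UniformHypergraph.tendsto_coverBound hd
  have hmc := fun n => UniformHypergraph.coverBound_le hd (n := n)
  obtain ⟨D, rfl⟩ : ∃ D, d = D + 2 := ⟨d - 2, by omega⟩
  have hup := WordRAM.tendsto_loadBound D
  rw [show D + 2 - 1 = D + 1 from rfl] at *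
  -- The error terms are the exact deviations of the explicit bounds from `1 / d!`, after
  -- normalisation; their maximum serves for both ends of the chain.
  let r₁ : ℕ → ℝ := fun n => 1 / ((D + 2).factorial : ℝ) -
    UniformHypergraph.coverBound (D + 2) n * (Real.logb 2 n / (n : ℝ) ^ (D + 1))
  let r₂ : ℕ → ℝ := fun n => WordRAM.loadBound D n * (Real.logb 2 n / (n : ℝ) ^ (D + 1)) -
    1 / ((D + 2).factorial : ℝ)
  have hr₁ : Filter.Tendsto r₁ Filter.atTop (nhds 0) := by
    simpa only [sub_self] using hlow.const_sub (1 / ((D + 2).factorial : ℝ))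
  have hr₂ : Filter.Tendsto r₂ Filter.atTop (nhds 0) := by
    simpa only [sub_self] using hup.sub_const (1 / ((D + 2).factorial : ℝ))
  have hcancel : ∀ (x : ℝ) (n : ℕ), 2 ≤ n →
      x * (Real.logb 2 n / (n : ℝ) ^ (D + 1)) * ((n : ℝ) ^ (D + 1) / Real.logb 2 n) = x := by
    intro x n hn
    have hn' : (0 : ℝ) < n := by positivity
    have hlog : 0 < Real.logb 2 n := Real.logb_pos one_lt_two (by exact_mod_cast hn)
    field_simp
  have hload : ∀ n : ℕ, 2 ≤ n → WordRAM.loadBound D n =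
      (1 / ((D + 2).factorial : ℝ) + r₂ n) * ((n : ℝ) ^ (D + 1) / Real.logb 2 n) := by
    intro n hn
    simp only [r₂]
    rw [add_sub_cancel, hcancel _ n hn]
  have hcover : ∀ n : ℕ, 2 ≤ n → UniformHypergraph.coverBound (D + 2) n =
      (1 / ((D + 2).factorial : ℝ) - r₁ n) * ((n : ℝ) ^ (D + 1) / Real.logb 2 n) := by
    intro n hn
    simp only [r₁]
    rw [sub_sub_cancel, hcancel _ n hn]
  have hr : Filter.Tendsto (fun n => max (r₁ n) (r₂ n)) Filter.atTop (nhds 0) := by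
    simpa only [max_self] using hr₁.max hr₂
  have hchain : ∀ n : ℕ, 2 ≤ n →
      (1 / ((D + 2).factorial : ℝ) - max (r₁ n) (r₂ n)) * ((n : ℝ) ^ (D + 1) / Real.logb 2 n)
          ≤ (UniformHypergraph.maxMC (D + 2) n : ℝ) / n ∧
      (UniformHypergraph.maxMC (D + 2) n : ℝ) / n ≤
        (UniformHypergraph.maxMP (D + 2) n : ℝ) / n ∧
      (UniformHypergraph.maxMP (D + 2) n : ℝ) / n ≤ (UniformHypergraph.maxLMP (D + 2) n : ℝ) ∧
      (UniformHypergraph.maxLMP (D + 2) n : ℝ) ≤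
        (1 / ((D + 2).factorial : ℝ) + max (r₁ n) (r₂ n)) *
          ((n : ℝ) ^ (D + 1) / Real.logb 2 n) := by
    intro n hn
    refine ⟨?_, ?_, ?_, ?_⟩
    · refine le_trans ?_ ((hcover n hn).symm.le.trans (hmc n hn))
      exact mul_le_mul_of_nonneg_right (sub_le_sub_left (le_max_left _ _) _) (hg n hn).le
    · have := UniformHypergraph.maxMC_le_maxMP (D + 2) n
      gcongr
    · rw [div_le_iff₀ (by positivity), mul_comm]
      exact_mod_cast UniformHypergraph.maxMP_le_mul_maxLMP (D + 2) n
    · refine (UniformHypergraph.maxLMP_le_loadBound D n).trans ((hload n hn).le.trans ?_)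
      exact mul_le_mul_of_nonneg_right (add_le_add_right (le_max_right _ _) _) (hg n hn).le
  obtain ⟨B, hB⟩ := WordRAM.lengthBound_le D
  refine ⟨⟨⟨_, hr, hchain⟩, ?_, ?_, ?_⟩, r₂, B, hr₂, ?_, ?_⟩
  · refine UniformHypergraph.isEquivalent_of_le hf hr hg fun n hn => ?_
    obtain ⟨h1, h2, h3, h4⟩ := hchain n hn
    exact ⟨h1, h2.trans (h3.trans h4)⟩
  · refine UniformHypergraph.isEquivalent_of_le hf hr hg fun n hn => ?_
    obtain ⟨h1, h2, h3, h4⟩ := hchain n hn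
    exact ⟨h1.trans h2, h3.trans h4⟩
  · refine UniformHypergraph.isEquivalent_of_le hf hr hg fun n hn => ?_
    obtain ⟨h1, h2, h3, h4⟩ := hchain n hn
    exact ⟨h1.trans (h2.trans h3), h4⟩
  · intro V _ _ H hV
    obtain ⟨L, -, -, hnodup, hpart, hl, hlen, -⟩ :=
      WordRAM.exists_outputs (H.map (Fintype.equivFin V))
    obtain ⟨C, hC, hcard, hCl⟩ := hpart.of_map
    refine ⟨C, hC, fun v => ?_, ?_⟩
    · rw [hCl, ← hload _ hV]
      exact hl _
    · rw [hcard, List.toFinset_card_of_nodup hnodup]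
      exact hlen.trans (hB _ hV)
  · have htime : ∀ᶠ n : ℕ in Filter.atTop,
        WordRAM.timeBound D n ≤ 14 * ((n : ℝ) ^ (D + 2) / ((D + 2).factorial : ℝ)) := by
      have h14 : 13 / ((D + 2).factorial : ℝ) < 14 / ((D + 2).factorial : ℝ) := by
        gcongr
        norm_num
      filter_upwards [(WordRAM.tendsto_timeBound D).eventually_lt_const h14,
        Filter.eventually_ge_atTop 1] with n h hn
      rw [div_lt_iff₀ (by positivity)] at h
      exact h.le.trans (le_of_eq (by ring))
    obtain ⟨N, hN⟩ := Filter.eventually_atTop.1 htime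
    refine ⟨WordRAM.partitionProgram D, 4 * D + 20, N, fun n H => ?_⟩
    obtain ⟨L, t, hout, hnodup, hpart, hl, hlen, ht⟩ := WordRAM.exists_outputs H
    refine ⟨L, t, hout, hnodup, hpart, fun hn => ⟨fun v => ?_, hlen.trans (hB n hn)⟩,
      fun hn => ht.trans (hN n hn)⟩
    rw [← hload n hn]
    exact hl v
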